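/- **Definitions.** Let $D$ be an integral domain with quotient field $K$. A fractional ideal of $D$ is a $D$-submodule $I$ of $K$ with $dI\subseteq D$ for some nonzero $d$. A *star operation* on $D$ is a map $I\mapsto I^\star$ from the set of fractional ideals of $D$ to itself such that, for all fractional ideals $I,J$ and all $x\in K$: $I\subseteq I^\star$; $I\subseteq J$ implies $I^\star\subseteq J^\star$; $(I^\star)^\star=I^\star$; $x\cdot I^\star=(xI)^\star$; and $D^\star=D$. Let $\mathrm{Star}(D)$ be the set of star operations on $D$. An *overring* of $D$ is a ring $T$ with $D\subseteq T\subseteq K$, and $D$ is *star regular* if $|\mathrm{Star}(D)|\ge|\mathrm{Star}(T)|$ for every overring $T$ of $D$. The *Houston–Mimouni–Park conjecture* states that every one-dimensional Noetherian local domain $D$ with $1<|\mathrm{Star}(D)|<\infty$ is star regular. A numerical semigroup $S$ (a submonoid of $\mathbb N$ with finite complement), with $g=\sup(\mathbb Z\setminus S)$, is *pseudo-symmetric* if $g$ is even and, for every $a\in\mathbb N$ with $a\ne g/2$, either $a\in S$ or $g-a\in S$. Let $V$ be a discrete valuation ring with normalized valuation $v$, and let $R$ be a Noetherian local subring of $V$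 such that $R$ and $V$ have the same quotient field, $V$ is the integral closure of $R$, the conductor $(R:V)$ is nonzero, and the inclusion $R\hookrightarrow V$ induces an isomorphism of residue fields. (Equivalently, $R$ is an analytically irreducible, residually rational one-dimensional Noetherian local domain with integral closure $V$.) Then $R$ is a *Kunz domain* if its value semigroup $v(R)=\{v(r)\mid r\in R\setminus\{0\}\}$ is a pseudo-symmetric numerical semigroup. **Theorem.** Let $R$ be a Kunz domain with finite residue field and with integral closure $V$, and suppose that $\ell_R(V/R)\ge 4$, where $\ell_R$ denotes length as an $R$-module. Then: 1. $1<|\mathrm{Star}(R)|<\infty$; 2. if $g=\sup(\mathbb Z\setminus v(R))$, $y\in V$ is any element with $v(y)=g$, and $T=R[y]$, then $|\mathrm{Star}(R)|<|\mathrm{Star}(T)|$; 3. in particular, $R$ is not star regular. Consequently, the Houston–Mimouni–Park conjecture is false. -/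

import Mathlib

open scoped nonZeroDivisors Cardinal Pointwise

/-- A star operation on a domain `D` with quotient field `K`. The type `FractionalIdeal D⁰ K`
consists of all `D`-submodules `I` of `K` such that `d I ⊆ D` for some nonzero `d`
(including the zero ideal). -/
@[ext]
structure StarOperation (D K : Type*) [CommRing D] [Field K] [Algebra D K] where
  /-- the map `I ↦ I^⋆` -/
  toFun : FractionalIdeal D⁰ K → FractionalIdeal D⁰ K
  le_star : ∀ I, I ≤ toFun I
  mono : ∀ I J, I ≤ J → toFun I ≤ toFun J
  idem : ∀ I, toFun (toFun I) = toFun I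
  /-- `x · I^⋆ = (x I)^⋆`, where `J` is the fractional ideal `x I` -/
  smul_star : ∀ (x : K) (I J : FractionalIdeal D⁰ K),
    (J : Submodule D K) = x • (I : Submodule D K) →
      (toFun J : Submodule D K) = x • (toFun I : Submodule D K)
  star_one : toFun 1 = 1

/-- `D` (with quotient field `K`) is star regular: `|Star(T)| ≤ |Star(D)|` for every overring `T`,
i.e. for every ring `T` with `D ⊆ T ⊆ K`. -/
def IsStarRegular (D K : Type*) [CommRing D] [Field K] [Algebra D K] : Prop :=
  ∀ T : Subalgebra D K, #(StarOperation T K) ≤ #(StarOperation D K)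

/-- The Houston–Mimouni–Park conjecture: every one-dimensional Noetherian local domain `D`
with `1 < |Star(D)| < ∞` is star regular. -/
def HoustonMimouniParkConjecture : Prop :=
  ∀ (D K : Type) [CommRing D] [IsDomain D] [Field K] [Algebra D K] [IsFractionRing D K]
    [IsLocalRing D] [IsNoetherianRing D],
    ringKrullDim D = 1 → 1 < #(StarOperation D K) → #(StarOperation D K) < ℵ₀ →
      IsStarRegular D K

/-- `g = sup (ℤ \ S)`, the supremum being attained. -/
def IsFrobeniusNumberOf (S : AddSubmonoid ℕ) (g : ℤ) : Prop :=
  IsGreatest {n : ℤ | ¬ ∃ s ∈ S, (s : ℤ) = n} g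

/-- `S` is a numerical semigroup (a submonoid of `ℕ` with finite complement) whose Frobenius
number `g` is even, and for every `a ∈ ℕ` with `a ≠ g / 2` either `a ∈ S` or `g - a ∈ S`. -/
def IsPseudoSymmetric (S : AddSubmonoid ℕ) : Prop :=
  ((S : Set ℕ)ᶜ).Finite ∧ ∃ g : ℤ, IsFrobeniusNumberOf S g ∧ Even g ∧
    ∀ a : ℕ, (a : ℤ) ≠ g / 2 → a ∈ S ∨ ∃ s ∈ S, (s : ℤ) = g - a

/-- The value semigroup `v(R) = {v(r) | r ∈ R, r ≠ 0}`, where `v` is the normalized valuation of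
the discrete valuation ring `V`. -/
def valueSemigroup (R V : Type*) [CommRing R] [CommRing V] [IsDomain V]
    [IsDiscreteValuationRing V] [Algebra R V] : AddSubmonoid ℕ where
  carrier := {n | ∃ r : R, IsDiscreteValuationRing.addVal V (algebraMap R V r) = n}
  zero_mem' := ⟨1, by simp⟩
  add_mem' := by
    rintro m n ⟨r, hr⟩ ⟨s, hs⟩
    exact ⟨r * s, by simp [hr, hs]⟩

/-- The Noetherian local ring `R`, sitting in the discrete valuation ring `V` with the same
quotient field `K`, is a Kunz domain. -/
structure IsKunzDomain (R V K : Type*) [CommRing R] [CommRing V] [IsDomain V]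
    [IsDiscreteValuationRing V] [Field K] [Algebra R V] [Algebra R K] [Algebra V K]
    [IsScalarTower R V K] [IsFractionRing R K] [IsFractionRing V K]
    [IsLocalRing R] [IsNoetherianRing R] : Prop where
  /-- `V` is the integral closure of `R` (in `K`) -/
  integralClosure : IsIntegralClosure V R K
  /-- the conductor `(R : V) = {c ∈ K | c V ⊆ R}` is nonzero -/
  conductor_ne_zero : ∃ c : K, c ≠ 0 ∧
    ∀ x : V, ∃ r : R, algebraMap R K r = c * algebraMap V K x
  /-- `R → V` is a local homomorphism, so that it induces a map of residue fields -/
  isLocalHom : IsLocalHom (algebraMap R V)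
  /-- the induced map of residue fields is an isomorphism -/
  residue_bijective :
    Function.Bijective (IsLocalRing.ResidueField.map (algebraMap R V))
  /-- the value semigroup is pseudo-symmetric -/
  pseudoSymmetric : IsPseudoSymmetric (valueSemigroup R V)

/-!
Let `A` be a Kunz domain with quotient field `K`, normalized valuation `v`, maximal ideal `m` and
Frobenius number `g = 2 * τ`, and let `T = A + {x | v x ≥ g}`, which is the ring `R[y]` of the
statement. A star operation amounts to its family of closed ideals, and the families that occur
are those that contain the ring and `0` and are stable under scaling and intersections
(`StarOperation.equivFamily`). Ideals are encoded as additive subgroups of `K`, so that the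
families for `A` and for `T` can be compared.

Two facts describe the fractional ideals of `A`. First, up to scaling each nonzero one is `A`, or
a canonical ideal, or a fractional ideal of `T` (`KunzSubring.classification`). A star operation
that closes a canonical ideal is the identity, by canonical duality, which is proved from value
sets in `KunzSubring.exists_val_colon`. Second, there is an element `z` of value `τ` with `z m ⊆
A`, and every ideal stable under `z`, such as `m`, is closed under all star operations
(`KunzSubring.mem_family_of_socle_stable`). Hence a star operation on `A` other than the identity
is determined by the ideals of `T` that it closes.

If these include `T`, they form a star operation on `T`. Otherwise, adding the multiples of `T`
and removing the multiples of `m` gives one, because `m` is then not the intersection of larger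
ideals in the family (`KunzSubring.P_le_of_maxIdeal_lt`). The two cases are told apart by `m`,
which is closed in the first case only. So the star operations on `A` other than the identity
embed into those on `T`, and each image closes all `z`-stable ideals of `T` that are not multiples
of `m`. If `v(A)` has at least four gaps, there are two star operations on `T` violating this:
their closed ideals are the multiples of `T` and all ideals whose length over the conductor is
small, with or without one further class of ideals (`KunzSubring.shortFamily`,
`KunzSubring.exists_witnesses`). They account for the identity and for strict inequality
(`KunzSubring.exists_option_injective`).

A star operation on `A` is determined by the closed ideals between `A` and its integral closure
`V`, of which there are finitely many if the residue field is finite; and the multiples of `A`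
together with the ideals of `T` form a star operation other than the identity. Finally, the power
series over the field with two elements whose exponents lie in the semigroup `{0, 4, 5, 7, 8, …}`
form a Kunz domain to which all this applies, and which refutes the conjecture.
-/

/-! ### Star operations as families of closed modules -/

/-- The additive subgroup `N` of the field `K` is a fractional ideal of the subring `D`. -/
structure IsFracModule {K : Type*} [Field K] (D : Subring K) (N : AddSubgroup K) : Prop where
  mul_mem : ∀ d ∈ D, ∀ x ∈ N, d * x ∈ N
  exists_denom : ∃ d ∈ D, d ≠ 0 ∧ ∀ x ∈ N, d * x ∈ D

/-- The families of fractional ideals of `D` that occur as the family of closed ideals of a star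
operation. Fractional ideals are encoded as additive subgroups of `K`, so that families for
different subrings of `K` can be compared. -/
structure IsStarFamily {K : Type*} [Field K] (D : Subring K) (F : Set (AddSubgroup K)) :
    Prop where
  frac : ∀ N ∈ F, IsFracModule D N
  ring_mem : D.toAddSubgroup ∈ F
  bot_mem : ⊥ ∈ F
  smul_mem : ∀ x : K, x ≠ 0 → ∀ N ∈ F, x • N ∈ F
  sInf_mem : ∀ G : Set (AddSubgroup K), G ⊆ F → G.Nonempty → sInf G ∈ F

theorem AddSubgroup.mem_smul_iff_exists_mul {K : Type*} [Field K] {x y : K} {N : AddSubgroup K} :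
    y ∈ x • N ↔ ∃ n ∈ N, x * n = y :=
  AddSubgroup.mem_smul_pointwise_iff_exists _ _ _

theorem AddSubgroup.mem_smul_iff_inv_mul_mem {K : Type*} [Field K] {x y : K} {N : AddSubgroup K}
    (hx : x ≠ 0) : y ∈ x • N ↔ x⁻¹ * y ∈ N :=
  AddSubgroup.mem_pointwise_smul_iff_inv_smul_mem₀ hx _ _

theorem AddSubgroup.exists_mem_ne_zero {G : Type*} [AddGroup G] {N : AddSubgroup G}
    (h0 : N ≠ ⊥) : ∃ x ∈ N, x ≠ 0 := by
  by_contra! hcon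
  exact h0 ((AddSubgroup.eq_bot_iff_forall N).2 hcon)

namespace StarOperation

section Families

variable {D K : Type*} [CommRing D] [Field K] [Algebra D K]

/-- The family of closed ideals of a star operation. -/
def closedFamily (s : StarOperation D K) : Set (AddSubgroup K) :=
  {N | ∃ I : FractionalIdeal D⁰ K, s.toFun I = I ∧ (I : Submodule D K).toAddSubgroup = N}

theorem fractionalIdeal_ext_toAddSubgroup {I J : FractionalIdeal D⁰ K}
    (h : (I : Submodule D K).toAddSubgroup = (J : Submodule D K).toAddSubgroup) : I = J :=
  FractionalIdeal.coeToSubmodule_injective (Submodule.toAddSubgroup_injective h)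

theorem closedFamily_injective :
    Function.Injective (closedFamily : StarOperation D K → Set (AddSubgroup K)) := by
  have key : ∀ s t : StarOperation D K, closedFamily s = closedFamily t →
      ∀ I, s.toFun I ≤ t.toFun I := by
    intro s t h I
    have h1 : ((t.toFun I : FractionalIdeal D⁰ K) : Submodule D K).toAddSubgroup ∈
        closedFamily s := by
      rw [h]; exact ⟨t.toFun I, t.idem I, rfl⟩
    obtain ⟨J, hJ, hJe⟩ := h1
    obtain rfl := fractionalIdeal_ext_toAddSubgroup hJe
    calc s.toFun I ≤ s.toFun (t.toFun I) := s.mono _ _ (t.le_star I)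
      _ = t.toFun I := hJ
  intro s t h
  ext1
  funext I
  exact le_antisymm (key s t h I) (key t s h.symm I)

variable [IsDomain D] [IsFractionRing D K]

theorem isFracModule_coe (I : FractionalIdeal D⁰ K) :
    IsFracModule (algebraMap D K).range (I : Submodule D K).toAddSubgroup := by
  refine ⟨?_, ?_⟩
  · rintro _ ⟨d, rfl⟩ x hx
    rw [← Algebra.smul_def]
    exact (I : Submodule D K).smul_mem d hx
  · obtain ⟨a, ha, h⟩ := I.isFractional
    refine ⟨algebraMap D K a, ⟨a, rfl⟩, ?_, ?_⟩
    · exact IsFractionRing.to_map_ne_zero_of_mem_nonZeroDivisors ha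
    · intro x hx
      obtain ⟨d, hd⟩ := h x hx
      exact ⟨d, by rw [hd, Algebra.smul_def]⟩

/-- A fractional ideal, from its underlying additive group. -/
def ofFracModule (N : AddSubgroup K) (hN : IsFracModule (algebraMap D K).range N) :
    FractionalIdeal D⁰ K :=
  ⟨{ N with
      smul_mem' := fun d x hx => by
        rw [Algebra.smul_def]; exact hN.mul_mem _ ⟨d, rfl⟩ x hx }, by
    obtain ⟨_, ⟨d, rfl⟩, hd, h⟩ := hN.exists_denom
    refine ⟨d, mem_nonZeroDivisors_of_ne_zero (fun h0 => hd (by rw [h0, map_zero])), ?_⟩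
    intro x hx
    obtain ⟨e, he⟩ := h x hx
    exact ⟨e, by rw [he, Algebra.smul_def]⟩⟩

omit [IsFractionRing D K] in
theorem mem_ofFracModule {N : AddSubgroup K} {hN : IsFracModule (algebraMap D K).range N} {x : K} :
    x ∈ (ofFracModule N hN : FractionalIdeal D⁰ K) ↔ x ∈ N := Iff.rfl

theorem exists_mul_mem_range (x : K) :
    ∃ d ∈ (algebraMap D K).range, d ≠ 0 ∧ d * x ∈ (algebraMap D K).range := by
  obtain ⟨a, b, hb, rfl⟩ := IsFractionRing.div_surjective (A := D) x
  have hb0 : algebraMap D K b ≠ 0 := IsFractionRing.to_map_ne_zero_of_mem_nonZeroDivisors hb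
  exact ⟨algebraMap D K b, ⟨b, rfl⟩, hb0, a, by field_simp⟩

theorem isFracModule_smul {N : AddSubgroup K} (hN : IsFracModule (algebraMap D K).range N)
    (x : K) : IsFracModule (algebraMap D K).range (x • N) := by
  refine ⟨?_, ?_⟩
  · intro d hd y hy
    obtain ⟨n, hn, rfl⟩ := AddSubgroup.mem_smul_iff_exists_mul.1 hy
    exact AddSubgroup.mem_smul_iff_exists_mul.2 ⟨d * n, hN.mul_mem d hd n hn, by ring⟩
  · obtain ⟨d, hd, hd0, h⟩ := hN.exists_denom
    obtain ⟨e, he, he0, h'⟩ := exists_mul_mem_range (D := D) x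
    refine ⟨d * e, mul_mem hd he, mul_ne_zero hd0 he0, ?_⟩
    intro y hy
    obtain ⟨n, hn, rfl⟩ := AddSubgroup.mem_smul_iff_exists_mul.1 hy
    have : d * e * (x * n) = (e * x) * (d * n) := by ring
    rw [this]
    exact mul_mem h' (h n hn)

omit [IsDomain D] [IsFractionRing D K] in
theorem isFracModule_of_le {N N' : AddSubgroup K}
    (hN : ∀ d ∈ (algebraMap D K).range, ∀ x ∈ N, d * x ∈ N)
    (h : N ≤ N') (hN' : IsFracModule (algebraMap D K).range N') :
    IsFracModule (algebraMap D K).range N := by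
  obtain ⟨d, hd, hd0, h'⟩ := hN'.exists_denom
  exact ⟨hN, d, hd, hd0, fun x hx => h' x (h hx)⟩

theorem isStarFamily_closedFamily (s : StarOperation D K) :
    IsStarFamily (algebraMap D K).range s.closedFamily where
  frac := by
    rintro N ⟨I, -, rfl⟩
    exact isFracModule_coe I
  ring_mem := by
    refine ⟨1, s.star_one, ?_⟩
    ext x
    simp
  bot_mem := by
    refine ⟨0, ?_, ?_⟩
    · apply FractionalIdeal.coeToSubmodule_injective
      have := s.smul_star 0 1 0 (by simp)
      simpa using this
    · ext x; simp
  smul_mem := by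
    rintro x hx N ⟨I, hI, rfl⟩
    have h1 := isFracModule_smul (isFracModule_coe I) x
    refine ⟨ofFracModule _ h1, ?_, rfl⟩
    have h2 : ((ofFracModule _ h1 : FractionalIdeal D⁰ K) : Submodule D K) =
        x • (I : Submodule D K) := by
      apply Submodule.toAddSubgroup_injective
      rfl
    apply FractionalIdeal.coeToSubmodule_injective
    simp only
    rw [s.smul_star x I _ h2, hI, h2]
  sInf_mem := by
    intro G hG hne
    have hfr : ∀ N ∈ G, IsFracModule (algebraMap D K).range N := by
      intro N hN
      obtain ⟨I, -, rfl⟩ := hG hN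
      exact isFracModule_coe I
    obtain ⟨N₀, hN₀⟩ := hne
    have h1 : IsFracModule (algebraMap D K).range (sInf G) := by
      refine isFracModule_of_le ?_ (sInf_le hN₀) (hfr _ hN₀)
      intro d hd x hx
      rw [AddSubgroup.mem_sInf] at hx ⊢
      exact fun N hN => (hfr N hN).mul_mem d hd x (hx N hN)
    refine ⟨ofFracModule _ h1, le_antisymm ?_ (s.le_star _), rfl⟩
    intro x hx
    rw [mem_ofFracModule, AddSubgroup.mem_sInf]
    intro N hN
    obtain ⟨I, hI, rfl⟩ := hG hN
    have h2 : ofFracModule _ h1 ≤ I := by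
      intro y hy
      exact (sInf_le hN : sInf G ≤ _) hy
    have h3 := s.mono _ _ h2
    rw [hI] at h3
    exact h3 hx

/-- The star operation with a given family of closed ideals: an ideal is sent to the
intersection of the members of the family that contain it. -/
def ofFamily (F : Set (AddSubgroup K)) (hF : IsStarFamily (algebraMap D K).range F) :
    StarOperation D K :=
  have hne : ∀ I : FractionalIdeal D⁰ K,
      {N ∈ F | (I : Submodule D K).toAddSubgroup ≤ N}.Nonempty := by
    intro I
    obtain ⟨d, hd, hd0, h⟩ := (isFracModule_coe I).exists_denom
    refine ⟨d⁻¹ • (algebraMap D K).range.toAddSubgroup,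
      hF.smul_mem _ (inv_ne_zero hd0) _ hF.ring_mem, ?_⟩
    intro x hx
    rw [AddSubgroup.mem_smul_iff_inv_mul_mem (inv_ne_zero hd0), inv_inv]
    exact h x hx
  have hmem : ∀ I : FractionalIdeal D⁰ K,
      sInf {N ∈ F | (I : Submodule D K).toAddSubgroup ≤ N} ∈ F := fun I =>
    hF.sInf_mem _ (fun _ h => h.1) (hne I)
  have hmin : ∀ (I : FractionalIdeal D⁰ K) (N : AddSubgroup K), N ∈ F →
      (I : Submodule D K).toAddSubgroup ≤ N →
      sInf {N ∈ F | (I : Submodule D K).toAddSubgroup ≤ N} ≤ N := fun I N hN hle =>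
    sInf_le ⟨hN, hle⟩
  have hle : ∀ I : FractionalIdeal D⁰ K, (I : Submodule D K).toAddSubgroup ≤
      sInf {N ∈ F | (I : Submodule D K).toAddSubgroup ≤ N} := fun I =>
    le_sInf fun _ h => h.2
  { toFun := fun I => ofFracModule _ (hF.frac _ (hmem I))
    le_star := fun I x hx => hle I hx
    mono := by
      intro I J hIJ x hx
      exact hmin I _ (hmem J) (le_trans (fun y hy => hIJ hy) (hle J)) hx
    idem := by
      intro I
      apply le_antisymm
      · intro x hx
        exact hmin (ofFracModule _ (hF.frac _ (hmem I))) _ (hmem I) le_rfl hx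
      · intro x hx
        exact hle (ofFracModule _ (hF.frac _ (hmem I))) hx
    smul_star := by
      intro x I J hJ
      apply Submodule.toAddSubgroup_injective
      change (sInf _ : AddSubgroup K) = x • (sInf _ : AddSubgroup K)
      have hJ' : (J : Submodule D K).toAddSubgroup = x • (I : Submodule D K).toAddSubgroup := by
        rw [hJ]; rfl
      by_cases hx : x = 0
      · subst hx
        have h0 : ∀ N : AddSubgroup K, (0 : K) • N = ⊥ := by
          intro N
          ext y
          rw [AddSubgroup.mem_smul_iff_exists_mul]
          constructor
          · rintro ⟨n, -, rfl⟩; simp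
          · intro hy
            exact ⟨0, zero_mem _, by simpa using hy.symm⟩
        rw [h0, eq_bot_iff]
        exact hmin J _ hF.bot_mem (by rw [hJ', h0])
      · apply le_antisymm
        · refine hmin J _ (hF.smul_mem x hx _ (hmem I)) ?_
          rw [hJ']
          intro y hy
          obtain ⟨n, hn, rfl⟩ := AddSubgroup.mem_smul_iff_exists_mul.1 hy
          exact AddSubgroup.mem_smul_iff_exists_mul.2 ⟨n, hle I hn, rfl⟩
        · have h1 := hmin I _ (hF.smul_mem x⁻¹ (inv_ne_zero hx) _ (hmem J)) (by
            intro y hy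
            rw [AddSubgroup.mem_smul_iff_inv_mul_mem (inv_ne_zero hx), inv_inv]
            apply hle J
            rw [hJ']
            exact AddSubgroup.mem_smul_iff_exists_mul.2 ⟨y, hy, rfl⟩)
          intro y hy
          obtain ⟨n, hn, rfl⟩ := AddSubgroup.mem_smul_iff_exists_mul.1 hy
          have := h1 hn
          rwa [AddSubgroup.mem_smul_iff_inv_mul_mem (inv_ne_zero hx), inv_inv] at this
    star_one := by
      have h1 : ((1 : FractionalIdeal D⁰ K) : Submodule D K).toAddSubgroup =
          (algebraMap D K).range.toAddSubgroup := by
        ext x; simp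
      apply le_antisymm
      · intro x hx
        have := hmin 1 _ hF.ring_mem h1.le hx
        rw [← h1] at this
        exact this
      · intro x hx
        exact hle 1 hx }

theorem closedFamily_ofFamily (F : Set (AddSubgroup K))
    (hF : IsStarFamily (algebraMap D K).range F) :
    (ofFamily F hF).closedFamily = F := by
  have hcl : ∀ I : FractionalIdeal D⁰ K, (((ofFamily F hF).toFun I : FractionalIdeal D⁰ K) :
      Submodule D K).toAddSubgroup = sInf {N ∈ F | (I : Submodule D K).toAddSubgroup ≤ N} :=
    fun I => rfl
  ext N
  constructor
  · rintro ⟨I, hI, rfl⟩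
    rw [← hI, hcl]
    refine hF.sInf_mem _ (fun _ h => h.1) ?_
    obtain ⟨d, hd, hd0, h⟩ := (isFracModule_coe I).exists_denom
    refine ⟨d⁻¹ • (algebraMap D K).range.toAddSubgroup,
      hF.smul_mem _ (inv_ne_zero hd0) _ hF.ring_mem, ?_⟩
    intro x hx
    rw [AddSubgroup.mem_smul_iff_inv_mul_mem (inv_ne_zero hd0), inv_inv]
    exact h x hx
  · intro hN
    refine ⟨ofFracModule N (hF.frac N hN), ?_, rfl⟩
    apply fractionalIdeal_ext_toAddSubgroup
    rw [hcl]
    apply le_antisymm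
    · exact sInf_le ⟨hN, le_rfl⟩
    · exact le_sInf fun _ h => h.2

variable (D K) in
/-- A star operation is the same as its family of closed ideals. -/
noncomputable def equivFamily :
    StarOperation D K ≃ {F // IsStarFamily (algebraMap D K).range F} :=
  Equiv.ofBijective (fun s => ⟨s.closedFamily, isStarFamily_closedFamily s⟩)
    ⟨fun _ _ h => closedFamily_injective (congrArg Subtype.val h),
      fun F => ⟨ofFamily F.1 F.2, Subtype.ext (closedFamily_ofFamily F.1 F.2)⟩⟩

end Families

end StarOperation

/-! ### Valued fields and value sets -/

/-- The set of values of the nonzero elements of `N`. -/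
def valSet {K : Type*} [Field K] (v : K → ℤ) (N : AddSubgroup K) : Set ℤ :=
  {n | ∃ x ∈ N, x ≠ 0 ∧ v x = n}

/-- A subring `A` of a field `K` with a discrete valuation `v` (whose value at `0` is irrelevant)
such that `A` is local, residually rational, contains all elements of value larger than `2 * τ`,
and has a pseudo-symmetric value semigroup with Frobenius number `2 * τ`. -/
structure PseudoSymmetricSubring {K : Type*} [Field K] (A : Subring K) (v : K → ℤ) (τ : ℤ) :
    Prop where
  val_mul : ∀ x y, x ≠ 0 → y ≠ 0 → v (x * y) = v x + v y
  le_val_add : ∀ n x y, x ≠ 0 → y ≠ 0 → x + y ≠ 0 → n ≤ v x → n ≤ v y → n ≤ v (x + y)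
  val_nonneg : ∀ a ∈ A, a ≠ 0 → 0 ≤ v a
  inv_mem : ∀ a ∈ A, a ≠ 0 → v a = 0 → a⁻¹ ∈ A
  residue : ∀ x y, x ≠ 0 → y ≠ 0 → v x = v y →
    ∃ a ∈ A, a ≠ 0 ∧ v a = 0 ∧ (x - a * y = 0 ∨ v x + 1 ≤ v (x - a * y))
  mem_of_val : ∀ x, x ≠ 0 → 2 * τ + 1 ≤ v x → x ∈ A
  frobenius : 2 * τ ∉ valSet v A.toAddSubgroup
  symm : ∀ n, n ≠ τ → n ∈ valSet v A.toAddSubgroup ∨ 2 * τ - n ∈ valSet v A.toAddSubgroup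
  one_le : 1 ≤ τ

/-- A pseudo-symmetric subring whose value semigroup has at least four gaps. -/
structure KunzSubring {K : Type*} [Field K] (A : Subring K) (v : K → ℤ) (τ : ℤ) : Prop extends
    PseudoSymmetricSubring A v τ where
  three_le : 3 ≤ τ

theorem valSet_mono {K : Type*} [Field K] {v : K → ℤ} {N N' : AddSubgroup K} (hN : N ≤ N') :
    valSet v N ⊆ valSet v N' := by
  rintro _ ⟨x, hx, h0, rfl⟩
  exact ⟨x, hN hx, h0, rfl⟩

namespace PseudoSymmetricSubring

variable {K : Type*} [Field K] {A : Subring K} {v : K → ℤ} {τ : ℤ}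

section Basic

variable (h : PseudoSymmetricSubring A v τ)
include h

theorem val_one : v 1 = 0 := by
  have := h.val_mul 1 1 one_ne_zero one_ne_zero
  simp at this
  exact this

theorem val_neg (x : K) : v (-x) = v x := by
  by_cases hx : x = 0
  · simp [hx]
  have h1 := h.val_mul (-1) (-1) (by simp) (by simp)
  have h2 := h.val_mul (-1) x (by simp) hx
  simp only [mul_neg, mul_one, neg_neg, neg_mul, one_mul] at h1 h2
  rw [h.val_one] at h1
  omega

theorem val_inv {x : K} (hx : x ≠ 0) : v x⁻¹ = - v x := by
  have := h.val_mul x x⁻¹ hx (inv_ne_zero hx)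
  rw [mul_inv_cancel₀ hx, h.val_one] at this
  omega

/-- The elements of value at least `n`, together with `0`. -/
def P (n : ℤ) : AddSubgroup K where
  carrier := {x | x ≠ 0 → n ≤ v x}
  zero_mem' := fun h0 => absurd rfl h0
  add_mem' := by
    intro x y hx hy hxy
    by_cases hx0 : x = 0
    · subst hx0; simp only [zero_add] at hxy ⊢; exact hy hxy
    by_cases hy0 : y = 0
    · subst hy0; simp only [add_zero] at hxy ⊢; exact hx hxy
    exact h.le_val_add n x y hx0 hy0 hxy (hx hx0) (hy hy0)
  neg_mem' := by
    intro x hx hx0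
    rw [h.val_neg]
    exact hx (neg_ne_zero.1 hx0)

theorem mem_P_of_le {n : ℤ} {x : K} (hx : n ≤ v x) : x ∈ h.P n := fun _ => hx

theorem P_anti {m n : ℤ} (hmn : m ≤ n) : h.P n ≤ h.P m := fun _ hx h0 => hmn.trans (hx h0)

theorem mul_mem_P {m n : ℤ} {x y : K} (hx : x ∈ h.P m) (hy : y ∈ h.P n) :
    x * y ∈ h.P (m + n) := by
  intro h0
  have hx0 := left_ne_zero_of_mul h0
  have hy0 := right_ne_zero_of_mul h0
  rw [h.val_mul x y hx0 hy0]
  exact add_le_add (hx hx0) (hy hy0)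

theorem val_add_of_mem {x y : K} (hx : x ≠ 0) (hy : y ∈ h.P (v x + 1)) :
    x + y ≠ 0 ∧ v (x + y) = v x := by
  have h1 : x ∉ h.P (v x + 1) := fun hh => by have := hh hx; omega
  have h2 : x + y ∉ h.P (v x + 1) := fun hh => h1 (by
    have := sub_mem hh hy
    rwa [add_sub_cancel_right] at this)
  have h3 : x + y ∈ h.P (v x) :=
    add_mem (h.mem_P_of_le le_rfl) (h.P_anti (by omega) hy)
  have h4 : x + y ≠ 0 := fun h0 => h2 (by rw [h0]; exact zero_mem _)
  refine ⟨h4, ?_⟩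
  have h5 := h3 h4
  by_contra hne
  exact h2 (h.mem_P_of_le (by omega))

theorem exists_unit_mul {x y : K} (hx : x ≠ 0) (hy : y ≠ 0) (hxy : v x = v y) :
    ∃ a ∈ A, a ≠ 0 ∧ v a = 0 ∧ x - a * y ∈ h.P (v x + 1) := by
  obtain ⟨a, ha, ha0, hva, h1⟩ := h.residue x y hx hy hxy
  exact ⟨a, ha, ha0, hva, fun hne => h1.resolve_left hne⟩

theorem le_P_zero : A.toAddSubgroup ≤ h.P 0 := fun a ha h0 => h.val_nonneg a ha h0

theorem P_le : h.P (2 * τ + 1) ≤ A.toAddSubgroup := by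
  intro x hx
  by_cases h0 : x = 0
  · rw [h0]; exact zero_mem _
  · exact h.mem_of_val x h0 (hx h0)

theorem zero_mem_valSet : 0 ∈ valSet v A.toAddSubgroup :=
  ⟨1, A.one_mem, one_ne_zero, h.val_one⟩

theorem nonneg_of_mem_valSet {n : ℤ} (hn : n ∈ valSet v A.toAddSubgroup) : 0 ≤ n := by
  obtain ⟨x, hx, h0, rfl⟩ := hn
  exact h.val_nonneg x hx h0

theorem add_mem_valSet {N : AddSubgroup K} (hN : ∀ a ∈ A, ∀ x ∈ N, a * x ∈ N) {m n : ℤ}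
    (hm : m ∈ valSet v A.toAddSubgroup) (hn : n ∈ valSet v N) : m + n ∈ valSet v N := by
  obtain ⟨x, hx, hx0, rfl⟩ := hm
  obtain ⟨y, hy, hy0, rfl⟩ := hn
  exact ⟨x * y, hN x hx y hy, mul_ne_zero hx0 hy0, h.val_mul x y hx0 hy0⟩

theorem add_mem_valSet_self {m n : ℤ}
    (hm : m ∈ valSet v A.toAddSubgroup) (hn : n ∈ valSet v A.toAddSubgroup) :
    m + n ∈ valSet v A.toAddSubgroup :=
  h.add_mem_valSet (fun _ ha _ hx => A.mul_mem ha hx) hm hn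

theorem not_mem_valSet_sub {n : ℤ} (hn : n ∈ valSet v A.toAddSubgroup) :
    2 * τ - n ∉ valSet v A.toAddSubgroup := by
  intro hn'
  have := h.add_mem_valSet_self hn hn'
  rw [add_sub_cancel] at this
  exact h.frobenius this

theorem tau_not_mem : τ ∉ valSet v A.toAddSubgroup := by
  intro hn
  have := h.add_mem_valSet_self hn hn
  rw [← two_mul] at this
  exact h.frobenius this

theorem mem_valSet_of_gt {n : ℤ} (hn : 2 * τ < n) : n ∈ valSet v A.toAddSubgroup := by
  have h3 := h.one_le
  rcases h.symm n (by omega) with h1 | h1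
  · exact h1
  · have := h.nonneg_of_mem_valSet h1
    omega

theorem exists_val_eq (n : ℤ) : ∃ x : K, x ≠ 0 ∧ v x = n := by
  have h3 := h.one_le
  obtain ⟨a, -, ha0, ha⟩ := h.mem_valSet_of_gt (n := 2 * τ + 1 + |n| + n)
    (by have := neg_abs_le n; omega)
  obtain ⟨b, -, hb0, hb⟩ := h.mem_valSet_of_gt (n := 2 * τ + 1 + |n|)
    (by have := abs_nonneg n; omega)
  refine ⟨a * b⁻¹, mul_ne_zero ha0 (inv_ne_zero hb0), ?_⟩
  rw [h.val_mul a b⁻¹ ha0 (inv_ne_zero hb0), h.val_inv hb0]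
  omega

theorem mul_nat_mem_valSet {m : ℤ} (hm : m ∈ valSet v A.toAddSubgroup) (k : ℕ) :
    (k : ℤ) * m ∈ valSet v A.toAddSubgroup := by
  induction k with
  | zero => simpa using h.zero_mem_valSet
  | succ k ih =>
    have := h.add_mem_valSet_self ih hm
    convert this using 1
    push_cast; ring

theorem one_not_mem : (1 : ℤ) ∉ valSet v A.toAddSubgroup := by
  intro h1
  have h3 := h.one_le
  have := h.mul_nat_mem_valSet h1 τ.toNat
  rw [Int.toNat_of_nonneg (by omega), mul_one] at this
  exact h.tau_not_mem this

theorem two_not_mem : (2 : ℤ) ∉ valSet v A.toAddSubgroup := by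
  intro h1
  have h3 := h.one_le
  have := h.mul_nat_mem_valSet h1 τ.toNat
  rw [Int.toNat_of_nonneg (by omega), mul_comm] at this
  exact h.frobenius this

/-- Comparison of modules by values: a subgroup all of whose values are attained in an
`A`-submodule is contained in this submodule, as soon as the latter has a conductor. -/
theorem le_of_valSet_subset {N N' : AddSubgroup K} (hN : ∀ a ∈ A, ∀ x ∈ N, a * x ∈ N)
    {c : ℤ} (hc : h.P c ≤ N) (hle : N ≤ N') (hv : valSet v N' ⊆ valSet v N) : N' ≤ N := by
  have key : ∀ k : ℕ, ∀ x ∈ N', x ∈ h.P (c - k) → x ∈ N := by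
    intro k
    induction k with
    | zero => intro x _ hx; exact hc (by simpa using hx)
    | succ k ih =>
      intro x hx hxP
      by_cases h0 : x = 0
      · rw [h0]; exact zero_mem _
      obtain ⟨y, hy, hy0, hyx⟩ := hv ⟨x, hx, h0, rfl⟩
      obtain ⟨a, ha, ha0, -, hr⟩ := h.exists_unit_mul h0 hy0 hyx.symm
      have h1 := ih (x - a * y) (sub_mem hx (hle (hN a ha y hy))) (by
        refine h.P_anti ?_ hr
        have := hxP h0
        push_cast at this
        omega)
      have := add_mem h1 (hN a ha y hy)
      rwa [sub_add_cancel] at this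
  intro x hx
  refine key (c - v x).toNat x hx (h.mem_P_of_le ?_)
  omega

/-- A module containing an element of value `n` and all elements of larger value contains all
elements of value at least `n`. -/
theorem P_le_of_mem_valSet {N : AddSubgroup K} (hN : ∀ a ∈ A, ∀ x ∈ N, a * x ∈ N) {n : ℤ}
    (hP : h.P (n + 1) ≤ N) (hn : n ∈ valSet v N) : h.P n ≤ N := by
  have h1 : h.P n ⊔ N ≤ N := by
    refine h.le_of_valSet_subset hN hP le_sup_right ?_
    rintro _ ⟨x, hx, h0, rfl⟩
    obtain ⟨y, hy, w, hw, rfl⟩ := AddSubgroup.mem_sup.1 hx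
    by_cases hyn : v y = n ∧ y ≠ 0
    · obtain ⟨u, hu, hu0, huv⟩ := hn
      obtain ⟨a, ha, ha0, -, hr⟩ := h.exists_unit_mul hyn.2 hu0 (hyn.1.trans huv.symm)
      rw [hyn.1] at hr
      have hyN : y ∈ N := by
        have := add_mem (hP hr) (hN a ha u hu)
        rwa [sub_add_cancel] at this
      exact ⟨y + w, add_mem hyN hw, h0, rfl⟩
    · have hyN : y ∈ N := hP (fun hy0 => by
        have := hy hy0
        have hne : v y ≠ n := fun hh => hyn ⟨hh, hy0⟩
        omega)
      exact ⟨y + w, add_mem hyN hw, h0, rfl⟩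
  exact le_sup_left.trans h1

end Basic

end PseudoSymmetricSubring

/-! ### Duality with respect to a canonical module -/

namespace KunzSubring

variable {K : Type*} [Field K] {A : Subring K} {v : K → ℤ} {τ : ℤ}

section Duality

variable (h : KunzSubring A v τ)
include h

/-- The maximal ideal of `A`. -/
def maxIdeal : AddSubgroup K := A.toAddSubgroup ⊓ h.P 1

theorem mem_maxIdeal_of_val {x : K} (hx : x ∈ A) (h1 : 1 ≤ v x) : x ∈ h.maxIdeal :=
  ⟨hx, h.mem_P_of_le h1⟩

theorem mem_maxIdeal_or {x : K} (hx : x ∈ A) : x ∈ h.maxIdeal ∨ (x ≠ 0 ∧ v x = 0) := by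
  by_cases h0 : x = 0
  · left; rw [h0]; exact zero_mem _
  have h1 := h.val_nonneg x hx h0
  rcases eq_or_lt_of_le h1 with h2 | h2
  · exact Or.inr ⟨h0, h2.symm⟩
  · exact Or.inl (h.mem_maxIdeal_of_val hx h2)

/-- Let `I` be an `A`-module containing all elements of value larger than the Frobenius number
`g = 2 * τ`, but none of value `g`, and suppose that `(I : m)` has length one over `I`. Then
the colon module `(I : L)` has the largest value set that `g ∉ v(I)` permits. The proof adds to
`L ∩ P c` one value at a time: this shrinks the value set of the colon module by at most one
element, because `(I : m) / I` has length one, and by at least one element, because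
`g ∉ v(I)`. -/
theorem exists_val_colon {I : AddSubgroup K} (hI : ∀ a ∈ A, ∀ x ∈ I, a * x ∈ I)
    (hIP : h.P (2 * τ + 1) ≤ I) (hIg : 2 * τ ∉ valSet v I)
    (hIm : ∀ x, (∀ a ∈ h.maxIdeal, a * x ∈ I) → ∃ i ∈ I, x - i ∈ h.P (2 * τ))
    {L : AddSubgroup K} (hL : ∀ a ∈ A, ∀ x ∈ L, a * x ∈ L) {b c : ℤ} (hb : L ≤ h.P b)
    (hc : h.P c ≤ L) {n : ℤ} (hn : n ∉ valSet v L) :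
    ∃ α, α ≠ 0 ∧ v α = 2 * τ - n ∧ ∀ x ∈ L, α * x ∈ I := by
  have key : ∀ k : ℕ, ∀ n, n ∉ valSet v (L ⊓ h.P (c - k)) →
      ∃ α, α ≠ 0 ∧ v α = 2 * τ - n ∧ ∀ x ∈ L ⊓ h.P (c - k), α * x ∈ I := by
    intro k
    induction k with
    | zero =>
      intro n hn
      have hnc : n < c := by
        by_contra hcn
        obtain ⟨x, hx0, hx⟩ := h.exists_val_eq n
        have hxc : x ∈ h.P c := h.mem_P_of_le (by omega)
        exact hn ⟨x, ⟨hc hxc, by simpa using hxc⟩, hx0, hx⟩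
      obtain ⟨α, hα0, hα⟩ := h.exists_val_eq (2 * τ - n)
      refine ⟨α, hα0, hα, fun x hx => hIP ?_⟩
      have hx2 : x ∈ h.P c := by simpa using hx.2
      exact h.P_anti (by omega) (h.mul_mem_P (h.mem_P_of_le hα.ge) hx2)
    | succ k ih =>
      intro n hn
      set j : ℤ := c - (k + 1 : ℕ) with hj
      have hjk : c - (k : ℤ) = j + 1 := by rw [hj]; push_cast; ring
      rw [hjk] at ih
      by_cases hx : ∃ x ∈ L, x ≠ 0 ∧ v x = j
      · obtain ⟨x, hxL, hx0, hxj⟩ := hx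
        have hsub : L ⊓ h.P (j + 1) ≤ L ⊓ h.P j :=
          inf_le_inf_left _ (h.P_anti (by omega))
        have hnk : n ∉ valSet v (L ⊓ h.P (j + 1)) := fun hh => hn (valSet_mono hsub hh)
        have hjn : j ∉ valSet v (L ⊓ h.P (j + 1)) := by
          rintro ⟨y, hy, hy0, hyj⟩
          have := hy.2 hy0
          omega
        have hne : n ≠ j := by
          rintro rfl
          exact hn ⟨x, ⟨hxL, h.mem_P_of_le hxj.ge⟩, hx0, hxj⟩
        obtain ⟨α, hα0, hα, hαI⟩ := ih n hnk
        obtain ⟨β, hβ0, hβ, hβI⟩ := ih j hjn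
        -- a multiplier of the smaller module that also takes `x` into `I` is a multiplier of
        -- the larger one
        have hext : ∀ γ, (∀ y ∈ L ⊓ h.P (j + 1), γ * y ∈ I) → γ * x ∈ I →
            ∀ y ∈ L ⊓ h.P j, γ * y ∈ I := by
          intro γ hγ hγx y hy
          by_cases hyj : y ∈ h.P (j + 1)
          · exact hγ y ⟨hy.1, hyj⟩
          have hy0 : y ≠ 0 := fun h0 => hyj (by rw [h0]; exact zero_mem _)
          have hyv : v y = j := by
            have h1 := hy.2 hy0
            have h2 : ¬ j + 1 ≤ v y := fun hh => hyj (h.mem_P_of_le hh)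
            omega
          obtain ⟨a, ha, ha0, -, hr⟩ := h.exists_unit_mul hy0 hx0 (hyv.trans hxj.symm)
          rw [hyv] at hr
          have h1 := hγ (y - a * x) ⟨L.sub_mem hy.1 (hL a ha x hxL), hr⟩
          have h2 := hI a ha _ hγx
          have := add_mem h1 h2
          convert this using 1
          ring
        have hmx : ∀ γ, (∀ y ∈ L ⊓ h.P (j + 1), γ * y ∈ I) →
            ∃ i ∈ I, γ * x - i ∈ h.P (2 * τ) := by
          intro γ hγ
          apply hIm
          intro a ha
          have h1 : a * x ∈ L ⊓ h.P (j + 1) := by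
            refine ⟨hL a ha.1 x hxL, ?_⟩
            have := h.mul_mem_P ha.2 (h.mem_P_of_le hxj.ge)
            rwa [add_comm] at this
          have := hγ _ h1
          convert this using 1
          ring
        by_cases hαx : α * x ∈ I
        · exact ⟨α, hα0, hα, hext α hαI hαx⟩
        obtain ⟨i, hi, hp⟩ := hmx α hαI
        have hβx : v (β * x) = 2 * τ := by rw [h.val_mul β x hβ0 hx0]; omega
        have hp0 : α * x - i ≠ 0 := fun h0 => hαx (by rw [sub_eq_zero.1 h0]; exact hi)
        have hpv : v (α * x - i) = 2 * τ := by
          have h1 := hp hp0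
          by_contra hne'
          have h2 : α * x - i ∈ I := hIP (h.mem_P_of_le (by omega))
          exact hαx (by have := add_mem h2 hi; rwa [sub_add_cancel] at this)
        obtain ⟨a, ha, ha0, hav, hr⟩ := h.exists_unit_mul hp0 (mul_ne_zero hβ0 hx0)
          (hpv.trans hβx.symm)
        rw [hpv] at hr
        have hγx : (α - a * β) * x ∈ I := by
          have := add_mem (hIP hr) hi
          convert this using 1
          ring
        have hγI : ∀ y ∈ L ⊓ h.P (j + 1), (α - a * β) * y ∈ I := by
          intro y hy
          have := sub_mem (hαI y hy) (hI a ha _ (hβI y hy))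
          convert this using 1
          ring
        have haβ0 : a * β ≠ 0 := mul_ne_zero ha0 hβ0
        have haβ : v (a * β) = 2 * τ - j := by rw [h.val_mul a β ha0 hβ0]; omega
        rcases lt_or_gt_of_ne hne with hlt | hgt
        · -- the value of `α` is the larger one, and the new multiplier has value `2 * τ - j`,
          -- which would put an element of value `2 * τ` into `I`
          exfalso
          have h1 := h.val_add_of_mem (x := -(a * β)) (y := α) (neg_ne_zero.2 haβ0)
            (h.mem_P_of_le (by rw [h.val_neg]; omega))
          rw [neg_add_eq_sub, h.val_neg] at h1
          apply hIg
          refine ⟨_, hγx, mul_ne_zero h1.1 hx0, ?_⟩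
          rw [h.val_mul _ x h1.1 hx0]
          omega
        · have h1 := h.val_add_of_mem (x := α) (y := -(a * β)) hα0
            (h.mem_P_of_le (by rw [h.val_neg]; omega))
          rw [← sub_eq_add_neg] at h1
          exact ⟨α - a * β, h1.1, h1.2.trans hα, hext _ hγI hγx⟩
      · have heq : L ⊓ h.P j = L ⊓ h.P (j + 1) := by
          apply le_antisymm
          · rintro y ⟨hyL, hyj⟩
            refine ⟨hyL, fun hy0 => ?_⟩
            have h1 := hyj hy0
            have h2 : v y ≠ j := fun hh => hx ⟨y, hyL, hy0, hh⟩
            omega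
          · exact inf_le_inf_left _ (h.P_anti (by omega))
        rw [heq] at hn ⊢
        exact ih n hn
  have hk : L ⊓ h.P (c - ((c - b).toNat : ℤ)) = L := by
    apply inf_eq_left.2
    exact hb.trans (h.P_anti (by omega))
  have := key (c - b).toNat n
  rw [hk] at this
  exact this hn

/-- The separation property behind canonical duality: `L = (I : (I : L))`. -/
theorem exists_mul_not_mem {I : AddSubgroup K} (hI : ∀ a ∈ A, ∀ x ∈ I, a * x ∈ I)
    (hIP : h.P (2 * τ + 1) ≤ I) (hIg : 2 * τ ∉ valSet v I)
    (hIm : ∀ x, (∀ a ∈ h.maxIdeal, a * x ∈ I) → ∃ i ∈ I, x - i ∈ h.P (2 * τ))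
    {L : AddSubgroup K} (hL : ∀ a ∈ A, ∀ x ∈ L, a * x ∈ L) {b c : ℤ} (hb : L ≤ h.P b)
    (hc : h.P c ≤ L) {x : K} (hx : x ∉ L) :
    ∃ α, α ≠ 0 ∧ (∀ y ∈ L, α * y ∈ I) ∧ α * x ∉ I := by
  -- `x` may be modified by elements of `L`, hence assumed to have a value that `L` lacks
  have key : ∃ y ∈ L, x - y ≠ 0 ∧ v (x - y) ∉ valSet v L := by
    by_contra! hcon
    apply hx
    have key : ∀ k : ℕ, ∀ y ∈ L, x - y ∈ h.P (c - k) → x ∈ L := by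
      intro k
      induction k with
      | zero =>
        intro y hy hxy
        have := add_mem (hc (by simpa using hxy)) hy
        rwa [sub_add_cancel] at this
      | succ k ih =>
        intro y hy hxy
        by_cases h0 : x - y = 0
        · rw [sub_eq_zero.1 h0]; exact hy
        obtain ⟨w, hw, hw0, hwv⟩ := hcon y hy h0
        obtain ⟨a, ha, ha0, -, hr⟩ := h.exists_unit_mul h0 hw0 hwv.symm
        refine ih (y + a * w) (add_mem hy (hL a ha w hw)) ?_
        rw [← sub_sub]
        refine h.P_anti ?_ hr
        have := hxy h0
        push_cast at this
        omega
    refine key (c - v x).toNat 0 (zero_mem _) ?_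
    rw [sub_zero]
    exact h.mem_P_of_le (by omega)
  obtain ⟨y, hy, hne, hv⟩ := key
  obtain ⟨α, hα0, hα, hαI⟩ := h.exists_val_colon hI hIP hIg hIm hL hb hc hv
  refine ⟨α, hα0, hαI, fun hαx => hIg ?_⟩
  refine ⟨α * (x - y), ?_, mul_ne_zero hα0 hne, ?_⟩
  · rw [mul_sub]; exact sub_mem hαx (hαI y hy)
  · rw [h.val_mul α _ hα0 hne]; omega

/-- A fractional ideal of `A` containing `A`, without elements of value `2 * τ` but with elements
of value `τ`. These are the canonical ideals of `A` in normalized form. -/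
structure IsCanonical (_ : KunzSubring A v τ) (N : AddSubgroup K) : Prop where
  frac : IsFracModule A N
  le : A.toAddSubgroup ≤ N
  frobenius_not_mem : 2 * τ ∉ valSet v N
  tau_mem : τ ∈ valSet v N

/-- An element `z` of value `τ` with `z * m ⊆ A`. -/
structure IsSocleElement (z : K) : Prop where
  ne_zero : z ≠ 0
  val : v z = τ
  mul_mem : ∀ a ∈ h.maxIdeal, z * a ∈ A

/-- If a value is missing in `N` and is neither `τ` nor `2 * τ`, then some nonunit of `A` moves
it to `2 * τ`. -/
theorem exists_maxIdeal_val {n : ℤ} (hn : n ∉ valSet v A.toAddSubgroup) (hτ : n ≠ τ)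
    (hg : n ≠ 2 * τ) : ∃ a ∈ h.maxIdeal, a ≠ 0 ∧ v a = 2 * τ - n := by
  obtain ⟨a, ha, ha0, hav⟩ := (h.symm n hτ).resolve_left hn
  refine ⟨a, h.mem_maxIdeal_of_val ha ?_, ha0, hav⟩
  have := h.val_nonneg a ha ha0
  omega

theorem exists_sub_mem_P {N : AddSubgroup K} (hN : ∀ a ∈ A, ∀ x ∈ N, a * x ∈ N)
    (hAN : A.toAddSubgroup ≤ N) (hg : 2 * τ ∉ valSet v N)
    (hτ : ∀ x, x ≠ 0 → (∀ a ∈ h.maxIdeal, a * x ∈ N) → v x = τ → τ ∈ valSet v N) :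
    ∀ x, (∀ a ∈ h.maxIdeal, a * x ∈ N) → ∃ i ∈ N, x - i ∈ h.P (2 * τ) := by
  let N' : AddSubgroup K :=
    { carrier := {x | ∀ a ∈ h.maxIdeal, a * x ∈ N}
      zero_mem' := fun a _ => by rw [mul_zero]; exact zero_mem _
      add_mem' := fun hx hy a ha => by rw [mul_add]; exact add_mem (hx a ha) (hy a ha)
      neg_mem' := fun hx a ha => by rw [mul_neg]; exact neg_mem (hx a ha) }
  have hPN : h.P (2 * τ + 1) ≤ N := h.P_le.trans hAN
  have hsup : ∀ a ∈ A, ∀ x ∈ N ⊔ h.P (2 * τ), a * x ∈ N ⊔ h.P (2 * τ) := by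
    intro a ha x hx
    obtain ⟨y, hy, w, hw, rfl⟩ := AddSubgroup.mem_sup.1 hx
    rw [mul_add]
    refine add_mem (AddSubgroup.mem_sup_left (hN a ha y hy)) (AddSubgroup.mem_sup_right ?_)
    have := h.mul_mem_P (h.le_P_zero ha) hw
    rwa [zero_add] at this
  have h1 : N' ≤ N ⊔ h.P (2 * τ) := by
    refine h.le_of_valSet_subset hsup (c := 2 * τ) le_sup_right ?_ ?_
    · refine sup_le (fun y hy a ha => hN a ha.1 y hy) (fun y hy a ha => hPN ?_)
      have := h.mul_mem_P ha.2 hy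
      rwa [add_comm] at this
    · rintro _ ⟨x, hx, hx0, rfl⟩
      by_cases hS : v x ∈ valSet v A.toAddSubgroup
      · exact valSet_mono (hAN.trans le_sup_left) hS
      by_cases hxτ : v x = τ
      · rw [hxτ]
        exact valSet_mono le_sup_left (hτ x hx0 hx hxτ)
      by_cases hxg : v x = 2 * τ
      · exact ⟨x, AddSubgroup.mem_sup_right (h.mem_P_of_le hxg.ge), hx0, rfl⟩
      · exfalso
        obtain ⟨a, ha, ha0, hav⟩ := h.exists_maxIdeal_val hS hxτ hxg
        refine hg ⟨a * x, hx a ha, mul_ne_zero ha0 hx0, ?_⟩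
        rw [h.val_mul a x ha0 hx0]
        omega
  intro x hx
  obtain ⟨y, hy, w, hw, hyw⟩ := AddSubgroup.mem_sup.1 (h1 (show x ∈ N' from hx))
  exact ⟨y, hy, by rw [← hyw, add_sub_cancel_left]; exact hw⟩

/-- A socle element exists: otherwise `(A : m)` would have length one over `A`, so that `A` would be
its own canonical module, and its value semigroup symmetric rather than pseudo-symmetric. -/
theorem exists_isSocleElement : ∃ z, h.IsSocleElement z := by
  by_contra hcon
  have hA : ∀ a ∈ A, ∀ x ∈ A.toAddSubgroup, a * x ∈ A.toAddSubgroup :=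
    fun a ha x hx => A.mul_mem ha hx
  have h1 := h.exists_sub_mem_P hA le_rfl h.frobenius (fun x hx0 hx hxτ =>
    absurd ⟨x, hx0, hxτ, fun a ha => by rw [mul_comm]; exact hx a ha⟩ hcon)
  obtain ⟨α, hα0, hα, hαA⟩ := h.exists_val_colon hA h.P_le h.frobenius h1 hA h.le_P_zero h.P_le
    h.tau_not_mem
  apply h.tau_not_mem
  refine ⟨α, ?_, hα0, by omega⟩
  have := hαA 1 A.one_mem
  rwa [mul_one] at this

variable {h} in
omit h in
theorem IsSocleElement.mul_mem_maxIdeal {h : KunzSubring A v τ} {z : K} (hz : h.IsSocleElement z)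
    {a : K} (ha : a ∈ h.maxIdeal) : z * a ∈ h.maxIdeal := by
  refine ⟨hz.mul_mem a ha, ?_⟩
  have := h.three_le
  exact h.P_anti (by omega) (h.mul_mem_P (h.mem_P_of_le hz.val.ge) ha.2)

/-- The module `A + A z`. -/
def canonicalModule (_ : KunzSubring A v τ) (z : K) : AddSubgroup K where
  carrier := {x | ∃ r ∈ A, ∃ c ∈ A, x = r + c * z}
  zero_mem' := ⟨0, A.zero_mem, 0, A.zero_mem, by ring⟩
  add_mem' := by
    rintro _ _ ⟨r, hr, c, hc, rfl⟩ ⟨s, hs, d, hd, rfl⟩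
    exact ⟨r + s, A.add_mem hr hs, c + d, A.add_mem hc hd, by ring⟩
  neg_mem' := by
    rintro _ ⟨r, hr, c, hc, rfl⟩
    exact ⟨-r, A.neg_mem hr, -c, A.neg_mem hc, by ring⟩

end Duality

end KunzSubring

/-! ### Fractional ideals of a Kunz subring -/

namespace KunzSubring

variable {K : Type*} [Field K] {A : Subring K} {v : K → ℤ} {τ : ℤ}

section Modules

variable (h : KunzSubring A v τ)
include h

theorem le_canonicalModule (z : K) : A.toAddSubgroup ≤ h.canonicalModule z :=
  fun r hr => ⟨r, hr, 0, A.zero_mem, by ring⟩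

theorem frobenius_not_mem_canonicalModule {z : K} (hz : h.IsSocleElement z) {x : K}
    (hx : x ∈ h.canonicalModule z) (hx0 : x ≠ 0) : v x ≠ 2 * τ := by
  have h3 := h.three_le
  obtain ⟨r, hr, c, hc, rfl⟩ := hx
  intro hxv
  have hmul : c ∈ h.maxIdeal → r + c * z ∈ A := fun hc' => by
    have := hz.mul_mem c hc'
    rw [mul_comm] at this
    exact A.add_mem hr this
  rcases h.mem_maxIdeal_or hc with hc' | ⟨hc0, hcv⟩
  · exact h.frobenius ⟨_, hmul hc', hx0, hxv⟩
  · have hczv : v (c * z) = τ := by rw [h.val_mul c z hc0 hz.ne_zero, hcv, hz.val, zero_add]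
    have h1 := h.val_add_of_mem (x := -(c * z)) (y := r + c * z)
      (neg_ne_zero.2 (mul_ne_zero hc0 hz.ne_zero))
      (h.mem_P_of_le (by rw [h.val_neg]; omega))
    rw [h.val_neg, hczv] at h1
    have h2 : -(c * z) + (r + c * z) = r := by ring
    rw [h2] at h1
    exact h.tau_not_mem ⟨r, hr, h1.1, h1.2⟩

theorem mul_mem_canonicalModule (z : K) :
    ∀ a ∈ A, ∀ x ∈ h.canonicalModule z, a * x ∈ h.canonicalModule z := by
  rintro a ha _ ⟨r, hr, c, hc, rfl⟩
  exact ⟨a * r, A.mul_mem ha hr, a * c, A.mul_mem ha hc, by ring⟩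

theorem val_sq {z : K} (hz : h.IsSocleElement z) : v (z * z) = 2 * τ := by
  rw [h.val_mul z z hz.ne_zero hz.ne_zero, hz.val, two_mul]

/-- The values of a fractional ideal are bounded below. -/
theorem exists_le_P {N : AddSubgroup K} (hN : IsFracModule A N) : ∃ b, N ≤ h.P b := by
  obtain ⟨d, hd, hd0, hdN⟩ := hN.exists_denom
  refine ⟨-v d, fun x hx hx0 => ?_⟩
  have := h.val_nonneg _ (hdN x hx) (mul_ne_zero hd0 hx0)
  rw [h.val_mul d x hd0 hx0] at this
  omega

theorem P_le_of_mem {N : AddSubgroup K} (hN : ∀ a ∈ A, ∀ x ∈ N, a * x ∈ N) {x : K} (hx : x ∈ N)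
    (hx0 : x ≠ 0) : h.P (2 * τ + 1 + v x) ≤ N := by
  intro y hy
  have h1 : y * x⁻¹ ∈ A := by
    apply h.P_le
    have := h.mul_mem_P hy (h.mem_P_of_le (h.val_inv hx0).ge)
    rwa [add_neg_cancel_right] at this
  have := hN _ h1 x hx
  rwa [inv_mul_cancel_right₀ hx0] at this

theorem exists_P_le {N : AddSubgroup K} (hN : ∀ a ∈ A, ∀ x ∈ N, a * x ∈ N) (h0 : N ≠ ⊥) :
    ∃ c, h.P c ≤ N := by
  obtain ⟨x, hx, hx0⟩ := AddSubgroup.exists_mem_ne_zero h0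
  exact ⟨_, h.P_le_of_mem hN hx hx0⟩

theorem isFracModule_of_bounds {N : AddSubgroup K} (hN : ∀ a ∈ A, ∀ x ∈ N, a * x ∈ N) {b : ℤ}
    (hb : N ≤ h.P b) : IsFracModule A N := by
  obtain ⟨d, hd0, hd⟩ := h.exists_val_eq (max (2 * τ + 1) (2 * τ + 1 - b))
  refine ⟨hN, d, h.P_le (h.mem_P_of_le (by omega)), hd0, fun x hx => h.P_le ?_⟩
  exact h.P_anti (by omega) (h.mul_mem_P (h.mem_P_of_le hd.ge) (hb hx))

theorem isFracModule_self : IsFracModule A A.toAddSubgroup :=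
  h.isFracModule_of_bounds (fun _ ha _ hx => A.mul_mem ha hx) h.le_P_zero

theorem isFracModule_smul {N : AddSubgroup K} (hN : IsFracModule A N) (x : K) :
    IsFracModule A (x • N) := by
  obtain ⟨b, hb⟩ := h.exists_le_P hN
  refine h.isFracModule_of_bounds (b := v x + b) ?_ ?_
  · intro a ha y hy
    obtain ⟨n, hn, rfl⟩ := AddSubgroup.mem_smul_iff_exists_mul.1 hy
    exact AddSubgroup.mem_smul_iff_exists_mul.2 ⟨a * n, hN.mul_mem a ha n hn, by ring⟩
  · intro y hy
    obtain ⟨n, hn, rfl⟩ := AddSubgroup.mem_smul_iff_exists_mul.1 hy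
    exact h.mul_mem_P (h.mem_P_of_le le_rfl) (hb hn)

theorem isCanonical_canonicalModule {z : K} (hz : h.IsSocleElement z) :
    h.IsCanonical (h.canonicalModule z) where
  frac := by
    have h3 := h.three_le
    refine h.isFracModule_of_bounds (h.mul_mem_canonicalModule z) (b := 0) ?_
    rintro _ ⟨r, hr, c, hc, rfl⟩
    refine add_mem (h.le_P_zero hr) ?_
    exact h.P_anti (by rw [hz.val]; omega)
      (h.mul_mem_P (h.le_P_zero hc) (h.mem_P_of_le (le_refl (v z))))
  le := h.le_canonicalModule z
  frobenius_not_mem := by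
    rintro ⟨x, hx, hx0, hxv⟩
    exact h.frobenius_not_mem_canonicalModule hz hx hx0 hxv
  tau_mem := ⟨z, ⟨0, A.zero_mem, 1, A.one_mem, by ring⟩, hz.ne_zero, hz.val⟩

omit h in
theorem IsCanonical.exists_mul_not_mem {I : AddSubgroup K} {h : KunzSubring A v τ}
    (hI : h.IsCanonical I) {L : AddSubgroup K} (hL : IsFracModule A L) (hL0 : L ≠ ⊥) {x : K}
    (hx : x ∉ L) : ∃ α, α ≠ 0 ∧ (∀ y ∈ L, α * y ∈ I) ∧ α * x ∉ I := by
  obtain ⟨b, hb⟩ := h.exists_le_P hL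
  obtain ⟨c, hc⟩ := h.exists_P_le hL.mul_mem hL0
  exact KunzSubring.exists_mul_not_mem h hI.frac.mul_mem (h.P_le.trans hI.le)
    hI.frobenius_not_mem
    (h.exists_sub_mem_P hI.frac.mul_mem hI.le hI.frobenius_not_mem (fun _ _ _ _ => hI.tau_mem))
    hL.mul_mem hb hc hx

omit h in
/-- If a family of closed ideals is such that for each `x ∉ L` some multiple of a member
contains `L` but not `x`, then `L` belongs to it. -/
theorem mem_family_of_separated {D : Subring K} {F : Set (AddSubgroup K)} (hF : IsStarFamily D F)
    {I L : AddSubgroup K} (hI : I ∈ F) (hne : ∃ α, α ≠ 0 ∧ ∀ y ∈ L, α * y ∈ I)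
    (hsep : ∀ x, x ∉ L → ∃ α, α ≠ 0 ∧ (∀ y ∈ L, α * y ∈ I) ∧ α * x ∉ I) : L ∈ F := by
  have h1 : sInf {N | ∃ α, α ≠ 0 ∧ (∀ y ∈ L, α * y ∈ I) ∧ N = α⁻¹ • I} ∈ F := by
    apply hF.sInf_mem
    · rintro _ ⟨α, hα, -, rfl⟩
      exact hF.smul_mem _ (inv_ne_zero hα) _ hI
    · obtain ⟨α, hα, hαL⟩ := hne
      exact ⟨_, α, hα, hαL, rfl⟩
  convert h1
  apply le_antisymm
  · apply le_sInf
    rintro _ ⟨α, hα, hαL, rfl⟩ y hy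
    rw [AddSubgroup.mem_smul_iff_inv_mul_mem (inv_ne_zero hα), inv_inv]
    exact hαL y hy
  · intro x hx
    by_contra hxL
    obtain ⟨α, hα, hαL, hαx⟩ := hsep x hxL
    have := AddSubgroup.mem_sInf.1 hx _ ⟨α, hα, hαL, rfl⟩
    rw [AddSubgroup.mem_smul_iff_inv_mul_mem (inv_ne_zero hα), inv_inv] at this
    exact hαx this

/-- A star operation that closes a canonical ideal is the identity. -/
theorem mem_family_of_isCanonical {F : Set (AddSubgroup K)} (hF : IsStarFamily A F)
    {I : AddSubgroup K} (hI : I ∈ F) (hIc : h.IsCanonical I) {L : AddSubgroup K}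
    (hL : IsFracModule A L) : L ∈ F := by
  by_cases hL0 : L = ⊥
  · rw [hL0]; exact hF.bot_mem
  refine mem_family_of_separated hF hI ?_ (fun x hx => hIc.exists_mul_not_mem hL hL0 hx)
  obtain ⟨d, hd, hd0, hdL⟩ := hL.exists_denom
  exact ⟨d, hd0, fun y hy => hIc.le (hdL y hy)⟩

/-- Ideals stable under `z` are divisorial, that is, closed under every star operation. A
multiple of such an ideal inside the canonical module `A + A z` lies in the maximal ideal of `A`,
since otherwise multiplication by `z` or `z ^ 2` would produce an element of value `2 * τ`. -/
theorem mem_family_of_socle_stable {F : Set (AddSubgroup K)} (hF : IsStarFamily A F)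
    {z : K} (hz : h.IsSocleElement z) {L : AddSubgroup K} (hL : IsFracModule A L)
    (hzL : ∀ x ∈ L, z * x ∈ L) : L ∈ F := by
  by_cases hL0 : L = ⊥
  · rw [hL0]; exact hF.bot_mem
  obtain ⟨d, hd, hd0, hdL⟩ := hL.exists_denom
  refine mem_family_of_separated hF hF.ring_mem ⟨d, hd0, hdL⟩ (fun x hx => ?_)
  obtain ⟨α, hα0, hαL, hαx⟩ :=
    (h.isCanonical_canonicalModule hz).exists_mul_not_mem hL hL0 hx
  refine ⟨α, hα0, fun y hy => ?_, fun hh => hαx (h.le_canonicalModule z hh)⟩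
  have h3 := h.three_le
  have hz0 := hz.ne_zero
  obtain ⟨r, hr, c, hc, hw⟩ := hαL y hy
  have hw1 := hαL _ (hzL y hy)
  have hw2 := hαL _ (hzL _ (hzL y hy))
  -- `z * (c * z)` has value `2 * τ` if `c` is a unit, and likewise for `z * (z * r)`
  have hno : ∀ u ∈ A, u ≠ 0 → v u = 0 → ∀ w ∈ h.canonicalModule z,
      w - u * (z * z) ∈ A → w - u * (z * z) ∈ h.P (2 * τ + 1) → False := by
    intro u hu hu0 huv w hw hwA hwP
    have hne : u * (z * z) ≠ 0 := mul_ne_zero hu0 (mul_ne_zero hz0 hz0)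
    have hval : v (u * (z * z)) = 2 * τ := by
      rw [h.val_mul u _ hu0 (mul_ne_zero hz0 hz0), huv, h.val_sq hz, zero_add]
    have h1 := h.val_add_of_mem (x := u * (z * z)) (y := w - u * (z * z)) hne (by rwa [hval])
    rw [add_sub_cancel, hval] at h1
    exact h.frobenius_not_mem_canonicalModule hz hw h1.1 h1.2
  have hzP : z ∈ h.P τ := h.mem_P_of_le hz.val.ge
  have hrm : r ∈ h.maxIdeal := by
    rcases h.mem_maxIdeal_or hr with hrm | ⟨hr0, hrv⟩
    · exact hrm
    · exfalso
      have hP : c * z * z * z ∈ h.P (2 * τ + 1) := by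
        have := h.mul_mem_P (h.mul_mem_P (h.mul_mem_P (h.le_P_zero hc) hzP) hzP) hzP
        exact h.P_anti (by omega) this
      have he : α * (z * (z * y)) - r * (z * z) = c * z * z * z := by
        linear_combination (z * z) * hw
      refine hno r hr hr0 hrv _ hw2 ?_ ?_
      · rw [he]; exact h.P_le hP
      · rw [he]; exact hP
  have hcm : c ∈ h.maxIdeal := by
    rcases h.mem_maxIdeal_or hc with hcm | ⟨hc0, hcv⟩
    · exact hcm
    · exfalso
      have hzr := hz.mul_mem_maxIdeal hrm
      have hne : c * (z * z) ≠ 0 := mul_ne_zero hc0 (mul_ne_zero hz0 hz0)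
      have hval : v (c * (z * z)) = 2 * τ := by
        rw [h.val_mul c _ hc0 (mul_ne_zero hz0 hz0), hcv, h.val_sq hz, zero_add]
      have he : α * (z * y) - z * r = c * (z * z) := by linear_combination z * hw
      refine h.frobenius_not_mem_canonicalModule hz (x := c * (z * z)) ?_ hne hval
      rw [← he]
      exact sub_mem hw1 (h.le_canonicalModule z hzr.1)
  change α * y ∈ A
  rw [hw]
  refine A.add_mem hr ?_
  rw [mul_comm]
  exact hz.mul_mem c hcm

/-- The overring `T = A + P g` of `A`, where `g = 2 * τ`. -/
def overring : Subring K where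
  carrier := {x | ∃ a ∈ A, x - a ∈ h.P (2 * τ)}
  zero_mem' := ⟨0, A.zero_mem, by simp [zero_mem]⟩
  one_mem' := ⟨1, A.one_mem, by simp [zero_mem]⟩
  add_mem' := by
    rintro x y ⟨a, ha, hx⟩ ⟨b, hb, hy⟩
    exact ⟨a + b, A.add_mem ha hb, by rw [add_sub_add_comm]; exact add_mem hx hy⟩
  neg_mem' := by
    rintro x ⟨a, ha, hx⟩
    exact ⟨-a, A.neg_mem ha, by rw [neg_sub_neg, ← neg_sub]; exact neg_mem hx⟩
  mul_mem' := by
    rintro x y ⟨a, ha, hx⟩ ⟨b, hb, hy⟩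
    refine ⟨a * b, A.mul_mem ha hb, ?_⟩
    have h3 := h.three_le
    have h1 := h.mul_mem_P (h.le_P_zero ha) hy
    have h2 := h.mul_mem_P (h.le_P_zero hb) hx
    have h4 := h.mul_mem_P hx hy
    have he : x * y - a * b = a * (y - b) + b * (x - a) + (x - a) * (y - b) := by ring
    rw [he]
    exact add_mem (add_mem (h.P_anti (by omega) h1) (h.P_anti (by omega) h2))
      (h.P_anti (by omega) h4)

theorem le_overring : A ≤ h.overring := fun a ha => ⟨a, ha, by rw [sub_self]; exact zero_mem _⟩

theorem P_le_overring : h.P (2 * τ) ≤ h.overring.toAddSubgroup :=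
  fun x hx => ⟨0, A.zero_mem, by rwa [sub_zero]⟩

theorem overring_le_P_zero : h.overring.toAddSubgroup ≤ h.P 0 := by
  rintro x ⟨a, ha, hx⟩
  have h3 := h.three_le
  have := add_mem (h.P_anti (by omega) hx : x - a ∈ h.P 0) (h.le_P_zero ha)
  rwa [sub_add_cancel] at this

theorem mem_valSet_overring {n : ℤ} :
    n ∈ valSet v h.overring.toAddSubgroup ↔ n ∈ valSet v A.toAddSubgroup ∨ n = 2 * τ := by
  constructor
  · rintro ⟨x, ⟨a, ha, hx⟩, hx0, rfl⟩
    by_cases hxa : 2 * τ ≤ v x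
    · rcases eq_or_lt_of_le hxa with h1 | h1
      · exact Or.inr h1.symm
      · exact Or.inl (h.mem_valSet_of_gt h1)
    · left
      have h1 := h.val_add_of_mem (x := x) (y := -(x - a)) hx0
        (neg_mem (h.P_anti (by omega) hx))
      rw [neg_sub, add_sub_cancel] at h1
      exact ⟨a, ha, h1.1, h1.2⟩
  · rintro (h1 | rfl)
    · exact valSet_mono h.le_overring h1
    · obtain ⟨x, hx0, hx⟩ := h.exists_val_eq (2 * τ)
      exact ⟨x, h.P_le_overring (h.mem_P_of_le hx.ge), hx0, hx⟩

theorem inv_mem_overring {x : K} (hx : x ∈ h.overring) (hx0 : x ≠ 0) (hxv : v x = 0) :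
    x⁻¹ ∈ h.overring := by
  obtain ⟨a, ha, hxa⟩ := hx
  have h3 := h.three_le
  have h1 := h.val_add_of_mem (x := x) (y := -(x - a)) hx0
    (neg_mem (h.P_anti (by omega) hxa))
  rw [neg_sub, add_sub_cancel, hxv] at h1
  refine ⟨a⁻¹, h.inv_mem a ha h1.1 h1.2, ?_⟩
  have he : x⁻¹ - a⁻¹ = -(x - a) * x⁻¹ * a⁻¹ := by
    field_simp [hx0, h1.1]
    ring
  rw [he]
  have := h.mul_mem_P (h.mul_mem_P (neg_mem hxa) (h.mem_P_of_le (h.val_inv hx0).ge))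
    (h.mem_P_of_le (h.val_inv h1.1).ge)
  exact h.P_anti (by omega) this

/-- An `A`-module inside the valuation ring, containing `1` and an element of value `2 * τ`, is a
module over the overring. -/
theorem overring_mul_mem {N : AddSubgroup K} (hN : ∀ a ∈ A, ∀ x ∈ N, a * x ∈ N)
    (hN0 : N ≤ h.P 0) (hP : h.P (2 * τ) ≤ N) :
    ∀ t ∈ h.overring, ∀ x ∈ N, t * x ∈ N := by
  rintro t ⟨a, ha, ht⟩ x hx
  have h1 := hP (by simpa using h.mul_mem_P ht (hN0 hx))
  have := add_mem h1 (hN a ha x hx)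
  rwa [← add_mul, sub_add_cancel] at this

theorem isFracModule_overring_iff {N : AddSubgroup K} :
    IsFracModule h.overring N ↔
      IsFracModule A N ∧ ∀ t ∈ h.overring, ∀ x ∈ N, t * x ∈ N := by
  constructor
  · intro hN
    refine ⟨?_, hN.mul_mem⟩
    obtain ⟨d, hd, hd0, hdN⟩ := hN.exists_denom
    refine h.isFracModule_of_bounds (b := - v d)
      (fun a ha => hN.mul_mem a (h.le_overring ha)) ?_
    intro x hx hx0
    have := h.overring_le_P_zero (hdN x hx) (mul_ne_zero hd0 hx0)
    rw [h.val_mul d x hd0 hx0] at this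
    omega
  · rintro ⟨hN, hT⟩
    obtain ⟨d, hd, hd0, hdN⟩ := hN.exists_denom
    exact ⟨hT, d, h.le_overring hd, hd0, fun x hx => h.le_overring (hdN x hx)⟩

theorem isFracModule_overring_smul {N : AddSubgroup K} (hN : IsFracModule h.overring N) (x : K) :
    IsFracModule h.overring (x • N) := by
  rw [isFracModule_overring_iff] at hN ⊢
  refine ⟨h.isFracModule_smul hN.1 x, ?_⟩
  intro t ht y hy
  obtain ⟨n, hn, rfl⟩ := AddSubgroup.mem_smul_iff_exists_mul.1 hy
  exact AddSubgroup.mem_smul_iff_exists_mul.2 ⟨t * n, hN.2 t ht n hn, by ring⟩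

/-- Every nonzero fractional ideal has, up to scaling, `1` as element of least value. -/
theorem exists_smul_normalized {N : AddSubgroup K} (hN : IsFracModule A N) (h0 : N ≠ ⊥) :
    ∃ x : K, x ≠ 0 ∧ (1 : K) ∈ x • N ∧ x • N ≤ h.P 0 := by
  obtain ⟨b, hb⟩ := h.exists_le_P hN
  obtain ⟨y, hy, hy0⟩ := AddSubgroup.exists_mem_ne_zero h0
  obtain ⟨m, ⟨w, hw, hw0, hwm⟩, hmin⟩ := Int.exists_least_of_bdd (P := fun n => n ∈ valSet v N)
    ⟨b, by rintro _ ⟨x, hx, hx0, rfl⟩; exact hb hx hx0⟩ ⟨_, y, hy, hy0, rfl⟩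
  refine ⟨w⁻¹, inv_ne_zero hw0, ?_, ?_⟩
  · exact AddSubgroup.mem_smul_iff_exists_mul.2 ⟨w, hw, inv_mul_cancel₀ hw0⟩
  · intro x hx hx0
    obtain ⟨n, hn, rfl⟩ := AddSubgroup.mem_smul_iff_exists_mul.1 hx
    have hn0 := right_ne_zero_of_mul hx0
    rw [h.val_mul _ n (inv_ne_zero hw0) hn0, h.val_inv hw0]
    have := hmin _ ⟨n, hn, hn0, rfl⟩
    omega

/-- Classification of the nonzero fractional ideals of `A`: up to scaling, they are `A` itself,
the canonical ideals, and the fractional ideals of the overring. -/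
theorem classification {N : AddSubgroup K} (hN : IsFracModule A N) (h0 : N ≠ ⊥) :
    (∃ x : K, x ≠ 0 ∧ x • N = A.toAddSubgroup) ∨ (∃ x : K, x ≠ 0 ∧ h.IsCanonical (x • N)) ∨
      IsFracModule h.overring N := by
  obtain ⟨x, hx0, h1, hP⟩ := h.exists_smul_normalized hN h0
  have hN' := h.isFracModule_smul hN x
  have hA : A.toAddSubgroup ≤ x • N := fun a ha => by
    have := hN'.mul_mem a ha 1 h1
    rwa [mul_one] at this
  by_cases hg : 2 * τ ∈ valSet v (x • N)
  · right; right
    have h2 := h.P_le_of_mem_valSet hN'.mul_mem (h.P_le.trans hA) hg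
    have h4 : IsFracModule h.overring (x • N) :=
      h.isFracModule_overring_iff.2 ⟨hN', h.overring_mul_mem hN'.mul_mem hP h2⟩
    have := h.isFracModule_overring_smul h4 x⁻¹
    rwa [inv_smul_smul₀ hx0] at this
  by_cases hτ : τ ∈ valSet v (x • N)
  · exact Or.inr (Or.inl ⟨x, hx0, hN', hA, hg, hτ⟩)
  · left
    refine ⟨x, hx0, le_antisymm ?_ hA⟩
    refine h.le_of_valSet_subset (fun a ha y hy => A.mul_mem ha hy) h.P_le hA ?_
    intro n hn
    by_contra hnA
    have hnτ : n ≠ τ := fun hh => hτ (hh ▸ hn)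
    have := h.add_mem_valSet hN'.mul_mem ((h.symm n hnτ).resolve_left hnA) hn
    rw [sub_add_cancel] at this
    exact hg this

end Modules

end KunzSubring

/-! ### Families of closed ideals for the overring -/

namespace KunzSubring

variable {K : Type*} [Field K] {A : Subring K} {v : K → ℤ} {τ : ℤ}

theorem isFracModule_sInf {D : Subring K} {G : Set (AddSubgroup K)}
    (hG : ∀ N ∈ G, IsFracModule D N) (hne : G.Nonempty) : IsFracModule D (sInf G) := by
  obtain ⟨N, hN⟩ := hne
  obtain ⟨d, hd, hd0, hdN⟩ := (hG N hN).exists_denom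
  refine ⟨?_, d, hd, hd0, fun x hx => hdN x (AddSubgroup.mem_sInf.1 hx N hN)⟩
  intro e he x hx
  rw [AddSubgroup.mem_sInf] at hx ⊢
  exact fun N' hN' => (hG N' hN').mul_mem e he x (hx N' hN')

theorem isFracModule_bot {D : Subring K} : IsFracModule D ⊥ :=
  ⟨fun d _ x hx => by rw [AddSubgroup.mem_bot] at hx ⊢; rw [hx, mul_zero],
    1, D.one_mem, one_ne_zero, fun x hx => by
      rw [AddSubgroup.mem_bot] at hx; rw [hx, mul_zero]; exact D.zero_mem⟩

section Families

variable (h : KunzSubring A v τ)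
include h

theorem isFracModule_overring_self : IsFracModule h.overring h.overring.toAddSubgroup :=
  ⟨fun _ ha _ hx => h.overring.mul_mem ha hx, 1, h.overring.one_mem, one_ne_zero,
    fun x hx => by rw [one_mul]; exact hx⟩

/-- Let `D` be a local subring of the valuation ring. To a family of `D`-modules that is stable
under intersections and contains the maximal ideal of `D` one may add the multiples of `D`: an
intersection contained in `x • D` is either `x • D` or contained in `x` times the maximal
ideal. -/
theorem sInf_mem_union_smul {D : Subring K} (hD : D.toAddSubgroup ≤ h.P 0)
    (hDinv : ∀ x ∈ D, x ≠ 0 → v x = 0 → x⁻¹ ∈ D) {G : Set (AddSubgroup K)}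
    (hGD : ∀ N ∈ G, ∀ d ∈ D, ∀ x ∈ N, d * x ∈ N)
    (hGsmul : ∀ x : K, x ≠ 0 → ∀ N ∈ G, x • N ∈ G)
    (hGinf : ∀ S ⊆ G, S.Nonempty → sInf S ∈ G) (hM : D.toAddSubgroup ⊓ h.P 1 ∈ G)
    {S : Set (AddSubgroup K)}
    (hS : S ⊆ G ∪ {N | ∃ x : K, x ≠ 0 ∧ N = x • D.toAddSubgroup}) (hne : S.Nonempty) :
    sInf S ∈ G ∪ {N | ∃ x : K, x ≠ 0 ∧ N = x • D.toAddSubgroup} := by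
  by_cases hcase : ∃ x : K, x ≠ 0 ∧ sInf S = x • D.toAddSubgroup
  · exact Or.inr hcase
  left
  have hmod : ∀ N ∈ S, ∀ d ∈ D, ∀ y ∈ N, d * y ∈ N := by
    intro N hN d hd y hy
    rcases hS hN with h1 | ⟨x, hx0, rfl⟩
    · exact hGD N h1 d hd y hy
    · obtain ⟨n, hn, rfl⟩ := AddSubgroup.mem_smul_iff_exists_mul.1 hy
      exact AddSubgroup.mem_smul_iff_exists_mul.2 ⟨d * n, D.mul_mem hd hn, by ring⟩
  have key : ∀ N ∈ S, ∃ N' ∈ G, sInf S ≤ N' ∧ N' ≤ N := by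
    intro N hN
    rcases hS hN with h1 | ⟨x, hx0, hNx⟩
    · exact ⟨N, h1, sInf_le hN, le_rfl⟩
    refine ⟨x • (D.toAddSubgroup ⊓ h.P 1), hGsmul x hx0 _ hM, ?_, ?_⟩
    · intro y hy
      have hyN : y ∈ N := AddSubgroup.mem_sInf.1 hy N hN
      rw [hNx] at hyN
      obtain ⟨d, hd, rfl⟩ := AddSubgroup.mem_smul_iff_exists_mul.1 hyN
      refine AddSubgroup.mem_smul_iff_exists_mul.2 ⟨d, ⟨hd, fun hd0 => ?_⟩, rfl⟩
      by_contra hd1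
      have hdv : v d = 0 := by have := hD hd hd0; omega
      apply hcase
      refine ⟨x, hx0, le_antisymm (hNx ▸ sInf_le hN) ?_⟩
      intro y' hy'
      obtain ⟨e, he, rfl⟩ := AddSubgroup.mem_smul_iff_exists_mul.1 hy'
      rw [AddSubgroup.mem_sInf] at hy ⊢
      intro N' hN'
      have := hmod N' hN' _ (D.mul_mem he (hDinv d hd hd0 hdv)) _ (hy N' hN')
      convert this using 1
      field_simp
    · rw [hNx]
      intro y hy
      obtain ⟨d, hd, rfl⟩ := AddSubgroup.mem_smul_iff_exists_mul.1 hy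
      exact AddSubgroup.mem_smul_iff_exists_mul.2 ⟨d, hd.1, rfl⟩
  have heq : sInf S = sInf {N ∈ G | sInf S ≤ N} := by
    apply le_antisymm
    · exact le_sInf fun N hN => hN.2
    · apply le_sInf
      intro N hN
      obtain ⟨N', hN', hle, hle'⟩ := key N hN
      exact (sInf_le ⟨hN', hle⟩ : sInf {N ∈ G | sInf S ≤ N} ≤ N').trans hle'
  rw [heq]
  apply hGinf _ (fun N hN => hN.1)
  obtain ⟨N, hN⟩ := hne
  obtain ⟨N', hN', hle, -⟩ := key N hN
  exact ⟨N', hN', hle⟩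

theorem isFracModule_overring_maxIdeal : IsFracModule h.overring h.maxIdeal := by
  rw [isFracModule_overring_iff]
  have hle : h.maxIdeal ≤ A.toAddSubgroup := inf_le_left
  refine ⟨h.isFracModule_of_bounds ?_ (hle.trans h.le_P_zero), ?_⟩
  · intro a ha x hx
    exact ⟨A.mul_mem ha hx.1, by simpa using h.mul_mem_P (h.le_P_zero ha) hx.2⟩
  · rintro t ⟨a, ha, ht⟩ x hx
    have h3 := h.three_le
    have h1 := h.mul_mem_P ht hx.2
    have h2 : (t - a) * x ∈ h.maxIdeal := ⟨h.P_le h1, h.P_anti (by omega) h1⟩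
    have h4 : a * x ∈ h.maxIdeal :=
      ⟨A.mul_mem ha hx.1, by simpa using h.mul_mem_P (h.le_P_zero ha) hx.2⟩
    have := add_mem h2 h4
    rwa [← add_mul, sub_add_cancel] at this

theorem isFracModule_overring_inf : IsFracModule h.overring (h.overring.toAddSubgroup ⊓ h.P 1) := by
  refine ⟨?_, 1, h.overring.one_mem, one_ne_zero, fun x hx => by rw [one_mul]; exact hx.1⟩
  intro t ht x hx
  exact ⟨h.overring.mul_mem ht hx.1, by simpa using h.mul_mem_P (h.overring_le_P_zero ht) hx.2⟩

theorem socle_mul_mem_overring_inf {z : K} (hz : h.IsSocleElement z) {x : K}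
    (hx : x ∈ h.overring.toAddSubgroup ⊓ h.P 1) :
    z * x ∈ h.overring.toAddSubgroup ⊓ h.P 1 := by
  obtain ⟨⟨a, ha, hxa⟩, hx1⟩ := hx
  have h3 := h.three_le
  have ham : a ∈ h.maxIdeal := by
    refine ⟨ha, ?_⟩
    have := (h.P 1).sub_mem hx1 (h.P_anti (by omega) hxa : x - a ∈ h.P 1)
    rwa [sub_sub_cancel] at this
  have h1 := hz.mul_mem_maxIdeal ham
  have h2 := h.mul_mem_P (h.mem_P_of_le hz.val.ge) hxa
  have he : z * x = z * a + z * (x - a) := by ring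
  rw [he]
  exact add_mem ⟨h.le_overring h1.1, h1.2⟩
    ⟨h.P_le_overring (h.P_anti (by omega) h2), h.P_anti (by omega) h2⟩

theorem overring_inf_mem_family {F : Set (AddSubgroup K)} (hF : IsStarFamily A F) :
    h.overring.toAddSubgroup ⊓ h.P 1 ∈ F := by
  obtain ⟨z, hz⟩ := h.exists_isSocleElement
  exact h.mem_family_of_socle_stable hF hz
    (h.isFracModule_overring_iff.1 h.isFracModule_overring_inf).1
    (fun x hx => h.socle_mul_mem_overring_inf hz hx)

theorem maxIdeal_mem_family {F : Set (AddSubgroup K)} (hF : IsStarFamily A F) :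
    h.maxIdeal ∈ F := by
  obtain ⟨z, hz⟩ := h.exists_isSocleElement
  exact h.mem_family_of_socle_stable hF hz
    (h.isFracModule_overring_iff.1 h.isFracModule_overring_maxIdeal).1
    (fun x hx => hz.mul_mem_maxIdeal hx)

/-- The ideals of the overring that are closed in `F`. -/
def overringFamily (F : Set (AddSubgroup K)) : Set (AddSubgroup K) :=
  {N ∈ F | IsFracModule h.overring N}

/-- The ideals of the overring that are closed in `F`, together with the multiples of the
overring. -/
def overringFamilyAdjoin (F : Set (AddSubgroup K)) : Set (AddSubgroup K) :=
  h.overringFamily F ∪ {N | ∃ x : K, x ≠ 0 ∧ N = x • h.overring.toAddSubgroup}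

theorem overringFamily_smul_mem {F : Set (AddSubgroup K)} (hF : IsStarFamily A F) {x : K}
    (hx : x ≠ 0) {N : AddSubgroup K} (hN : N ∈ h.overringFamily F) :
    x • N ∈ h.overringFamily F :=
  ⟨hF.smul_mem x hx N hN.1, h.isFracModule_overring_smul hN.2 x⟩

theorem overringFamily_sInf_mem {F : Set (AddSubgroup K)} (hF : IsStarFamily A F)
    {S : Set (AddSubgroup K)} (hS : S ⊆ h.overringFamily F) (hne : S.Nonempty) :
    sInf S ∈ h.overringFamily F :=
  ⟨hF.sInf_mem S (fun _ hN => (hS hN).1) hne, isFracModule_sInf (fun _ hN => (hS hN).2) hne⟩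

theorem isStarFamily_overringFamily {F : Set (AddSubgroup K)} (hF : IsStarFamily A F)
    (hT : h.overring.toAddSubgroup ∈ F) : IsStarFamily h.overring (h.overringFamily F) where
  frac _ hN := hN.2
  ring_mem := ⟨hT, h.isFracModule_overring_self⟩
  bot_mem := ⟨hF.bot_mem, isFracModule_bot⟩
  smul_mem _ hx _ hN := h.overringFamily_smul_mem hF hx hN
  sInf_mem _ hG hne := h.overringFamily_sInf_mem hF hG hne

theorem isStarFamily_overringFamilyAdjoin {F : Set (AddSubgroup K)} (hF : IsStarFamily A F) :
    IsStarFamily h.overring (h.overringFamilyAdjoin F) where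
  frac := by
    rintro N (hN | ⟨x, -, rfl⟩)
    · exact hN.2
    · exact h.isFracModule_overring_smul h.isFracModule_overring_self x
  ring_mem := Or.inr ⟨1, one_ne_zero, (one_smul _ _).symm⟩
  bot_mem := Or.inl ⟨hF.bot_mem, isFracModule_bot⟩
  smul_mem := by
    rintro x hx N (hN | ⟨y, hy, rfl⟩)
    · exact Or.inl (h.overringFamily_smul_mem hF hx hN)
    · exact Or.inr ⟨x * y, mul_ne_zero hx hy, (mul_smul _ _ _).symm⟩
  sInf_mem := fun S hS hne => h.sInf_mem_union_smul h.overring_le_P_zero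
    (fun x hx hx0 hxv => h.inv_mem_overring hx hx0 hxv) (fun N hN => hN.2.mul_mem)
    (fun x hx N hN => h.overringFamily_smul_mem hF hx hN)
    (fun S hS hne => h.overringFamily_sInf_mem hF hS hne)
    ⟨h.overring_inf_mem_family hF, h.isFracModule_overring_inf⟩ hS hne

/-- All fractional ideals of `A`: the family of the identity operation. -/
theorem isStarFamily_all : IsStarFamily A {N | IsFracModule A N} where
  frac _ hN := hN
  ring_mem := h.isFracModule_self
  bot_mem := isFracModule_bot
  smul_mem x _ _ hN := h.isFracModule_smul hN x
  sInf_mem _ hG hne := isFracModule_sInf hG hne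

theorem isStarFamily_overring_union : IsStarFamily A
    ({N | IsFracModule h.overring N} ∪ {N | ∃ x : K, x ≠ 0 ∧ N = x • A.toAddSubgroup}) where
  frac := by
    rintro N (hN | ⟨x, -, rfl⟩)
    · exact (h.isFracModule_overring_iff.1 hN).1
    · exact h.isFracModule_smul h.isFracModule_self x
  ring_mem := Or.inr ⟨1, one_ne_zero, (one_smul _ _).symm⟩
  bot_mem := Or.inl isFracModule_bot
  smul_mem := by
    rintro x hx N (hN | ⟨y, hy, rfl⟩)
    · exact Or.inl (h.isFracModule_overring_smul hN x)
    · exact Or.inr ⟨x * y, mul_ne_zero hx hy, (mul_smul _ _ _).symm⟩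
  sInf_mem := fun S hS hne => h.sInf_mem_union_smul h.le_P_zero
    h.inv_mem (fun N hN => (h.isFracModule_overring_iff.1 hN).1.mul_mem)
    (fun x _ N hN => h.isFracModule_overring_smul hN x)
    (fun S hS hne => isFracModule_sInf hS hne) h.isFracModule_overring_maxIdeal hS hne

theorem valSet_smul {x : K} (hx : x ≠ 0) {N : AddSubgroup K} {n : ℤ} :
    n ∈ valSet v (x • N) ↔ n - v x ∈ valSet v N := by
  constructor
  · rintro ⟨y, hy, hy0, rfl⟩
    obtain ⟨w, hw, rfl⟩ := AddSubgroup.mem_smul_iff_exists_mul.1 hy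
    have hw0 := right_ne_zero_of_mul hy0
    exact ⟨w, hw, hw0, by rw [h.val_mul x w hx hw0]; ring⟩
  · rintro ⟨w, hw, hw0, hwv⟩
    exact ⟨x * w, AddSubgroup.mem_smul_iff_exists_mul.2 ⟨w, hw, rfl⟩, mul_ne_zero hx hw0,
      by rw [h.val_mul x w hx hw0, hwv]; ring⟩

/-- No multiple of `A` is an ideal of the overring, and neither is a canonical ideal. -/
theorem not_isFracModule_overring {N : AddSubgroup K} (hN : (1 : K) ∈ N)
    (hg : 2 * τ ∉ valSet v N) : ¬ IsFracModule h.overring N := by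
  intro hT
  obtain ⟨y, hy0, hy⟩ := h.exists_val_eq (2 * τ)
  have := hT.mul_mem y (h.P_le_overring (h.mem_P_of_le hy.ge)) 1 hN
  rw [mul_one] at this
  exact hg ⟨y, this, hy0, hy⟩

/-- `A` has a star operation other than the identity: the one whose closed ideals are the
multiples of `A` and the ideals of the overring. -/
theorem nontrivial_family : Nontrivial {F : Set (AddSubgroup K) // IsStarFamily A F} := by
  obtain ⟨z, hz⟩ := h.exists_isSocleElement
  have hc := h.isCanonical_canonicalModule hz
  refine ⟨⟨_, h.isStarFamily_all⟩, ⟨_, h.isStarFamily_overring_union⟩, fun heq => ?_⟩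
  have h1 := congrArg Subtype.val heq
  simp only at h1
  have h2 : h.canonicalModule z ∈ {N | IsFracModule A N} := hc.frac
  rw [h1] at h2
  rcases h2 with h2 | ⟨x, hx0, h2⟩
  · exact h.not_isFracModule_overring (hc.le A.one_mem) hc.frobenius_not_mem h2
  · have h4 : v x ∈ valSet v A.toAddSubgroup ∨ v x = τ := by
      have hx : x ∈ h.canonicalModule z := by
        rw [h2]
        exact AddSubgroup.mem_smul_iff_exists_mul.2 ⟨1, A.one_mem, mul_one x⟩
      by_cases hxτ : v x = τ
      · exact Or.inr hxτ
      left
      rcases h.symm (v x) hxτ with h5 | h5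
      · exact h5
      · exfalso
        have := h.add_mem_valSet hc.frac.mul_mem h5 ⟨x, hx, hx0, rfl⟩
        rw [sub_add_cancel] at this
        exact hc.frobenius_not_mem this
    have hx0v : v x = 0 := by
      have h5 : (0 : ℤ) ∈ valSet v (h.canonicalModule z) := valSet_mono hc.le h.zero_mem_valSet
      rw [h2, h.valSet_smul hx0] at h5
      have h6 := h.nonneg_of_mem_valSet h5
      have h3 := h.three_le
      rcases h4 with h4 | h4
      · have := h.nonneg_of_mem_valSet h4
        omega
      · omega
    have h5 := hc.tau_mem
    rw [h2, h.valSet_smul hx0, hx0v, sub_zero] at h5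
    exact h.tau_not_mem h5

end Families

end KunzSubring

/-! ### The length of a module over its conductor -/

/-- The number of values of `N` below the largest value missing in `N`. For a fractional ideal of
a residually rational ring this is the length of `N` over its conductor. -/
noncomputable def gapLength {K : Type*} [Field K] (v : K → ℤ) (N : AddSubgroup K) : ℕ :=
  {n | n ∈ valSet v N ∧ ∃ G, n < G ∧ G ∉ valSet v N}.ncard

namespace KunzSubring

variable {K : Type*} [Field K] {A : Subring K} {v : K → ℤ} {τ : ℤ}

section GapLength

variable (h : KunzSubring A v τ)
include h

theorem mem_valSet_of_P_le {N : AddSubgroup K} {c n : ℤ} (hc : h.P c ≤ N) (hn : c ≤ n) :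
    n ∈ valSet v N := by
  obtain ⟨x, hx0, hx⟩ := h.exists_val_eq n
  exact ⟨x, hc (h.mem_P_of_le (by omega)), hx0, hx⟩

theorem gapLength_smul {x : K} (hx : x ≠ 0) (N : AddSubgroup K) :
    gapLength v (x • N) = gapLength v N := by
  unfold gapLength
  symm
  rw [← Set.ncard_image_of_injective _ (add_right_injective (v x))]
  symm
  congr 1
  ext n
  simp only [Set.mem_ofPred_eq, Set.mem_image, h.valSet_smul hx]
  constructor
  · rintro ⟨h1, G, hG, hGn⟩
    exact ⟨n - v x, ⟨h1, G - v x, by omega, hGn⟩, by ring⟩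
  · rintro ⟨m, ⟨h1, G, hG, hGn⟩, rfl⟩
    refine ⟨by rwa [add_sub_cancel_left], v x + G, by omega, by rwa [add_sub_cancel_left]⟩

theorem finite_valSet_lt {N : AddSubgroup K} (hN : IsFracModule A N) (G : ℤ) :
    {n | n ∈ valSet v N ∧ n < G}.Finite := by
  obtain ⟨b, hb⟩ := h.exists_le_P hN
  refine (Set.finite_Icc b G).subset ?_
  rintro _ ⟨⟨x, hx, hx0, rfl⟩, hG⟩
  exact ⟨hb hx hx0, hG.le⟩

theorem gapLength_eq {N : AddSubgroup K} {G : ℤ} (hP : h.P (G + 1) ≤ N) (hG : G ∉ valSet v N) :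
    gapLength v N = {n | n ∈ valSet v N ∧ n < G}.ncard := by
  unfold gapLength
  congr 1
  ext n
  constructor
  · rintro ⟨h1, G', hG', hG'n⟩
    refine ⟨h1, ?_⟩
    by_contra hnG
    exact hG'n (h.mem_valSet_of_P_le hP (by omega))
  · rintro ⟨h1, h2⟩
    exact ⟨h1, G, h2, hG⟩

/-- A nonzero fractional ideal has a largest missing value. -/
theorem exists_gap {N : AddSubgroup K} (hN : IsFracModule A N) (h0 : N ≠ ⊥) :
    ∃ G, h.P (G + 1) ≤ N ∧ G ∉ valSet v N := by
  obtain ⟨b, hb⟩ := h.exists_le_P hN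
  obtain ⟨c, hc⟩ := h.exists_P_le hN.mul_mem h0
  obtain ⟨G, hG, hmin⟩ := Int.exists_least_of_bdd (P := fun n => h.P n ≤ N) (by
    refine ⟨b, fun n hn => ?_⟩
    obtain ⟨x, hx0, hx⟩ := h.exists_val_eq n
    have := hb (hn (h.mem_P_of_le hx.ge)) hx0
    omega) ⟨c, hc⟩
  refine ⟨G - 1, by rwa [sub_add_cancel], fun hh => ?_⟩
  have := hmin (G - 1) (h.P_le_of_mem_valSet hN.mul_mem (by rwa [sub_add_cancel]) hh)
  omega

/-- A nonzero intersection of fractional ideals either is one of them, or has smaller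
`gapLength` than one of them: compare it with a member that lacks the largest value missing in the
intersection. -/
theorem sInf_mem_or_gapLength_lt {S : Set (AddSubgroup K)} (hS : ∀ N ∈ S, IsFracModule A N)
    (hne : S.Nonempty) (h0 : sInf S ≠ ⊥) :
    sInf S ∈ S ∨ ∃ N ∈ S, gapLength v (sInf S) < gapLength v N := by
  have hI : IsFracModule A (sInf S) := isFracModule_sInf hS hne
  obtain ⟨G, hP, hG⟩ := h.exists_gap hI h0
  have h1 : ∃ N ∈ S, G ∉ valSet v N := by
    by_contra! hcon
    apply hG
    refine h.mem_valSet_of_P_le (c := G) (le_sInf fun N hN => ?_) le_rfl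
    exact h.P_le_of_mem_valSet (hS N hN).mul_mem (hP.trans (sInf_le hN)) (hcon N hN)
  obtain ⟨N, hN, hGN⟩ := h1
  have hle : sInf S ≤ N := sInf_le hN
  by_cases heq : sInf S = N
  · left; rw [heq]; exact hN
  right
  refine ⟨N, hN, ?_⟩
  rw [h.gapLength_eq hP hG, h.gapLength_eq (hP.trans hle) hGN]
  refine Set.ncard_lt_ncard ?_ (h.finite_valSet_lt (hS N hN) G)
  refine ⟨fun n hn => ⟨valSet_mono hle hn.1, hn.2⟩, fun hsub => heq ?_⟩
  refine le_antisymm hle (h.le_of_valSet_subset hI.mul_mem hP hle ?_)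
  intro n hn
  by_cases hnG : n < G
  · exact (hsub ⟨hn, hnG⟩).1
  · rcases eq_or_ne n G with rfl | hne'
    · exact absurd hn hGN
    · exact h.mem_valSet_of_P_le hP (by omega)

theorem mem_valSet_maxIdeal {n : ℤ} :
    n ∈ valSet v h.maxIdeal ↔ n ∈ valSet v A.toAddSubgroup ∧ 1 ≤ n := by
  constructor
  · rintro ⟨x, hx, hx0, rfl⟩
    exact ⟨⟨x, hx.1, hx0, rfl⟩, hx.2 hx0⟩
  · rintro ⟨⟨x, hx, hx0, rfl⟩, h1⟩
    exact ⟨x, h.mem_maxIdeal_of_val hx h1, hx0, rfl⟩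

theorem P_le_maxIdeal : h.P (2 * τ + 1) ≤ h.maxIdeal := by
  have h3 := h.three_le
  exact le_inf h.P_le (h.P_anti (by omega))

theorem frobenius_not_mem_maxIdeal : 2 * τ ∉ valSet v h.maxIdeal := fun hh =>
  h.frobenius (h.mem_valSet_maxIdeal.1 hh).1

theorem gapLength_maxIdeal :
    gapLength v h.maxIdeal = {n | n ∈ valSet v h.maxIdeal ∧ n < 2 * τ}.ncard :=
  h.gapLength_eq h.P_le_maxIdeal h.frobenius_not_mem_maxIdeal

theorem maxIdeal_isFracModule : IsFracModule A h.maxIdeal :=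
  (h.isFracModule_overring_iff.1 h.isFracModule_overring_maxIdeal).1

theorem gapLength_overring : gapLength v h.overring.toAddSubgroup + 1 ≤ gapLength v h.maxIdeal := by
  have h3 := h.three_le
  rw [h.gapLength_maxIdeal]
  set X := {n | n ∈ valSet v h.maxIdeal ∧ n < 2 * τ} with hX
  have hXf : X.Finite := h.finite_valSet_lt h.maxIdeal_isFracModule _
  -- the values `2 * τ - 1` and `2 * τ - 2` lie above all values missing in the overring
  have h1 : 2 * τ - 1 ∈ X := by
    refine ⟨h.mem_valSet_maxIdeal.2 ⟨?_, by omega⟩, by omega⟩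
    have := (h.symm 1 (by omega)).resolve_left h.one_not_mem
    exact this
  have h2 : 2 * τ - 2 ∈ X \ {2 * τ - 1} := by
    refine ⟨⟨h.mem_valSet_maxIdeal.2 ⟨?_, by omega⟩, by omega⟩, by simp⟩
    exact (h.symm 2 (by omega)).resolve_left h.two_not_mem
  have hsub : {n | n ∈ valSet v h.overring.toAddSubgroup ∧
      ∃ G, n < G ∧ G ∉ valSet v h.overring.toAddSubgroup} ⊆
      insert 0 ((X \ {2 * τ - 1}) \ {2 * τ - 2}) := by
    rintro n ⟨hn, G, hnG, hG⟩
    rw [h.mem_valSet_overring, not_or] at hG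
    have hG1 : G < 2 * τ - 2 := by
      by_contra hcon
      have hne1 : G ≠ 2 * τ - 1 := fun hh => hG.1 (hh ▸ (h.mem_valSet_maxIdeal.1 h1.1).1)
      have hne2 : G ≠ 2 * τ - 2 := fun hh => hG.1 (hh ▸ (h.mem_valSet_maxIdeal.1 h2.1.1).1)
      have hne3 := hG.2
      exact hG.1 (h.mem_valSet_of_gt (by omega))
    rw [h.mem_valSet_overring] at hn
    have hnA := hn.resolve_right (by omega)
    by_cases hn0 : n = 0
    · exact Or.inl hn0
    · right
      have := h.nonneg_of_mem_valSet hnA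
      refine ⟨⟨⟨h.mem_valSet_maxIdeal.2 ⟨hnA, by omega⟩, by omega⟩, ?_⟩, ?_⟩ <;>
        simp only [Set.mem_singleton_iff] <;> omega
  have hfin : ((X \ {2 * τ - 1}) \ {2 * τ - 2}).Finite := hXf.sdiff.sdiff
  have e1 := Set.ncard_sdiff_singleton_add_one h1 hXf
  have e2 := Set.ncard_sdiff_singleton_add_one h2 hXf.sdiff
  have e3 := Set.ncard_le_ncard hsub (hfin.insert 0)
  have e4 := Set.ncard_insert_le (0 : ℤ) ((X \ {2 * τ - 1}) \ {2 * τ - 2})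
  unfold gapLength
  omega

theorem gapLength_maxIdeal_le {N : AddSubgroup K} (hN : IsFracModule A N) (hle : h.maxIdeal ≤ N)
    (hg : 2 * τ ∉ valSet v N) : gapLength v h.maxIdeal ≤ gapLength v N := by
  rw [h.gapLength_maxIdeal, h.gapLength_eq (h.P_le_maxIdeal.trans hle) hg]
  exact Set.ncard_le_ncard (fun n hn => ⟨valSet_mono hle hn.1, hn.2⟩) (h.finite_valSet_lt hN _)

end GapLength

section Removal

variable (h : KunzSubring A v τ)
include h

/-- The structure of the ideals of the overring that contain `m` properly, but no element of value
`2 * τ`: they contain an element of value `τ`, and their ring of multipliers is the overring. -/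
theorem exists_mul_not_mem_of_maxIdeal_lt {N : AddSubgroup K} (hN : IsFracModule h.overring N)
    (hle : h.maxIdeal ≤ N) (hne : N ≠ h.maxIdeal) (hg : 2 * τ ∉ valSet v N) {x : K}
    (hx : x ∉ h.overring) : ∃ y ∈ N, y ≠ 0 ∧ x * y ∉ N := by
  have hNA := (h.isFracModule_overring_iff.1 hN).1
  have h3 := h.three_le
  obtain ⟨w, hw, hw0, hwτ⟩ : τ ∈ valSet v N := by
    by_contra hτ
    refine hne (le_antisymm ?_ hle)
    refine h.le_of_valSet_subset h.maxIdeal_isFracModule.mul_mem h.P_le_maxIdeal hle ?_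
    rintro n ⟨y, hy, hy0, rfl⟩
    have hyτ : v y ≠ τ := fun hh => hτ ⟨y, hy, hy0, hh⟩
    rw [h.mem_valSet_maxIdeal]
    have hyA : v y ∈ valSet v A.toAddSubgroup := by
      rcases h.symm (v y) hyτ with h1 | h1
      · exact h1
      · have := h.add_mem_valSet hNA.mul_mem h1 ⟨y, hy, hy0, rfl⟩
        rw [sub_add_cancel] at this
        exact absurd this hg
    refine ⟨hyA, ?_⟩
    have h1 := h.nonneg_of_mem_valSet hyA
    by_contra hcon
    obtain ⟨u, hu0, hu⟩ := h.exists_val_eq (2 * τ)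
    refine hg ⟨u * y, hN.mul_mem u (h.P_le_overring (h.mem_P_of_le hu.ge)) y hy,
      mul_ne_zero hu0 hy0, ?_⟩
    rw [h.val_mul u y hu0 hy0]
    omega
  by_contra! hcon
  let Q : AddSubgroup K :=
    { carrier := {x | ∀ y ∈ N, x * y ∈ N}
      zero_mem' := fun y _ => by rw [zero_mul]; exact zero_mem _
      add_mem' := fun ha hb y hy => by rw [add_mul]; exact add_mem (ha y hy) (hb y hy)
      neg_mem' := fun ha y hy => by rw [neg_mul]; exact neg_mem (ha y hy) }
  have hQ : Q ≤ h.overring.toAddSubgroup := by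
    refine h.le_of_valSet_subset
      (fun a ha x hx => h.overring.mul_mem (h.le_overring ha) hx) h.P_le_overring
      (fun t ht y hy => hN.mul_mem t ht y hy) ?_
    rintro n ⟨t, ht, ht0, rfl⟩
    rw [h.mem_valSet_overring]
    by_contra hcon'
    rw [not_or] at hcon'
    by_cases htτ : v t = τ
    · refine hg ⟨t * w, ht w hw, mul_ne_zero ht0 hw0, ?_⟩
      rw [h.val_mul t w ht0 hw0]; omega
    · obtain ⟨a, ha, ha0, hav⟩ := h.exists_maxIdeal_val hcon'.1 htτ hcon'.2
      refine hg ⟨t * a, ht a (hle ha), mul_ne_zero ht0 ha0, ?_⟩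
      rw [h.val_mul t a ht0 ha0]; omega
  apply hx
  apply hQ
  intro y hy
  by_cases hy0 : y = 0
  · rw [hy0, mul_zero]; exact zero_mem _
  · exact hcon y hy hy0

/-- If the overring is not closed in `F`, then the ideals in `overringFamilyAdjoin F` that contain
the maximal ideal of `A` properly contain all elements of value at least `2 * τ`; in particular,
the maximal ideal is not an intersection of such ideals. -/
theorem P_le_of_maxIdeal_lt {F : Set (AddSubgroup K)} (hF : IsStarFamily A F)
    (hT : h.overring.toAddSubgroup ∉ F) {N : AddSubgroup K} (hN : N ∈ h.overringFamilyAdjoin F)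
    (hle : h.maxIdeal ≤ N) (hne : N ≠ h.maxIdeal) : h.P (2 * τ) ≤ N := by
  have hNT := (h.isStarFamily_overringFamilyAdjoin hF).frac N hN
  have hNA := (h.isFracModule_overring_iff.1 hNT).1
  by_cases hg : 2 * τ ∈ valSet v N
  · exact h.P_le_of_mem_valSet hNA.mul_mem (h.P_le_maxIdeal.trans hle) hg
  exfalso
  rcases hN with hN | ⟨x, hx0, rfl⟩
  · apply hT
    have h3 := h.three_le
    obtain ⟨y, hy0, hyv⟩ := h.exists_val_eq (2 * τ + 1)
    refine mem_family_of_separated hF hN.1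
      ⟨y, hy0, fun t ht => hNT.mul_mem t ht y (hle (h.P_le_maxIdeal (h.mem_P_of_le hyv.ge)))
        |> fun hh => by rwa [mul_comm] at hh⟩ ?_
    intro x hx
    obtain ⟨y, hy, hy0, hxy⟩ := h.exists_mul_not_mem_of_maxIdeal_lt hNT hle hne hg hx
    refine ⟨y, hy0, fun t ht => ?_, by rwa [mul_comm]⟩
    rw [mul_comm]
    exact hNT.mul_mem t ht y hy
  · have h1 := h.gapLength_maxIdeal_le hNA hle hg
    rw [h.gapLength_smul hx0] at h1
    have := h.gapLength_overring
    omega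

theorem socle_not_mem_overring {z : K} (hz : h.IsSocleElement z) : z ∉ h.overring := by
  intro hh
  have h3 := h.three_le
  have h1 : τ ∈ valSet v h.overring.toAddSubgroup := ⟨z, hh, hz.ne_zero, hz.val⟩
  rw [h.mem_valSet_overring] at h1
  rcases h1 with h1 | h1
  · exact h.tau_not_mem h1
  · omega

/-- A multiple of the overring is not stable under `z`. -/
theorem ne_smul_overring {z : K} (hz : h.IsSocleElement z) {N : AddSubgroup K}
    (hN : ∀ x ∈ N, z * x ∈ N) {x : K} (hx : x ≠ 0) : N ≠ x • h.overring.toAddSubgroup := by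
  rintro rfl
  have h1 := hN x (AddSubgroup.mem_smul_iff_exists_mul.2 ⟨1, h.overring.one_mem, mul_one x⟩)
  obtain ⟨t, ht, hxt⟩ := AddSubgroup.mem_smul_iff_exists_mul.1 h1
  rw [mul_comm z x] at hxt
  exact h.socle_not_mem_overring hz (mul_left_cancel₀ hx hxt ▸ ht)

/-- The multiples of the maximal ideal of `A`. -/
def maxIdealMultiples : Set (AddSubgroup K) := {N | ∃ x : K, x ≠ 0 ∧ N = x • h.maxIdeal}

theorem isStarFamily_diff_maxIdeal {F : Set (AddSubgroup K)} (hF : IsStarFamily A F)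
    (hT : h.overring.toAddSubgroup ∉ F) :
    IsStarFamily h.overring (h.overringFamilyAdjoin F \ h.maxIdealMultiples) := by
  obtain ⟨z, hz⟩ := h.exists_isSocleElement
  have hF' := h.isStarFamily_overringFamilyAdjoin hF
  obtain ⟨y, hy0, hyv⟩ := h.exists_val_eq (2 * τ)
  have hsmul : ∀ x : K, x ≠ 0 → ∀ N ∈ h.overringFamilyAdjoin F \ h.maxIdealMultiples,
      x • N ∈ h.overringFamilyAdjoin F \ h.maxIdealMultiples := by
    rintro x hx N ⟨hN, hN'⟩
    refine ⟨hF'.smul_mem x hx N hN, ?_⟩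
    rintro ⟨w, hw, hxw⟩
    refine hN' ⟨x⁻¹ * w, mul_ne_zero (inv_ne_zero hx) hw, ?_⟩
    rw [mul_smul, ← hxw, inv_smul_smul₀ hx]
  refine ⟨fun N hN => hF'.frac N hN.1, ⟨hF'.ring_mem, ?_⟩, ⟨hF'.bot_mem, ?_⟩, hsmul, ?_⟩
  · rintro ⟨x, hx, hxe⟩
    refine h.ne_smul_overring hz (N := h.maxIdeal) (fun _ hm => hz.mul_mem_maxIdeal hm)
      (inv_ne_zero hx) ?_
    rw [hxe, inv_smul_smul₀ hx]
  · rintro ⟨x, hx, hxe⟩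
    obtain ⟨w, hw0, hw⟩ := h.exists_val_eq (2 * τ + 1)
    have h1 : x * w ∈ x • h.maxIdeal :=
      AddSubgroup.mem_smul_iff_exists_mul.2 ⟨w, h.P_le_maxIdeal (h.mem_P_of_le hw.ge), rfl⟩
    rw [← hxe, AddSubgroup.mem_bot] at h1
    exact mul_ne_zero hx hw0 h1
  · intro S hS hne
    refine ⟨hF'.sInf_mem S (fun N hN => (hS hN).1) hne, ?_⟩
    rintro ⟨x, hx, hxe⟩
    have h1 : x * y ∈ sInf S := by
      rw [AddSubgroup.mem_sInf]
      intro N hN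
      have hN' := hsmul x⁻¹ (inv_ne_zero hx) N (hS hN)
      have hle : h.maxIdeal ≤ x⁻¹ • N := by
        intro m hm
        rw [AddSubgroup.mem_smul_iff_inv_mul_mem (inv_ne_zero hx), inv_inv]
        apply (sInf_le hN : sInf S ≤ N)
        rw [hxe]
        exact AddSubgroup.mem_smul_iff_exists_mul.2 ⟨m, hm, rfl⟩
      have h2 := h.P_le_of_maxIdeal_lt hF hT hN'.1 hle
        (fun hh => hN'.2 ⟨1, one_ne_zero, by rw [hh, one_smul]⟩) (h.mem_P_of_le hyv.ge)
      rwa [AddSubgroup.mem_smul_iff_inv_mul_mem (inv_ne_zero hx), inv_inv] at h2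
    rw [hxe] at h1
    obtain ⟨m, hm, hxm⟩ := AddSubgroup.mem_smul_iff_exists_mul.1 h1
    rw [mul_left_cancel₀ hx hxm] at hm
    exact h.frobenius_not_mem_maxIdeal ⟨y, hm, hy0, hyv⟩

end Removal

section ShortFamilies

variable (h : KunzSubring A v τ)
include h

/-- The zero ideal, the multiples of the overring, and the ideals of the overring with
property `Q`. -/
def shortFamily (Q : AddSubgroup K → Prop) : Set (AddSubgroup K) :=
  {N | N = ⊥ ∨ (∃ x : K, x ≠ 0 ∧ N = x • h.overring.toAddSubgroup) ∨
    (IsFracModule h.overring N ∧ Q N)}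

theorem isStarFamily_shortFamily {Q : AddSubgroup K → Prop}
    (hQs : ∀ x : K, x ≠ 0 → ∀ N, Q N → Q (x • N))
    (hQ1 : ∀ N, Q N → gapLength v N + 1 ≤ gapLength v h.maxIdeal)
    (hQ2 : ∀ N, gapLength v N + 2 ≤ gapLength v h.maxIdeal → Q N) :
    IsStarFamily h.overring (h.shortFamily Q) where
  frac := by
    rintro N (rfl | ⟨x, -, rfl⟩ | hN)
    · exact isFracModule_bot
    · exact h.isFracModule_overring_smul h.isFracModule_overring_self x
    · exact hN.1
  ring_mem := Or.inr (Or.inl ⟨1, one_ne_zero, (one_smul _ _).symm⟩)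
  bot_mem := Or.inl rfl
  smul_mem := by
    rintro x hx N (rfl | ⟨y, hy, rfl⟩ | hN)
    · exact Or.inl (AddSubgroup.map_bot _)
    · exact Or.inr (Or.inl ⟨x * y, mul_ne_zero hx hy, (mul_smul _ _ _).symm⟩)
    · exact Or.inr (Or.inr ⟨h.isFracModule_overring_smul hN.1 x, hQs x hx N hN.2⟩)
  sInf_mem := by
    intro S hS hne
    have hfr : ∀ N ∈ S, IsFracModule h.overring N := by
      intro N hN
      rcases hS hN with rfl | ⟨x, -, rfl⟩ | hN'
      · exact isFracModule_bot
      · exact h.isFracModule_overring_smul h.isFracModule_overring_self x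
      · exact hN'.1
    by_cases h0 : sInf S = ⊥
    · exact Or.inl h0
    rcases h.sInf_mem_or_gapLength_lt
      (fun N hN => (h.isFracModule_overring_iff.1 (hfr N hN)).1) hne h0 with h1 | ⟨N, hN, hlt⟩
    · exact hS h1
    · refine Or.inr (Or.inr ⟨isFracModule_sInf hfr hne, hQ2 _ ?_⟩)
      rcases hS hN with rfl | ⟨x, hx, rfl⟩ | hN'
      · exact absurd (eq_bot_iff.2 (sInf_le hN)) h0
      · rw [h.gapLength_smul hx] at hlt
        have := h.gapLength_overring
        omega
      · have := hQ1 N hN'.2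
        omega

end ShortFamilies

end KunzSubring

/-! ### Comparison of the two sets of star operations -/

namespace KunzSubring

variable {K : Type*} [Field K] {A : Subring K} {v : K → ℤ} {τ : ℤ}

section Witnesses

variable (h : KunzSubring A v τ)
include h

/-- The two smallest positive elements `s₁ < s₂` of the value semigroup. -/
theorem exists_two_least : ∃ s₁ s₂, s₁ ∈ valSet v A.toAddSubgroup ∧ s₂ ∈ valSet v A.toAddSubgroup ∧
    1 ≤ s₁ ∧ s₁ < s₂ ∧ (∀ n ∈ valSet v A.toAddSubgroup, 1 ≤ n → n = s₁ ∨ s₂ ≤ n) := by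
  have h3 := h.three_le
  obtain ⟨s₁, ⟨h1, h1'⟩, hmin1⟩ := Int.exists_least_of_bdd
    (P := fun n => n ∈ valSet v A.toAddSubgroup ∧ 1 ≤ n) ⟨1, fun n hn => hn.2⟩
    ⟨2 * τ + 1, h.mem_valSet_of_gt (by omega), by omega⟩
  obtain ⟨s₂, ⟨h2, h2'⟩, hmin2⟩ := Int.exists_least_of_bdd
    (P := fun n => n ∈ valSet v A.toAddSubgroup ∧ s₁ < n) ⟨s₁, fun n hn => hn.2.le⟩
    ⟨2 * τ + 1 + s₁, h.mem_valSet_of_gt (by omega), by omega⟩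
  refine ⟨s₁, s₂, h1, h2, h1', h2', fun n hn hn1 => ?_⟩
  have e1 := hmin1 n ⟨hn, hn1⟩
  by_cases hns : n = s₁
  · exact Or.inl hns
  · exact Or.inr (hmin2 n ⟨hn, by omega⟩)

/-- Upper bounds for the two smallest positive elements of the value semigroup. They come from the
symmetry of the pairs `τ + 1`, `τ - 1` and `τ + 2`, `τ - 2`, and need `3 ≤ τ`. -/
theorem two_least_bounds {s₁ s₂ : ℤ} (h1 : s₁ ∈ valSet v A.toAddSubgroup) (h1' : 1 ≤ s₁)
    (hmin : ∀ n ∈ valSet v A.toAddSubgroup, 1 ≤ n → n = s₁ ∨ s₂ ≤ n) (h12 : s₁ < s₂) :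
    s₂ < 2 * τ ∧ s₂ < 2 * s₁ ∨ s₁ < τ ∧ s₂ < 2 * τ ∧ s₂ < τ + s₁ := by
  have h3 := h.three_le
  have hne : s₁ ≠ τ := fun hh => h.tau_not_mem (hh ▸ h1)
  have hs1 : s₁ ≠ 1 := fun hh => h.one_not_mem (hh ▸ h1)
  have hs2 : s₁ ≠ 2 := fun hh => h.two_not_mem (hh ▸ h1)
  have e1 := h.symm (τ + 1) (by omega)
  have e2 := h.symm (τ + 2) (by omega)
  rw [show 2 * τ - (τ + 1) = τ - 1 by ring] at e1
  rw [show 2 * τ - (τ + 2) = τ - 2 by ring] at e2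
  rcases e1 with e1 | e1 <;> have f1 := hmin _ e1 (by omega) <;>
    rcases e2 with e2 | e2 <;> have f2 := hmin _ e2 (by omega) <;> omega

theorem ne_bot_of_P_le {N : AddSubgroup K} {c : ℤ} (hc : h.P c ≤ N) : N ≠ ⊥ := by
  rintro rfl
  obtain ⟨x, hx0, hx⟩ := h.exists_val_eq c
  exact hx0 (AddSubgroup.mem_bot.1 (hc (h.mem_P_of_le hx.ge)))

/-- The module `A w + {a ∈ A | v a > s}`. -/
def mulAddTail (w : K) (s : ℤ) : AddSubgroup K where
  carrier := {x | ∃ c ∈ A, ∃ r ∈ A.toAddSubgroup ⊓ h.P (s + 1), x = c * w + r}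
  zero_mem' := ⟨0, A.zero_mem, 0, zero_mem _, by ring⟩
  add_mem' := by
    rintro _ _ ⟨c, hc, r, hr, rfl⟩ ⟨d, hd, s, hs, rfl⟩
    exact ⟨c + d, A.add_mem hc hd, r + s, add_mem hr hs, by ring⟩
  neg_mem' := by
    rintro _ ⟨c, hc, r, hr, rfl⟩
    exact ⟨-c, A.neg_mem hc, -r, neg_mem hr, by ring⟩

theorem mul_mem_tail {s : ℤ} : ∀ a ∈ A, ∀ x ∈ A.toAddSubgroup ⊓ h.P s,
    a * x ∈ A.toAddSubgroup ⊓ h.P s :=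
  fun a ha x hx => ⟨A.mul_mem ha hx.1, by simpa using h.mul_mem_P (h.le_P_zero ha) hx.2⟩

theorem mem_valSet_tail {n s : ℤ} :
    n ∈ valSet v (A.toAddSubgroup ⊓ h.P s) ↔ n ∈ valSet v A.toAddSubgroup ∧ s ≤ n := by
  constructor
  · rintro ⟨x, hx, hx0, rfl⟩
    exact ⟨⟨x, hx.1, hx0, rfl⟩, hx.2 hx0⟩
  · rintro ⟨⟨x, hx, hx0, rfl⟩, h1⟩
    exact ⟨x, ⟨hx, h.mem_P_of_le h1⟩, hx0, rfl⟩

theorem isFracModule_overring_tail {s : ℤ} (hs : 1 ≤ s) (hsg : s ≤ 2 * τ + 1) :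
    IsFracModule h.overring (A.toAddSubgroup ⊓ h.P s) := by
  rw [isFracModule_overring_iff]
  refine ⟨h.isFracModule_of_bounds h.mul_mem_tail (b := 0)
    (inf_le_left.trans h.le_P_zero), ?_⟩
  rintro t ⟨a, ha, ht⟩ x hx
  have h1 : (t - a) * x ∈ h.P (2 * τ + 1) := h.P_anti (by omega) (h.mul_mem_P ht hx.2)
  have h2 : (t - a) * x ∈ A.toAddSubgroup ⊓ h.P s := ⟨h.P_le h1, h.P_anti hsg h1⟩
  have := add_mem h2 (h.mul_mem_tail a ha x hx)
  rwa [← add_mul, sub_add_cancel] at this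

theorem isFracModule_overring_mulAddTail {w : K} {s : ℤ} (hw1 : 1 ≤ v w)
    (hs : 0 ≤ s) (hsg : s ≤ 2 * τ) : IsFracModule h.overring (h.mulAddTail w s) := by
  have h3 := h.three_le
  have hA : ∀ a ∈ A, ∀ x ∈ h.mulAddTail w s, a * x ∈ h.mulAddTail w s := by
    rintro a ha _ ⟨c, hc, r, hr, rfl⟩
    exact ⟨a * c, A.mul_mem ha hc, a * r, h.mul_mem_tail a ha r hr, by ring⟩
  have hP1 : h.mulAddTail w s ≤ h.P 1 := by
    rintro _ ⟨c, hc, r, hr, rfl⟩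
    refine add_mem ?_ (h.P_anti (by omega) hr.2)
    simpa using h.mul_mem_P (h.le_P_zero hc) (h.mem_P_of_le hw1)
  rw [isFracModule_overring_iff]
  refine ⟨h.isFracModule_of_bounds hA hP1, ?_⟩
  rintro t ⟨a, ha, ht⟩ x hx
  have h1 := h.mul_mem_P ht (hP1 hx)
  have h2 : (t - a) * x ∈ h.mulAddTail w s :=
    ⟨0, A.zero_mem, (t - a) * x, ⟨h.P_le h1, h.P_anti (by omega) h1⟩, by ring⟩
  have := add_mem h2 (hA a ha x hx)
  rwa [← add_mul, sub_add_cancel] at this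

theorem mem_valSet_mulAddTail {w : K} {s : ℤ} (hw0 : w ≠ 0)
    (hwm : ∀ a ∈ h.maxIdeal, a * w ∈ A.toAddSubgroup ⊓ h.P (s + 1))
    (hws : v w ∈ valSet v A.toAddSubgroup → v w ≤ s) {n : ℤ} :
    n ∈ valSet v (h.mulAddTail w s) ↔ n = v w ∨ n ∈ valSet v A.toAddSubgroup ∧ s < n := by
  constructor
  · rintro ⟨x, ⟨c, hc, r, hr, rfl⟩, hx0, rfl⟩
    rcases h.mem_maxIdeal_or hc with hcm | ⟨hc0, hcv⟩
    · right
      have h1 := add_mem (hwm c hcm) hr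
      exact ⟨⟨_, h1.1, hx0, rfl⟩, h1.2 hx0⟩
    have hcw : v (c * w) = v w := by rw [h.val_mul c w hc0 hw0, hcv, zero_add]
    by_cases hrv : r ∈ h.P (v w + 1)
    · left
      rw [← hcw] at hrv ⊢
      exact (h.val_add_of_mem (mul_ne_zero hc0 hw0) hrv).2
    · right
      have hr0 : r ≠ 0 := fun hh => hrv (by rw [hh]; exact zero_mem _)
      have hr1 : v r ≤ v w := by
        by_contra hcon
        exact hrv (h.mem_P_of_le (by omega))
      have hr2 : v r ≠ v w := by
        intro hh
        have e1 := hws (hh ▸ ⟨r, hr.1, hr0, rfl⟩)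
        have e2 := hr.2 hr0
        omega
      have e3 := h.val_add_of_mem (x := r) (y := c * w) hr0 (h.mem_P_of_le (by omega))
      rw [add_comm, e3.2]
      have := hr.2 hr0
      exact ⟨⟨r, hr.1, hr0, rfl⟩, by omega⟩
  · rintro (rfl | hn)
    · exact ⟨w, ⟨1, A.one_mem, 0, zero_mem _, by ring⟩, hw0, rfl⟩
    · have h1 : n ∈ valSet v (A.toAddSubgroup ⊓ h.P (s + 1)) := h.mem_valSet_tail.2 ⟨hn.1, by omega⟩
      refine valSet_mono ?_ h1
      intro r hr
      exact ⟨0, A.zero_mem, r, hr, by ring⟩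

/-- The witnesses that separate the families of closed ideals: two ideals `N` and `C` of the
overring with `gapLength` one less than that of the maximal ideal of `A`, where `N` is stable
under the socle element `z`, and `C` is not a multiple of `N` or of the overring. Removing the
values `s₁`, `s₂` from `m` and putting back the larger one of `s₁`, `τ` gives `C`; removing
`s₁` gives `N`. -/
theorem exists_witnesses {z : K} (hz : h.IsSocleElement z) : ∃ N C : AddSubgroup K,
    N ≠ ⊥ ∧ C ≠ ⊥ ∧ IsFracModule h.overring N ∧ (∀ x ∈ N, z * x ∈ N) ∧
    gapLength v N + 1 = gapLength v h.maxIdeal ∧ IsFracModule h.overring C ∧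
    gapLength v C + 1 = gapLength v h.maxIdeal ∧ (∀ x : K, x ≠ 0 → N ≠ x • C) ∧
    (∀ x : K, x ≠ 0 → C ≠ x • h.overring.toAddSubgroup) := by
  have h3 := h.three_le
  obtain ⟨s₁, s₂, h1, h2, h1', h12, hmin⟩ := h.exists_two_least
  have hbd := h.two_least_bounds h1 h1' hmin h12
  have hs1τ : s₁ ≠ τ := fun hh => h.tau_not_mem (hh ▸ h1)
  have hs2τ : s₂ ≠ τ := fun hh => h.tau_not_mem (hh ▸ h2)
  have hs2g : s₂ < 2 * τ := by omega
  have hmval : ∀ a ∈ h.maxIdeal, a ∈ h.P s₁ := by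
    intro a ha ha0
    rcases hmin (v a) ⟨a, ha.1, ha0, rfl⟩ (ha.2 ha0) with e | e <;> omega
  -- `w` realizes the larger one of `s₁` and `τ`, while `p` is the smaller one
  obtain ⟨w, p, hw0, hwp, hwm⟩ : ∃ w p, w ≠ 0 ∧
      (v w = τ ∧ p = s₁ ∧ s₁ < τ ∨ v w = s₁ ∧ p = τ ∧ τ < s₁) ∧
      ∀ a ∈ h.maxIdeal, a * w ∈ A.toAddSubgroup ⊓ h.P (s₂ + 1) := by
    rcases lt_or_gt_of_ne hs1τ with hlt | hgt
    · refine ⟨z, s₁, hz.ne_zero, Or.inl ⟨hz.val, rfl, hlt⟩, fun a ha => ⟨?_, ?_⟩⟩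
      · rw [mul_comm]; exact hz.mul_mem a ha
      · exact h.P_anti (by omega) (h.mul_mem_P (hmval a ha) (h.mem_P_of_le hz.val.ge))
    · obtain ⟨w, hw, hw0, hwv⟩ := h1
      refine ⟨w, τ, hw0, Or.inr ⟨hwv, rfl, hgt⟩, fun a ha => ⟨A.mul_mem ha.1 hw, ?_⟩⟩
      exact h.P_anti (by omega) (h.mul_mem_P (hmval a ha) (h.mem_P_of_le hwv.ge))
  have hwτ : v w ∈ valSet v A.toAddSubgroup → v w = s₁ := fun hh => by
    rcases hwp with e | e
    · exact absurd (e.1 ▸ hh) h.tau_not_mem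
    · exact e.1
  have hCval : ∀ {n}, n ∈ valSet v (h.mulAddTail w s₂) ↔
      n = v w ∨ n ∈ valSet v A.toAddSubgroup ∧ s₂ < n :=
    h.mem_valSet_mulAddTail hw0 hwm (fun hh => by have := hwτ hh; omega)
  have hCP : h.P (2 * τ + 1) ≤ h.mulAddTail w s₂ := fun x hx =>
    ⟨0, A.zero_mem, x, ⟨h.P_le hx, h.P_anti (by omega) hx⟩, by ring⟩
  have hCg : 2 * τ ∉ valSet v (h.mulAddTail w s₂) := by
    rw [hCval]
    rintro (e | e)
    · rcases hwp with e' | e'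
      · omega
      · exact h.frobenius (by rw [e, e'.1]; exact h1)
    · exact h.frobenius e.1
  have hNP : h.P (2 * τ + 1) ≤ A.toAddSubgroup ⊓ h.P (s₁ + 1) :=
    le_inf h.P_le (h.P_anti (by omega))
  have hNg : 2 * τ ∉ valSet v (A.toAddSubgroup ⊓ h.P (s₁ + 1)) := fun hh =>
    h.frobenius (h.mem_valSet_tail.1 hh).1
  have hNT : IsFracModule h.overring (A.toAddSubgroup ⊓ h.P (s₁ + 1)) :=
    h.isFracModule_overring_tail (by omega) (by omega)
  have hCT : IsFracModule h.overring (h.mulAddTail w s₂) :=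
    h.isFracModule_overring_mulAddTail (by omega) (by omega) (by omega)
  -- the common part of the three value sets
  set Y : Set ℤ := {n | n ∈ valSet v A.toAddSubgroup ∧ s₂ < n ∧ n < 2 * τ} with hY
  have hYf : Y.Finite := (Set.finite_Icc s₂ (2 * τ)).subset fun n hn => ⟨hn.2.1.le, hn.2.2.le⟩
  have hs2Y : s₂ ∉ Y := fun hh => by have := hh.2.1; omega
  have hs1Y : s₁ ∉ insert s₂ Y := by
    rintro (hh | hh)
    · omega
    · have := hh.2.1; omega
  have hwY : v w ∉ Y := fun hh => by
    have e1 := hwτ hh.1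
    have := hh.2.1
    omega
  have hM : {n | n ∈ valSet v h.maxIdeal ∧ n < 2 * τ} = insert s₁ (insert s₂ Y) := by
    ext n
    constructor
    · rintro ⟨hn, hng⟩
      rw [h.mem_valSet_maxIdeal] at hn
      rcases hmin n hn.1 hn.2 with e | e
      · exact Or.inl e
      · rcases eq_or_lt_of_le e with e | e
        · exact Or.inr (Or.inl e.symm)
        · exact Or.inr (Or.inr ⟨hn.1, e, hng⟩)
    · rintro (rfl | rfl | hn)
      · exact ⟨h.mem_valSet_maxIdeal.2 ⟨h1, h1'⟩, by omega⟩
      · exact ⟨h.mem_valSet_maxIdeal.2 ⟨h2, by omega⟩, by omega⟩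
      · exact ⟨h.mem_valSet_maxIdeal.2 ⟨hn.1, by have := hn.2.1; omega⟩, hn.2.2⟩
  have hNs : {n | n ∈ valSet v (A.toAddSubgroup ⊓ h.P (s₁ + 1)) ∧ n < 2 * τ} = insert s₂ Y := by
    ext n
    constructor
    · rintro ⟨hn, hng⟩
      rw [h.mem_valSet_tail] at hn
      rcases hmin n hn.1 (by omega) with e | e
      · omega
      · rcases eq_or_lt_of_le e with e | e
        · exact Or.inl e.symm
        · exact Or.inr ⟨hn.1, e, hng⟩
    · rintro (rfl | hn)
      · exact ⟨h.mem_valSet_tail.2 ⟨h2, by omega⟩, by omega⟩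
      · exact ⟨h.mem_valSet_tail.2 ⟨hn.1, by have := hn.2.1; omega⟩, hn.2.2⟩
  have hCs : {n | n ∈ valSet v (h.mulAddTail w s₂) ∧ n < 2 * τ} = insert (v w) Y := by
    ext n
    constructor
    · rintro ⟨hn, hng⟩
      rw [hCval] at hn
      rcases hn with e | e
      · exact Or.inl e
      · exact Or.inr ⟨e.1, e.2, hng⟩
    · rintro (rfl | hn)
      · exact ⟨hCval.2 (Or.inl rfl), by omega⟩
      · exact ⟨hCval.2 (Or.inr ⟨hn.1, hn.2.1⟩), hn.2.2⟩
  have eM : gapLength v h.maxIdeal = Y.ncard + 2 := by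
    rw [h.gapLength_maxIdeal, hM, Set.ncard_insert_of_notMem hs1Y (hYf.insert _),
      Set.ncard_insert_of_notMem hs2Y hYf]
  have eN : gapLength v (A.toAddSubgroup ⊓ h.P (s₁ + 1)) = Y.ncard + 1 := by
    rw [h.gapLength_eq hNP hNg, hNs, Set.ncard_insert_of_notMem hs2Y hYf]
  have eC : gapLength v (h.mulAddTail w s₂) = Y.ncard + 1 := by
    rw [h.gapLength_eq hCP hCg, hCs, Set.ncard_insert_of_notMem hwY hYf]
  refine ⟨A.toAddSubgroup ⊓ h.P (s₁ + 1), h.mulAddTail w s₂,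
    h.ne_bot_of_P_le hNP, h.ne_bot_of_P_le hCP, hNT, ?_, by omega, hCT, by omega,
    ?_, ?_⟩
  · intro x hx
    refine ⟨hz.mul_mem x ⟨hx.1, h.P_anti (by omega) hx.2⟩, ?_⟩
    exact h.P_anti (by omega) (h.mul_mem_P (h.mem_P_of_le hz.val.ge) hx.2)
  · -- both have `2 * τ` as largest missing value, so `x` is a unit, but `s₂ ∈ v(N) \ v(C)`
    intro x hx heq
    have e0 : ∀ n, n ∈ valSet v (A.toAddSubgroup ⊓ h.P (s₁ + 1)) ↔
        n - v x ∈ valSet v (h.mulAddTail w s₂) := fun n => by rw [heq, h.valSet_smul hx]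
    have e1 : v x = 0 := by
      have f1 : ¬ (2 * τ + 1 ≤ 2 * τ - v x) := fun hh =>
        hNg ((e0 _).2 (h.mem_valSet_of_P_le hCP hh))
      have f2 : ¬ (2 * τ + 1 ≤ 2 * τ + v x) := fun hh =>
        hCg (by
          have := (e0 _).1 (h.mem_valSet_of_P_le hNP hh)
          rwa [add_sub_cancel_right] at this)
      omega
    have e2 := (e0 s₂).1 (h.mem_valSet_tail.2 ⟨h2, by omega⟩)
    rw [e1, sub_zero, hCval] at e2
    rcases e2 with e2 | e2
    · omega
    · omega
  · -- the largest value missing in the overring is `2 * τ - p`, so `x` would have value `p`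
    intro x hx heq
    have e0 : ∀ n, n ∈ valSet v (h.mulAddTail w s₂) ↔
        n - v x ∈ valSet v h.overring.toAddSubgroup := fun n => by rw [heq, h.valSet_smul hx]
    have hTp : 2 * τ - p ∉ valSet v h.overring.toAddSubgroup := by
      rw [h.mem_valSet_overring, not_or]
      refine ⟨?_, by omega⟩
      rcases hwp with e | e
      · rw [e.2.1]; exact h.not_mem_valSet_sub h1
      · rw [e.2.1, show 2 * τ - τ = τ by ring]; exact h.tau_not_mem
    have hTgt : ∀ n, 2 * τ - p < n → n ∈ valSet v h.overring.toAddSubgroup := by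
      intro n hn
      rw [h.mem_valSet_overring]
      by_contra hcon
      rw [not_or] at hcon
      have e1 := (h.symm n (by omega)).resolve_left hcon.1
      have e2 := h.nonneg_of_mem_valSet e1
      rcases hmin _ e1 (by omega) with e3 | e3 <;> omega
    have f1 : v x ≤ p := by
      by_contra hcon
      have := (e0 (2 * τ - p + v x)).1 (h.mem_valSet_of_P_le hCP (by omega))
      rw [add_sub_cancel_right] at this
      exact hTp this
    have f2 : p ≤ v x := by
      by_contra hcon
      exact hCg ((e0 _).2 (hTgt _ (by omega)))
    have f3 := (e0 (v x)).2 (by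
      rw [sub_self, h.mem_valSet_overring]
      exact Or.inl h.zero_mem_valSet)
    rw [hCval] at f3
    rcases f3 with f3 | f3
    · omega
    · rcases hwp with e | e
      · omega
      · exact h.tau_not_mem (by rw [← e.2.1, le_antisymm f2 f1]; exact f3.1)

end Witnesses

section Comparison

variable (h : KunzSubring A v τ)
include h

/-- If no canonical ideal is closed in `F`, then `F` is determined by the closed ideals of the
overring. -/
theorem family_le_of_overringFamily_le {F F' : Set (AddSubgroup K)} (hF : IsStarFamily A F)
    (hF' : IsStarFamily A F') (hcan : ∀ N ∈ F, ¬ h.IsCanonical N)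
    (hle : h.overringFamily F ⊆ h.overringFamily F') : F ⊆ F' := by
  intro N hN
  by_cases h0 : N = ⊥
  · rw [h0]; exact hF'.bot_mem
  rcases h.classification (hF.frac N hN) h0 with ⟨x, hx, hxe⟩ | ⟨x, hx, hxc⟩ | hT
  · have := hF'.smul_mem x⁻¹ (inv_ne_zero hx) _ hF'.ring_mem
    rwa [← hxe, inv_smul_smul₀ hx] at this
  · exact absurd hxc (hcan _ (hF.smul_mem x hx N hN))
  · exact (hle ⟨hN, hT⟩).1

theorem overringFamily_le_of_diff_eq {F F' : Set (AddSubgroup K)} (hF : IsStarFamily A F)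
    (hF' : IsStarFamily A F') (hT : h.overring.toAddSubgroup ∉ F)
    (heq : h.overringFamilyAdjoin F \ h.maxIdealMultiples =
      h.overringFamilyAdjoin F' \ h.maxIdealMultiples) :
    h.overringFamily F ⊆ h.overringFamily F' := by
  intro N hN
  by_cases hM : N ∈ h.maxIdealMultiples
  · obtain ⟨x, hx, rfl⟩ := hM
    exact ⟨hF'.smul_mem x hx _ (h.maxIdeal_mem_family hF'), hN.2⟩
  · have h1 : N ∈ h.overringFamilyAdjoin F \ h.maxIdealMultiples := ⟨Or.inl hN, hM⟩
    rw [heq] at h1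
    rcases h1.1 with h2 | ⟨x, hx, rfl⟩
    · exact h2
    · have := hF.smul_mem x⁻¹ (inv_ne_zero hx) _ hN.1
      rw [inv_smul_smul₀ hx] at this
      exact absurd this hT

/-- The overring has strictly more star operations than `A`. A star operation on `A` other than
the identity is sent to its restriction to the ideals of the overring if it closes the overring;
otherwise the multiples of the overring are added to the closed ideals, and the multiples of the
maximal ideal of `A` are removed from them, to record the difference. The image misses two star
operations `E₁` and `E₂` of the overring that do not close all ideals stable under the socle
element; one of them serves as image of the identity, the other one makes the inequality strict. -/
theorem exists_option_injective :
    ∃ f : Option {F : Set (AddSubgroup K) // IsStarFamily A F} →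
      {F : Set (AddSubgroup K) // IsStarFamily h.overring F}, Function.Injective f := by
  obtain ⟨z, hz⟩ := h.exists_isSocleElement
  obtain ⟨N, C, hN0, hC0, hNT, hNz, hNe, hCT, hCe, hNC, hCT'⟩ := h.exists_witnesses hz
  set e₀ := gapLength v h.maxIdeal with he₀
  let E₁ := h.shortFamily fun L => gapLength v L + 2 ≤ e₀ ∨ ∃ x : K, x ≠ 0 ∧ L = x • C
  let E₂ := h.shortFamily fun L => gapLength v L + 2 ≤ e₀
  have hE₁ : IsStarFamily h.overring E₁ := by
    apply h.isStarFamily_shortFamily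
    · rintro x hx L (hL | ⟨y, hy, rfl⟩)
      · left; rwa [h.gapLength_smul hx]
      · exact Or.inr ⟨x * y, mul_ne_zero hx hy, (mul_smul _ _ _).symm⟩
    · rintro L (hL | ⟨y, hy, rfl⟩)
      · omega
      · rw [h.gapLength_smul hy]; omega
    · exact fun L hL => Or.inl hL
  have hE₂ : IsStarFamily h.overring E₂ := by
    apply h.isStarFamily_shortFamily
    · intro x hx L hL; rwa [h.gapLength_smul hx]
    · intro L hL; omega
    · exact fun L hL => hL
  have hNE₁ : N ∉ E₁ := by
    rintro (h0 | ⟨x, hx, h1⟩ | ⟨-, h1 | ⟨x, hx, h1⟩⟩)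
    · exact hN0 h0
    · exact h.ne_smul_overring hz hNz hx h1
    · omega
    · exact hNC x hx h1
  have hNE₂ : N ∉ E₂ := by
    rintro (h0 | ⟨x, hx, h1⟩ | ⟨-, h1⟩)
    · exact hN0 h0
    · exact h.ne_smul_overring hz hNz hx h1
    · omega
  have hCE₁ : C ∈ E₁ := Or.inr (Or.inr ⟨hCT, Or.inr ⟨1, one_ne_zero, (one_smul _ _).symm⟩⟩)
  have hCE₂ : C ∉ E₂ := by
    rintro (h0 | ⟨x, hx, h1⟩ | ⟨-, h1⟩)
    · exact hC0 h0
    · exact hCT' x hx h1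
    · omega
  have hNF : ∀ F, IsStarFamily A F → N ∈ h.overringFamily F := fun F hF =>
    ⟨h.mem_family_of_socle_stable hF hz (h.isFracModule_overring_iff.1 hNT).1 hNz, hNT⟩
  have hNM : N ∉ h.maxIdealMultiples := by
    rintro ⟨x, hx, rfl⟩
    rw [h.gapLength_smul hx] at hNe
    omega
  have hexists : ∀ F : {F : Set (AddSubgroup K) // IsStarFamily A F},
      ∃ G : {F : Set (AddSubgroup K) // IsStarFamily h.overring F},
        ((∃ I ∈ F.1, h.IsCanonical I) ∧ G.1 = E₁) ∨
        ((∀ I ∈ F.1, ¬ h.IsCanonical I) ∧ h.overring.toAddSubgroup ∈ F.1 ∧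
          G.1 = h.overringFamily F.1) ∨
        ((∀ I ∈ F.1, ¬ h.IsCanonical I) ∧ h.overring.toAddSubgroup ∉ F.1 ∧
          G.1 = h.overringFamilyAdjoin F.1 \ h.maxIdealMultiples) := by
    rintro ⟨F, hF⟩
    by_cases hc : ∃ I ∈ F, h.IsCanonical I
    · exact ⟨⟨E₁, hE₁⟩, Or.inl ⟨hc, rfl⟩⟩
    have hc' : ∀ I ∈ F, ¬ h.IsCanonical I := fun I hI hIc => hc ⟨I, hI, hIc⟩
    by_cases hT : h.overring.toAddSubgroup ∈ F
    · exact ⟨⟨_, h.isStarFamily_overringFamily hF hT⟩, Or.inr (Or.inl ⟨hc', hT, rfl⟩)⟩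
    · exact ⟨⟨_, h.isStarFamily_diff_maxIdeal hF hT⟩, Or.inr (Or.inr ⟨hc', hT, rfl⟩)⟩
  choose f hf using hexists
  have hM : ∀ F, IsStarFamily A F → h.maxIdeal ∈ h.overringFamily F := fun F hF =>
    ⟨h.maxIdeal_mem_family hF, h.isFracModule_overring_maxIdeal⟩
  have hM' : h.maxIdeal ∈ h.maxIdealMultiples := ⟨1, one_ne_zero, (one_smul _ _).symm⟩
  have hinj : Function.Injective f := by
    intro F F' hFF'
    have hval : (f F).1 = (f F').1 := by rw [hFF']
    apply Subtype.ext
    rcases hf F with ⟨hc, e⟩ | ⟨hc, hT, e⟩ | ⟨hc, hT, e⟩ <;>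
      rcases hf F' with ⟨hc', e'⟩ | ⟨hc', hT', e'⟩ | ⟨hc', hT', e'⟩ <;> rw [e, e'] at hval
    · obtain ⟨I, hI, hIc⟩ := hc
      obtain ⟨I', hI', hIc'⟩ := hc'
      apply Set.Subset.antisymm
      · exact fun L hL => h.mem_family_of_isCanonical F'.2 hI' hIc' (F.2.frac L hL)
      · exact fun L hL => h.mem_family_of_isCanonical F.2 hI hIc (F'.2.frac L hL)
    · exact absurd (hval ▸ hNF _ F'.2) hNE₁
    · exact absurd (hval ▸ ⟨Or.inl (hNF _ F'.2), hNM⟩) hNE₁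
    · exact absurd (hval ▸ hNF _ F.2) hNE₁
    · exact Set.Subset.antisymm (h.family_le_of_overringFamily_le F.2 F'.2 hc hval.subset)
        (h.family_le_of_overringFamily_le F'.2 F.2 hc' hval.symm.subset)
    · exact absurd hM' (show h.maxIdeal ∈ h.overringFamilyAdjoin F'.1 \ h.maxIdealMultiples from
        hval ▸ hM _ F.2).2
    · exact absurd (hval ▸ ⟨Or.inl (hNF _ F.2), hNM⟩) hNE₁
    · exact absurd hM' (show h.maxIdeal ∈ h.overringFamilyAdjoin F.1 \ h.maxIdealMultiples from
        hval.symm ▸ hM _ F'.2).2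
    · exact Set.Subset.antisymm
        (h.family_le_of_overringFamily_le F.2 F'.2 hc
          (h.overringFamily_le_of_diff_eq F.2 F'.2 hT hval))
        (h.family_le_of_overringFamily_le F'.2 F.2 hc'
          (h.overringFamily_le_of_diff_eq F'.2 F.2 hT' hval.symm))
  have hE₂f : ∀ F, f F ≠ ⟨E₂, hE₂⟩ := by
    intro F hFe
    have hval : (f F).1 = E₂ := by rw [hFe]
    rcases hf F with ⟨hc, e⟩ | ⟨hc, hT, e⟩ | ⟨hc, hT, e⟩ <;> rw [e] at hval
    · exact hCE₂ (hval ▸ hCE₁)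
    · exact hNE₂ (hval ▸ hNF _ F.2)
    · exact hNE₂ (hval ▸ ⟨Or.inl (hNF _ F.2), hNM⟩)
  refine ⟨fun o => o.elim ⟨E₂, hE₂⟩ f, ?_⟩
  rintro (_ | F) (_ | F') hFF'
  · rfl
  · exact absurd hFF'.symm (hE₂f F')
  · exact absurd hFF' (hE₂f F)
  · exact congrArg some (hinj hFF')

end Comparison

end KunzSubring

/-! ### Finiteness -/

namespace PseudoSymmetricSubring

variable {K : Type*} [Field K] {A : Subring K} {v : K → ℤ} {τ : ℤ}

/-- There are at most three gaps if `τ ≤ 2`. -/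
theorem gaps_subset (h : PseudoSymmetricSubring A v τ) (hτ : τ ≤ 2) {n : ℤ} (hn0 : 0 ≤ n)
    (hn : n ∉ valSet v A.toAddSubgroup) : n = 1 ∨ n = 2 ∨ n = 4 := by
  have h1 := h.one_le
  have e0 : n ≠ 0 := fun hh => hn (hh ▸ h.zero_mem_valSet)
  have e1 : ¬ 2 * τ < n := fun hh => hn (h.mem_valSet_of_gt hh)
  have e3 : n ≠ 3 := by
    rintro rfl
    have e4 := (h.symm 3 (by omega)).resolve_left hn
    rw [show 2 * τ - 3 = 1 by omega] at e4
    exact h.one_not_mem e4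
  omega

end PseudoSymmetricSubring

namespace KunzSubring

variable {K : Type*} [Field K] {A : Subring K} {v : K → ℤ} {τ : ℤ}

section Finite

variable (h : KunzSubring A v τ)
include h

/-- Over a finite residue field, the quotients of the powers of the valuation ideal are finite. -/
theorem exists_finite_representatives
    (hfin : ∃ s : Set K, s.Finite ∧ ∀ a ∈ A, ∃ r ∈ s, a - r ∈ h.P 1) (n : ℕ) :
    ∃ s : Set K, s.Finite ∧ ∀ x ∈ h.P 0, ∃ r ∈ s, x - r ∈ h.P n := by
  obtain ⟨s, hs, hsA⟩ := hfin
  induction n with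
  | zero => exact ⟨{0}, Set.finite_singleton 0, fun x hx => ⟨0, rfl, by simpa using hx⟩⟩
  | succ n ih =>
    obtain ⟨s', hs', hsP⟩ := ih
    obtain ⟨p, hp0, hp⟩ := h.exists_val_eq n
    refine ⟨(fun q : K × K => q.1 + q.2 * p) '' (s' ×ˢ s), (hs'.prod hs).image _, ?_⟩
    intro x hx
    obtain ⟨r, hr, hxr⟩ := hsP x hx
    obtain ⟨a, ha, hxa⟩ : ∃ a ∈ A, x - r - a * p ∈ h.P (n + 1 : ℕ) := by
      by_cases hxr' : x - r ∈ h.P (n + 1 : ℕ)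
      · exact ⟨0, A.zero_mem, by simpa using hxr'⟩
      · have h0 : x - r ≠ 0 := fun hh => hxr' (by rw [hh]; exact zero_mem _)
        have hv : v (x - r) = n := by
          have e1 := hxr h0
          by_contra hne
          exact hxr' (h.mem_P_of_le (by push_cast; omega))
        obtain ⟨a, ha, -, -, hr⟩ := h.exists_unit_mul h0 hp0 (hv.trans hp.symm)
        rw [hv] at hr
        exact ⟨a, ha, by push_cast; exact hr⟩
    obtain ⟨b, hb, hab⟩ := hsA a ha
    refine ⟨r + b * p, ⟨(r, b), ⟨hr, hb⟩, rfl⟩, ?_⟩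
    have e1 : (a - b) * p ∈ h.P (n + 1 : ℕ) := by
      have := h.mul_mem_P hab (h.mem_P_of_le hp.ge)
      push_cast
      rwa [add_comm] at this
    have := add_mem hxa e1
    convert this using 1
    ring

/-- Over a finite residue field, `A` has only finitely many star operations: a star operation is
determined by the closed ideals between `A` and the valuation ring. -/
theorem finite_families (hfin : ∃ s : Set K, s.Finite ∧ ∀ a ∈ A, ∃ r ∈ s, a - r ∈ h.P 1) :
    Finite {F : Set (AddSubgroup K) // IsStarFamily A F} := by
  have h3 := h.three_le
  obtain ⟨s, hs, hsP⟩ := h.exists_finite_representatives hfin (2 * τ + 1).toNat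
  rw [Int.toNat_of_nonneg (by omega)] at hsP
  set U : Set (AddSubgroup K) := {N | h.P (2 * τ + 1) ≤ N ∧ N ≤ h.P 0} with hU
  have hUf : U.Finite := by
    refine Set.Finite.of_finite_image (f := fun N => (N : Set K) ∩ s)
      (hs.finite_subsets.subset ?_) ?_
    · rintro _ ⟨N, -, rfl⟩
      exact Set.inter_subset_right
    · have key : ∀ N ∈ U, ∀ N' ∈ U, (N : Set K) ∩ s = (N' : Set K) ∩ s → N ≤ N' := by
        intro N hN N' hN' heq x hx
        obtain ⟨r, hr, hxr⟩ := hsP x (hN.2 hx)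
        have h1 : r ∈ (N : Set K) ∩ s := by
          refine ⟨?_, hr⟩
          have := sub_mem hx (hN.1 hxr)
          rwa [sub_sub_cancel] at this
        rw [heq] at h1
        have := add_mem (hN'.1 hxr) h1.1
        rwa [sub_add_cancel] at this
      intro N hN N' hN' heq
      exact le_antisymm (key N hN N' hN' heq) (key N' hN' N hN heq.symm)
  have hsub : ∀ F F' : Set (AddSubgroup K), IsStarFamily A F → IsStarFamily A F' →
      F ∩ U = F' ∩ U → F ⊆ F' := by
    intro F F' hF hF' heq N hN
    by_cases h0 : N = ⊥
    · rw [h0]; exact hF'.bot_mem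
    obtain ⟨x, hx, h1, hP⟩ := h.exists_smul_normalized (hF.frac N hN) h0
    have hxN := hF.smul_mem x hx N hN
    have h2 : x • N ∈ F ∩ U := by
      refine ⟨hxN, h.P_le.trans fun a ha => ?_, hP⟩
      have := (hF.frac _ hxN).mul_mem a ha 1 h1
      rwa [mul_one] at this
    rw [heq] at h2
    have := hF'.smul_mem x⁻¹ (inv_ne_zero hx) _ h2.1
    rwa [inv_smul_smul₀ hx] at this
  have : Finite {T : Set (AddSubgroup K) // T ⊆ U} := hUf.finite_subsets.to_subtype
  refine Finite.of_injective (β := {T : Set (AddSubgroup K) // T ⊆ U})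
    (fun F => ⟨F.1 ∩ U, Set.inter_subset_right⟩) ?_
  intro F F' heq
  have heq' : F.1 ∩ U = F'.1 ∩ U := congrArg Subtype.val heq
  exact Subtype.ext (Set.Subset.antisymm (hsub _ _ F.2 F'.2 heq') (hsub _ _ F'.2 F.2 heq'.symm))

end Finite

end KunzSubring

/-! ### The valuation on the quotient field of a discrete valuation ring -/

section Valuation

open IsDiscreteValuationRing

variable (V K : Type*) [CommRing V] [IsDomain V] [IsDiscreteValuationRing V] [Field K]
  [Algebra V K] [IsFractionRing V K]

/-- The normalized valuation on the quotient field of `V`, with an irrelevant value at `0`. -/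
noncomputable def fieldVal (x : K) : ℤ :=
  ((addVal V (IsFractionRing.div_surjective (A := V) x).choose).toNat : ℤ) -
    (addVal V (IsFractionRing.div_surjective (A := V) x).choose_spec.choose).toNat

variable {V K}

theorem coe_toNat_addVal {a : V} (ha : a ≠ 0) : ((addVal V a).toNat : ℕ∞) = addVal V a :=
  ENat.natCast_toNat (fun hh => ha (addVal_eq_top_iff.1 hh))

theorem toNat_addVal_mul {a b : V} (ha : a ≠ 0) (hb : b ≠ 0) :
    (addVal V (a * b)).toNat = (addVal V a).toNat + (addVal V b).toNat := by
  have h1 : ((addVal V (a * b)).toNat : ℕ∞) = ((addVal V a).toNat + (addVal V b).toNat : ℕ) := by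
    rw [coe_toNat_addVal (mul_ne_zero ha hb), addVal_mul]
    push_cast
    rw [coe_toNat_addVal ha, coe_toNat_addVal hb]
  exact_mod_cast h1

theorem dvd_iff_toNat_addVal {a b : V} (ha : a ≠ 0) (hb : b ≠ 0) :
    a ∣ b ↔ (addVal V a).toNat ≤ (addVal V b).toNat := by
  rw [← addVal_le_iff_dvd, ← coe_toNat_addVal ha, ← coe_toNat_addVal hb]
  simp

theorem isUnit_iff_toNat_addVal {a : V} (ha : a ≠ 0) : IsUnit a ↔ (addVal V a).toNat = 0 := by
  rw [isUnit_iff_dvd_one, dvd_iff_toNat_addVal ha one_ne_zero, addVal_one]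
  simp

theorem fieldVal_eq_sub {x : K} {a b : V} (ha : a ≠ 0) (hb : b ≠ 0)
    (hx : x * algebraMap V K b = algebraMap V K a) :
    fieldVal V K x = (addVal V a).toNat - (addVal V b).toNat := by
  have inj := IsFractionRing.injective V K
  let c := (IsFractionRing.div_surjective (A := V) x).choose
  let d := (IsFractionRing.div_surjective (A := V) x).choose_spec.choose
  have hd0 : d ∈ V⁰ := (IsFractionRing.div_surjective (A := V) x).choose_spec.choose_spec.1
  have hcd : algebraMap V K c / algebraMap V K d = x :=
    (IsFractionRing.div_surjective (A := V) x).choose_spec.choose_spec.2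
  change ((addVal V c).toNat : ℤ) - (addVal V d).toNat = _
  have hd0' : d ≠ 0 := nonZeroDivisors.ne_zero hd0
  have hdK : algebraMap V K d ≠ 0 := by simpa using hd0'
  have haK : algebraMap V K a ≠ 0 := by simpa using ha
  have hx0 : x ≠ 0 := by
    rintro rfl
    rw [zero_mul] at hx
    exact haK hx.symm
  rw [div_eq_iff hdK] at hcd
  have hc0 : c ≠ 0 := by
    intro hh
    rw [hh, map_zero] at hcd
    exact mul_ne_zero hx0 hdK hcd.symm
  have hmul : c * b = a * d := by
    apply inj
    rw [map_mul, map_mul, ← hx, hcd]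
    ring
  have h1 := congrArg (fun t => (addVal V t).toNat) hmul
  simp only [toNat_addVal_mul hc0 hb, toNat_addVal_mul ha hd0'] at h1
  omega

theorem fieldVal_algebraMap {a : V} (ha : a ≠ 0) :
    fieldVal V K (algebraMap V K a) = (addVal V a).toNat := by
  have := fieldVal_eq_sub (K := K) (x := algebraMap V K a) ha one_ne_zero (by simp)
  simpa using this

theorem exists_eq_div {x : K} (hx : x ≠ 0) :
    ∃ a b : V, a ≠ 0 ∧ b ≠ 0 ∧ x * algebraMap V K b = algebraMap V K a := by
  obtain ⟨a, b, hb, rfl⟩ := IsFractionRing.div_surjective (A := V) x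
  have hb0 : b ≠ 0 := nonZeroDivisors.ne_zero hb
  have hbK : algebraMap V K b ≠ 0 := by simpa using hb0
  refine ⟨a, b, ?_, hb0, by field_simp⟩
  rintro rfl
  simp at hx

theorem fieldVal_mul {x y : K} (hx : x ≠ 0) (hy : y ≠ 0) :
    fieldVal V K (x * y) = fieldVal V K x + fieldVal V K y := by
  obtain ⟨a, b, ha, hb, hab⟩ := exists_eq_div (V := V) hx
  obtain ⟨c, d, hc, hd, hcd⟩ := exists_eq_div (V := V) hy
  rw [fieldVal_eq_sub ha hb hab, fieldVal_eq_sub hc hd hcd,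
    fieldVal_eq_sub (mul_ne_zero ha hc) (mul_ne_zero hb hd) (by
      rw [map_mul, map_mul, ← hab, ← hcd]; ring),
    toNat_addVal_mul ha hc, toNat_addVal_mul hb hd]
  push_cast
  ring

/-- The valuation ring consists of the elements of nonnegative value. -/
theorem fieldVal_nonneg_iff {x : K} (hx : x ≠ 0) :
    0 ≤ fieldVal V K x ↔ ∃ a : V, algebraMap V K a = x := by
  constructor
  · intro h0
    obtain ⟨a, b, ha, hb, hab⟩ := exists_eq_div (V := V) hx
    rw [fieldVal_eq_sub ha hb hab] at h0
    obtain ⟨c, rfl⟩ := (dvd_iff_toNat_addVal hb ha).2 (by omega)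
    refine ⟨c, ?_⟩
    have hbK : algebraMap V K b ≠ 0 := by simpa using hb
    apply mul_right_cancel₀ hbK
    rw [hab, map_mul, mul_comm]
  · rintro ⟨a, rfl⟩
    have ha : a ≠ 0 := by
      rintro rfl
      simp at hx
    rw [fieldVal_algebraMap ha]
    omega

theorem fieldVal_inv {x : K} (hx : x ≠ 0) : fieldVal V K x⁻¹ = - fieldVal V K x := by
  have h1 := fieldVal_mul (V := V) hx (inv_ne_zero hx)
  have h2 := fieldVal_algebraMap (V := V) (K := K) one_ne_zero
  rw [mul_inv_cancel₀ hx] at h1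
  rw [map_one, addVal_one] at h2
  simp only [ENat.toNat_zero, Nat.cast_zero] at h2
  omega

theorem le_fieldVal_add {n : ℤ} {x y : K} (hx : x ≠ 0) (hy : y ≠ 0) (hxy : x + y ≠ 0)
    (hnx : n ≤ fieldVal V K x) (hny : n ≤ fieldVal V K y) : n ≤ fieldVal V K (x + y) := by
  have key : ∀ x y : K, x ≠ 0 → y ≠ 0 → x + y ≠ 0 → fieldVal V K x ≤ fieldVal V K y →
      fieldVal V K x ≤ fieldVal V K (x + y) := by
    intro x y hx hy hxy hle
    have hx' := inv_ne_zero hx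
    obtain ⟨a, ha⟩ := (fieldVal_nonneg_iff (V := V) (mul_ne_zero hy hx')).1 (by
      rw [fieldVal_mul hy hx', fieldVal_inv hx]; omega)
    have h1 := (fieldVal_nonneg_iff (V := V) (mul_ne_zero hxy hx')).2 ⟨1 + a, by
      rw [map_add, map_one, ha, add_mul, mul_inv_cancel₀ hx]⟩
    rw [fieldVal_mul hxy hx', fieldVal_inv hx] at h1
    omega
  rcases le_total (fieldVal V K x) (fieldVal V K y) with h1 | h1
  · exact hnx.trans (key x y hx hy hxy h1)
  · rw [add_comm] at hxy ⊢
    exact hny.trans (key y x hy hx hxy h1)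

end Valuation

/-! ### Kunz domains -/

section KunzDomain

set_option linter.unusedSectionVars false

open IsDiscreteValuationRing

variable {R V K : Type*} [CommRing R] [CommRing V] [IsDomain V]
  [IsDiscreteValuationRing V] [Field K] [Algebra R V] [Algebra R K] [Algebra V K]
  [IsScalarTower R V K] [IsFractionRing R K] [IsFractionRing V K]
  [IsLocalRing R] [IsNoetherianRing R]

theorem mem_valSet_range_iff {n : ℤ} :
    n ∈ valSet (fieldVal V K) (algebraMap R K).range.toAddSubgroup ↔
      ∃ s ∈ valueSemigroup R V, (s : ℤ) = n := by
  constructor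
  · rintro ⟨_, ⟨r, rfl⟩, hx0, rfl⟩
    rw [IsScalarTower.algebraMap_apply R V K] at hx0 ⊢
    have h0 : algebraMap R V r ≠ 0 := fun hh => hx0 (by rw [hh, map_zero])
    exact ⟨(addVal V (algebraMap R V r)).toNat, ⟨r, (coe_toNat_addVal h0).symm⟩,
      (fieldVal_algebraMap h0).symm⟩
  · rintro ⟨s, ⟨r, hr⟩, rfl⟩
    have h0 : algebraMap R V r ≠ 0 := fun hh => by
      rw [hh, addVal_zero] at hr
      exact ENat.top_ne_natCast s hr
    refine ⟨algebraMap R K r, ⟨r, rfl⟩, ?_, ?_⟩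
    · rw [IsScalarTower.algebraMap_apply R V K]
      simpa using h0
    · rw [IsScalarTower.algebraMap_apply R V K, fieldVal_algebraMap h0, hr]
      rfl

theorem one_le_fieldVal_of_mem_maximalIdeal {a : V} (ha : a ∈ IsLocalRing.maximalIdeal V)
    (h0 : a ≠ 0) : 1 ≤ fieldVal V K (algebraMap V K a) := by
  rw [fieldVal_algebraMap h0]
  have : (addVal V a).toNat ≠ 0 := fun hh =>
    (IsLocalRing.mem_maximalIdeal a).1 ha ((isUnit_iff_toNat_addVal h0).2 hh)
  omega

theorem isUnit_of_fieldVal_eq_zero {a : V} (h0 : a ≠ 0)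
    (ha : fieldVal V K (algebraMap V K a) = 0) : IsUnit a := by
  rw [fieldVal_algebraMap h0] at ha
  exact (isUnit_iff_toNat_addVal h0).2 (by omega)

/-- Residual rationality: elements of equal value differ by a unit of `R`, up to an element of
larger value. -/
theorem IsKunzDomain.exists_residue (hK : IsKunzDomain R V K) {x y : K} (hx : x ≠ 0) (hy : y ≠ 0)
    (hxy : fieldVal V K x = fieldVal V K y) :
    ∃ a ∈ (algebraMap R K).range, a ≠ 0 ∧ fieldVal V K a = 0 ∧
      (x - a * y = 0 ∨ fieldVal V K x + 1 ≤ fieldVal V K (x - a * y)) := by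
  have hy' := inv_ne_zero hy
  have hv : fieldVal V K (x * y⁻¹) = 0 := by
    rw [fieldVal_mul hx hy', fieldVal_inv hy]; omega
  have hxy0 : x * y⁻¹ ≠ 0 := mul_ne_zero hx hy'
  obtain ⟨u, hu⟩ := (fieldVal_nonneg_iff (V := V) hxy0).1 hv.ge
  have hu0 : u ≠ 0 := by
    rintro rfl
    rw [map_zero] at hu
    exact hxy0 hu.symm
  have huU : IsUnit u := isUnit_of_fieldVal_eq_zero (K := K) hu0 (by rw [hu, hv])
  have := hK.isLocalHom
  obtain ⟨rb, hrb⟩ := hK.residue_bijective.2 (IsLocalRing.residue V u)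
  obtain ⟨r, rfl⟩ := IsLocalRing.residue_surjective rb
  rw [IsLocalRing.ResidueField.map_residue] at hrb
  have hmem : u - algebraMap R V r ∈ IsLocalRing.maximalIdeal V := by
    rw [← IsLocalRing.residue_eq_zero_iff, map_sub, hrb, sub_self]
  have hrU : IsUnit (algebraMap R V r) := by
    by_contra hcon
    have h1 := add_mem hmem ((IsLocalRing.mem_maximalIdeal _).2 hcon)
    rw [sub_add_cancel] at h1
    exact (IsLocalRing.mem_maximalIdeal _).1 h1 huU
  have hr0 : algebraMap R V r ≠ 0 := hrU.ne_zero
  have hrv : fieldVal V K (algebraMap R K r) = 0 := by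
    rw [IsScalarTower.algebraMap_apply R V K, fieldVal_algebraMap hr0,
      (isUnit_iff_toNat_addVal hr0).1 hrU]
    rfl
  refine ⟨algebraMap R K r, ⟨r, rfl⟩, ?_, hrv, ?_⟩
  · rw [IsScalarTower.algebraMap_apply R V K]
    simpa using hr0
  · have he : x - algebraMap R K r * y = algebraMap V K (u - algebraMap R V r) * y := by
      rw [map_sub, hu, ← IsScalarTower.algebraMap_apply R V K]
      field_simp
    rw [he]
    by_cases h0 : u - algebraMap R V r = 0
    · left; rw [h0, map_zero, zero_mul]
    · right
      have h1 := one_le_fieldVal_of_mem_maximalIdeal (K := K) hmem h0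
      rw [fieldVal_mul (fun hh => h0 (IsFractionRing.injective V K (by rw [hh, map_zero]))) hy]
      omega

/-- The image of a Kunz domain in its quotient field is a pseudo-symmetric subring. -/
theorem IsKunzDomain.exists_pseudoSymmetricSubring (hK : IsKunzDomain R V K) :
    ∃ τ : ℤ, IsFrobeniusNumberOf (valueSemigroup R V) (2 * τ) ∧
      PseudoSymmetricSubring (algebraMap R K).range (fieldVal V K) τ := by
  obtain ⟨-, g, hg, ⟨τ, rfl⟩, hsymm⟩ := hK.pseudoSymmetric
  rw [← two_mul] at hg hsymm
  have hgt : ∀ n : ℤ, 2 * τ < n →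
      n ∈ valSet (fieldVal V K) (algebraMap R K).range.toAddSubgroup := by
    intro n hn
    rw [mem_valSet_range_iff]
    by_contra hcon
    have := hg.2 hcon
    omega
  have hneg : -1 ≤ 2 * τ := hg.2 (by rintro ⟨s, -, hs⟩; omega)
  have hzero : (0 : ℤ) ∈ valSet (fieldVal V K) (algebraMap R K).range.toAddSubgroup :=
    mem_valSet_range_iff.2 ⟨0, zero_mem _, rfl⟩
  have hfrob : 2 * τ ∉ valSet (fieldVal V K) (algebraMap R K).range.toAddSubgroup := fun hh =>
    hg.1 (mem_valSet_range_iff.1 hh)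
  have hτ0 : τ ≠ 0 := by
    rintro rfl
    exact hfrob (by simpa using hzero)
  refine ⟨τ, hg,
    { val_mul := fun x y hx hy => fieldVal_mul hx hy
      le_val_add := fun n x y hx hy hxy h1 h2 => le_fieldVal_add hx hy hxy h1 h2
      val_nonneg := ?_
      inv_mem := ?_
      residue := fun x y hx hy hxy => hK.exists_residue hx hy hxy
      mem_of_val := ?_
      frobenius := hfrob
      symm := ?_
      one_le := by omega }⟩
  · rintro _ ⟨r, rfl⟩ h0
    exact (fieldVal_nonneg_iff h0).2
      ⟨algebraMap R V r, (IsScalarTower.algebraMap_apply R V K r).symm⟩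
  · rintro _ ⟨r, rfl⟩ h0 hv
    rw [IsScalarTower.algebraMap_apply R V K] at h0 hv
    have h1 := isUnit_of_fieldVal_eq_zero (fun hh => h0 (by rw [hh, map_zero])) hv
    have := hK.isLocalHom
    obtain ⟨u, rfl⟩ := isUnit_of_map_unit (algebraMap R V) r h1
    refine ⟨((u⁻¹ : Rˣ) : R), ?_⟩
    rw [map_units_inv]
  · -- subtracting elements of `R` raises the value until the conductor is reached
    obtain ⟨c, hc0, hc⟩ := hK.conductor_ne_zero
    have hcond : ∀ x : K, x ≠ 0 → fieldVal V K c ≤ fieldVal V K x →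
        x ∈ (algebraMap R K).range := by
      intro x hx hcx
      obtain ⟨a, ha⟩ := (fieldVal_nonneg_iff (V := V) (mul_ne_zero hx (inv_ne_zero hc0))).1 (by
        rw [fieldVal_mul hx (inv_ne_zero hc0), fieldVal_inv hc0]; omega)
      obtain ⟨r, hr⟩ := hc a
      refine ⟨r, ?_⟩
      rw [hr, ha]
      field_simp
    have key : ∀ k : ℕ, ∀ x : K, x ≠ 0 → 2 * τ + 1 ≤ fieldVal V K x →
        fieldVal V K c - k ≤ fieldVal V K x → x ∈ (algebraMap R K).range := by
      intro k
      induction k with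
      | zero => intro x hx _ h1; exact hcond x hx (by simpa using h1)
      | succ k ih =>
        intro x hx hxg hxk
        obtain ⟨a, ha, ha0, hav⟩ := hgt (fieldVal V K x) (by omega)
        obtain ⟨b, hb, hb0, hbv, h1⟩ := hK.exists_residue hx ha0 hav.symm
        have hba : b * a ∈ (algebraMap R K).range := mul_mem hb ha
        have h2 : x - b * a ∈ (algebraMap R K).range := by
          by_cases h0 : x - b * a = 0
          · rw [h0]; exact zero_mem _
          · have h3 := h1.resolve_left h0
            exact ih _ h0 (by omega) (by push_cast at hxk; omega)
        have := add_mem h2 hba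
        rwa [sub_add_cancel] at this
    intro x hx hxg
    exact key (fieldVal V K c - fieldVal V K x).toNat x hx hxg (by omega)
  · intro n hn
    by_cases hn0 : 0 ≤ n
    · have h1 := hsymm n.toNat (by
        rw [Int.toNat_of_nonneg hn0]
        omega)
      rw [mem_valSet_range_iff, mem_valSet_range_iff]
      rcases h1 with h1 | ⟨s, hs, hsn⟩
      · exact Or.inl ⟨n.toNat, h1, Int.toNat_of_nonneg hn0⟩
      · right
        rw [Int.toNat_of_nonneg hn0] at hsn
        exact ⟨s, hs, hsn⟩
    · exact Or.inr (hgt _ (by omega))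

/-- The elements of the quotient field that are represented in a submodule of `V / R`. -/
def liftSubmodule (N : Submodule R (V ⧸ LinearMap.range (Algebra.linearMap R V))) :
    AddSubgroup K :=
  (N.comap (Submodule.mkQ _)).toAddSubgroup.map (algebraMap V K).toAddMonoidHom

theorem mem_liftSubmodule {N : Submodule R (V ⧸ LinearMap.range (Algebra.linearMap R V))}
    {x : K} : x ∈ liftSubmodule N ↔ ∃ a : V, Submodule.mkQ _ a ∈ N ∧ algebraMap V K a = x :=
  Iff.rfl

/-- The length of `V / R` is at most the number of gaps of the value semigroup: the value sets of
the modules in a chain between `R` and `V` increase strictly. -/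
theorem length_lt_four_of_tau_le_two {τ : ℤ} (hτ : τ ≤ 2)
    (h : PseudoSymmetricSubring (algebraMap R K).range (fieldVal V K) τ) :
    Module.length R (V ⧸ LinearMap.range (Algebra.linearMap R V)) < 4 := by
  set A := (algebraMap R K).range with hA
  have hmod : ∀ N : Submodule R (V ⧸ LinearMap.range (Algebra.linearMap R V)),
      ∀ a ∈ A, ∀ x ∈ (liftSubmodule N : AddSubgroup K), a * x ∈ liftSubmodule N := by
    rintro N _ ⟨r, rfl⟩ _ ⟨x, hx, rfl⟩
    refine mem_liftSubmodule.2 ⟨r • x, ?_, ?_⟩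
    · rw [map_smul]; exact N.smul_mem r hx
    · rw [Algebra.smul_def, map_mul, ← IsScalarTower.algebraMap_apply R V K]
      rfl
  have hle : ∀ N : Submodule R (V ⧸ LinearMap.range (Algebra.linearMap R V)),
      A.toAddSubgroup ≤ liftSubmodule N := by
    rintro N _ ⟨r, rfl⟩
    refine mem_liftSubmodule.2 ⟨algebraMap R V r, ?_, (IsScalarTower.algebraMap_apply R V K r).symm⟩
    have : Submodule.mkQ (LinearMap.range (Algebra.linearMap R V)) (algebraMap R V r) = 0 := by
      rw [Submodule.mkQ_apply, Submodule.Quotient.mk_eq_zero]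
      exact ⟨r, rfl⟩
    rw [this]
    exact N.zero_mem
  have hgaps : ∀ N : Submodule R (V ⧸ LinearMap.range (Algebra.linearMap R V)),
      ∀ n ∈ valSet (fieldVal V K) (liftSubmodule N), n ∉ valSet (fieldVal V K) A.toAddSubgroup →
      n ∈ ({1, 2, 4} : Set ℤ) := by
    rintro N _ ⟨x, ⟨a, -, rfl⟩, hx0, rfl⟩ hn
    exact h.gaps_subset hτ ((fieldVal_nonneg_iff hx0).2 ⟨a, rfl⟩) hn
  let G : Submodule R (V ⧸ LinearMap.range (Algebra.linearMap R V)) → Set ℤ := fun N =>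
    {n ∈ ({1, 2, 4} : Set ℤ) | n ∈ valSet (fieldVal V K) (liftSubmodule N)}
  have hfin : ({1, 2, 4} : Set ℤ).Finite := Set.toFinite _
  have hcard : ({1, 2, 4} : Set ℤ).ncard ≤ 3 := by
    refine (Set.ncard_insert_le _ _).trans ?_
    have := Set.ncard_insert_le (2 : ℤ) {4}
    rw [Set.ncard_singleton] at this
    omega
  have hGlt : ∀ N, (G N).ncard < 4 := fun N =>
    lt_of_le_of_lt (Set.ncard_le_ncard (fun n hn => hn.1) hfin) (by omega)
  have hmono : StrictMono fun N => (⟨(G N).ncard, hGlt N⟩ : Fin 4) := by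
    intro N N' hNN'
    have hlift : (liftSubmodule N : AddSubgroup K) ≤ liftSubmodule N' := by
      rintro _ ⟨a, ha, rfl⟩
      exact mem_liftSubmodule.2 ⟨a, hNN'.le ha, rfl⟩
    change (G N).ncard < (G N').ncard
    refine Set.ncard_lt_ncard ⟨fun n hn => ⟨hn.1, valSet_mono hlift hn.2⟩, fun hsub => ?_⟩
      (hfin.subset fun n hn => hn.1)
    have hle' : (liftSubmodule N' : AddSubgroup K) ≤ liftSubmodule N := by
      refine h.le_of_valSet_subset (hmod N) (h.P_le.trans (hle N)) hlift ?_
      intro n hn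
      by_cases hnA : n ∈ valSet (fieldVal V K) A.toAddSubgroup
      · exact valSet_mono (hle N) hnA
      · exact (hsub ⟨hgaps N' n hn hnA, hn⟩).2
    apply hNN'.not_ge
    intro q hq
    obtain ⟨a, rfl⟩ := Submodule.mkQ_surjective _ q
    obtain ⟨b, hb, hba⟩ := mem_liftSubmodule.1
      (hle' (mem_liftSubmodule.2 ⟨a, hq, rfl⟩))
    rwa [← IsFractionRing.injective V K hba]
  have hdim : Order.krullDim
      (Submodule R (V ⧸ LinearMap.range (Algebra.linearMap R V))) < (4 : ℕ) := by
    rw [Order.krullDim_lt_coe_iff]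
    intro l
    have := (l.map _ hmono).length_lt_card
    simpa using this
  rw [← Module.coe_length] at hdim
  have hlt : ((Module.length R (V ⧸ LinearMap.range (Algebra.linearMap R V)) : ℕ∞) : WithBot ℕ∞) <
      ((4 : ℕ∞) : WithBot ℕ∞) := hdim
  exact WithBot.coe_lt_coe.1 hlt

theorem IsKunzDomain.exists_kunzSubring (hK : IsKunzDomain R V K)
    (hlen : 4 ≤ Module.length R (V ⧸ LinearMap.range (Algebra.linearMap R V))) :
    ∃ τ : ℤ, IsFrobeniusNumberOf (valueSemigroup R V) (2 * τ) ∧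
      KunzSubring (algebraMap R K).range (fieldVal V K) τ := by
  obtain ⟨τ, hg, h⟩ := hK.exists_pseudoSymmetricSubring
  refine ⟨τ, hg, { h with three_le := ?_ }⟩
  by_contra hcon
  exact absurd hlen (not_le.2 (length_lt_four_of_tau_le_two (by omega) h))

theorem IsKunzDomain.exists_residue_representatives (hK : IsKunzDomain R V K)
    [Finite (IsLocalRing.ResidueField R)] {τ : ℤ}
    (h : KunzSubring (algebraMap R K).range (fieldVal V K) τ) :
    ∃ s : Set K, s.Finite ∧ ∀ a ∈ (algebraMap R K).range, ∃ r ∈ s, a - r ∈ h.P 1 := by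
  have hsurj := IsLocalRing.residue_surjective (R := R)
  refine ⟨Set.range fun c => algebraMap R K (Function.surjInv hsurj c), Set.finite_range _, ?_⟩
  rintro _ ⟨r, rfl⟩
  refine ⟨_, ⟨IsLocalRing.residue R r, rfl⟩, fun h0 => ?_⟩
  set r' := Function.surjInv hsurj (IsLocalRing.residue R r) with hr'
  have hmem : r - r' ∈ IsLocalRing.maximalIdeal R := by
    rw [← IsLocalRing.residue_eq_zero_iff, map_sub, hr', Function.surjInv_eq hsurj, sub_self]
  have := hK.isLocalHom
  have hmem' : algebraMap R V (r - r') ∈ IsLocalRing.maximalIdeal V := by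
    rw [IsLocalRing.mem_maximalIdeal] at hmem ⊢
    exact fun hu => hmem (isUnit_of_map_unit (algebraMap R V) _ hu)
  rw [← map_sub, IsScalarTower.algebraMap_apply R V K] at h0 ⊢
  exact one_le_fieldVal_of_mem_maximalIdeal hmem' (fun hh => h0 (by rw [hh, map_zero]))

/-- The overring is generated by any element whose value is the Frobenius number. -/
theorem range_algebraMap_adjoin {τ : ℤ}
    (h : KunzSubring (algebraMap R K).range (fieldVal V K) τ) {y : K} (hy0 : y ≠ 0)
    (hy : fieldVal V K y = 2 * τ) :
    (algebraMap (Algebra.adjoin R {y}) K).range = h.overring := by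
  have hrange : ∀ x, x ∈ (algebraMap (Algebra.adjoin R {y}) K).range ↔
      x ∈ Algebra.adjoin R {y} := by
    intro x
    constructor
    · rintro ⟨t, rfl⟩; exact t.2
    · intro hx; exact ⟨⟨x, hx⟩, rfl⟩
  ext x
  rw [hrange]
  constructor
  · intro hx
    induction hx using Algebra.adjoin_induction with
    | mem x hx =>
      rw [Set.mem_singleton_iff] at hx
      subst hx
      exact h.P_le_overring (h.mem_P_of_le hy.ge)
    | algebraMap r => exact h.le_overring ⟨r, rfl⟩
    | add x y _ _ hx hy => exact add_mem hx hy
    | mul x y _ _ hx hy => exact mul_mem hx hy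
  · rintro ⟨_, ⟨r, rfl⟩, hx⟩
    have hPy : x - algebraMap R K r ∈ Algebra.adjoin R {y} := by
      set w := x - algebraMap R K r with hw
      have hAle : ∀ a ∈ (algebraMap R K).range, a ∈ Algebra.adjoin R {y} := by
        rintro _ ⟨s, rfl⟩
        exact Subalgebra.algebraMap_mem _ s
      by_cases hw1 : w ∈ h.P (2 * τ + 1)
      · exact hAle _ (h.P_le hw1)
      have hw0 : w ≠ 0 := fun hh => hw1 (by rw [hh]; exact zero_mem _)
      have hwv : fieldVal V K w = 2 * τ := by
        have h1 := hx hw0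
        by_contra hne
        exact hw1 (h.mem_P_of_le (by omega))
      obtain ⟨a, ha, -, -, hr⟩ := h.exists_unit_mul hw0 hy0 (hwv.trans hy.symm)
      rw [hwv] at hr
      have h1 := add_mem (hAle _ (h.P_le hr))
        (mul_mem (hAle a ha) (Algebra.subset_adjoin (Set.mem_singleton y)))
      rwa [sub_add_cancel] at h1
    have := add_mem hPy (Subalgebra.algebraMap_mem _ r)
    rwa [sub_add_cancel] at this

/-- An overring of `R` has the same quotient field as `R`. -/
theorem Subalgebra.isFractionRing_of_isFractionRing (T : Subalgebra R K) : IsFractionRing T K := by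
  have : FaithfulSMul T K :=
    (faithfulSMul_iff_algebraMap_injective T K).2 Subtype.val_injective
  apply IsFractionRing.of_field
  intro z
  obtain ⟨a, b, -, rfl⟩ := IsFractionRing.div_surjective (A := R) z
  exact ⟨algebraMap R T a, algebraMap R T b, rfl⟩

theorem mk_starOperation_eq (D : Type*) [CommRing D] [IsDomain D] [Algebra D K]
    [IsFractionRing D K] {A : Subring K} (hA : (algebraMap D K).range = A) :
    #(StarOperation D K) = #{F : Set (AddSubgroup K) // IsStarFamily A F} := by
  subst hA
  exact Cardinal.mk_congr (StarOperation.equivFamily D K)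

/-- The three assertions on a single Kunz domain. -/
theorem IsKunzDomain.starOperation_card (hK : IsKunzDomain R V K)
    (hfin : Finite (IsLocalRing.ResidueField R))
    (hlen : 4 ≤ Module.length R (V ⧸ LinearMap.range (Algebra.linearMap R V))) :
    (1 < #(StarOperation R K) ∧ #(StarOperation R K) < ℵ₀) ∧
    (∀ (g : ℕ) (y : V), IsFrobeniusNumberOf (valueSemigroup R V) g →
      IsDiscreteValuationRing.addVal V y = g →
      #(StarOperation R K) <
        #(StarOperation (Algebra.adjoin R {algebraMap V K y}) K)) ∧
    ¬ IsStarRegular R K := by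
  obtain ⟨τ, hg, h⟩ := hK.exists_kunzSubring hlen
  have : IsDomain R := (IsFractionRing.injective R K).isDomain (algebraMap R K)
  have hcard := mk_starOperation_eq (K := K) R rfl
  have hfinite : Finite {F : Set (AddSubgroup K) // IsStarFamily (algebraMap R K).range F} :=
    h.finite_families (hK.exists_residue_representatives h)
  have hnontriv := h.nontrivial_family
  have hmain : ∀ (g : ℕ) (y : V), IsFrobeniusNumberOf (valueSemigroup R V) g →
      IsDiscreteValuationRing.addVal V y = g →
      #(StarOperation R K) <
        #(StarOperation (Algebra.adjoin R {algebraMap V K y}) K) := by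
    intro g y hg' hy
    have hgτ : (g : ℤ) = 2 * τ := hg'.unique hg
    have hy0 : y ≠ 0 := by
      rintro rfl
      rw [addVal_zero] at hy
      exact ENat.top_ne_natCast g hy
    have hyv : fieldVal V K (algebraMap V K y) = 2 * τ := by
      rw [fieldVal_algebraMap hy0, hy, ← hgτ]
      rfl
    have hfrac := Subalgebra.isFractionRing_of_isFractionRing (Algebra.adjoin R {algebraMap V K y})
    rw [hcard, mk_starOperation_eq (K := K) _ (range_algebraMap_adjoin h (by simpa using hy0) hyv)]
    obtain ⟨f, hf⟩ := h.exists_option_injective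
    have h1 := Cardinal.mk_le_of_injective hf
    rw [Cardinal.mk_option] at h1
    refine lt_of_lt_of_le ?_ h1
    obtain ⟨n, hn⟩ := Cardinal.lt_aleph0.1 (Cardinal.lt_aleph0_iff_finite.2 hfinite)
    rw [hn]
    exact_mod_cast Nat.lt_succ_self n
  refine ⟨⟨?_, ?_⟩, hmain, fun hreg => ?_⟩
  · rw [hcard, Cardinal.one_lt_iff_nontrivial]; exact hnontriv
  · rw [hcard, Cardinal.lt_aleph0_iff_finite]; exact hfinite
  · have h3 := h.three_le
    obtain ⟨x, hx0, hx⟩ := h.exists_val_eq (2 * τ)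
    obtain ⟨y, rfl⟩ := (fieldVal_nonneg_iff (V := V) hx0).1 (by omega)
    have hy0 : y ≠ 0 := fun hh => hx0 (by rw [hh, map_zero])
    rw [fieldVal_algebraMap hy0] at hx
    refine absurd (hreg (Algebra.adjoin R {algebraMap V K y}))
      (not_le.2 (hmain (addVal V y).toNat y ?_ (coe_toNat_addVal hy0).symm))
    rw [hx]
    exact hg

end KunzDomain

/-! ### A Kunz domain with two-element residue field -/

section Counterexample

open PowerSeries IsDiscreteValuationRing

/-- The ring of all power series over the field with two elements in which `X`, `X ^ 2`, `X ^ 3`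
and `X ^ 6` do not occur, i.e. the complete semigroup ring of the pseudo-symmetric
semigroup `{0, 4, 5, 7, 8, …}`. -/
def gapSeriesRing : Subring (ZMod 2)⟦X⟧ where
  carrier := {f | coeff 1 f = 0 ∧ coeff 2 f = 0 ∧ coeff 3 f = 0 ∧ coeff 6 f = 0}
  mul_mem' := by
    rintro f g ⟨h1, h2, h3, h6⟩ ⟨k1, k2, k3, k6⟩
    refine ⟨?_, ?_, ?_, ?_⟩ <;>
      simp [coeff_mul, Finset.Nat.antidiagonal_succ, h1, h2, h3, h6, k1, k2, k3, k6]
  one_mem' := by simp [coeff_one]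
  add_mem' := by
    rintro f g ⟨h1, h2, h3, h6⟩ ⟨k1, k2, k3, k6⟩
    simp [h1, h2, h3, h6, k1, k2, k3, k6]
  zero_mem' := by simp
  neg_mem' := by
    rintro f ⟨h1, h2, h3, h6⟩
    simp [h1, h2, h3, h6]

theorem mem_gapSeriesRing {f : (ZMod 2)⟦X⟧} : f ∈ gapSeriesRing ↔
    coeff 1 f = 0 ∧ coeff 2 f = 0 ∧ coeff 3 f = 0 ∧ coeff 6 f = 0 :=
  Iff.rfl

theorem X_pow_mul_mem_gapSeriesRing {n : ℕ} (hn : 7 ≤ n) (f : (ZMod 2)⟦X⟧) :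
    X ^ n * f ∈ gapSeriesRing := by
  refine ⟨?_, ?_, ?_, ?_⟩ <;> rw [coeff_X_pow_mul', if_neg (by omega)]

theorem C_mem_gapSeriesRing (c : ZMod 2) : C c ∈ gapSeriesRing := by
  simp [mem_gapSeriesRing]

theorem add_pow_eight {A : Type*} [CommRing A] [CharP A 2] (a b : A) :
    (a + b) ^ 8 = a ^ 8 + b ^ 8 :=
  add_pow_char_pow (p := 2) (n := 3) a b

/-- Eighth powers are additive in characteristic two, so that eighth powers of power series are
series in `X ^ 8`. -/
theorem pow_eight_mem_gapSeriesRing (f : (ZMod 2)⟦X⟧) : f ^ 8 ∈ gapSeriesRing := by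
  have : CharP (ZMod 2)⟦X⟧ 2 := charP_of_injective_ringHom (f := C) C_injective 2
  obtain ⟨h, hh⟩ : X ∣ f - C (coeff 0 f) := by rw [X_dvd_iff]; simp
  rw [← add_sub_cancel (C (coeff 0 f)) f, hh, add_pow_eight, mul_pow]
  exact add_mem (pow_mem (C_mem_gapSeriesRing _) _) (X_pow_mul_mem_gapSeriesRing (by norm_num) _)

theorem addVal_X_pow (n : ℕ) : addVal (ZMod 2)⟦X⟧ (X ^ n) = n :=
  X_irreducible.addVal_pow n

theorem exists_unit_mul_of_ne_zero {f : (ZMod 2)⟦X⟧} (hf : f ≠ 0) :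
    ∃ (n : ℕ) (u : (ZMod 2)⟦X⟧ˣ), f = (X ^ n : (ZMod 2)⟦X⟧) * u := by
  obtain ⟨n, hn⟩ := associated_pow_irreducible hf X_irreducible
  obtain ⟨u, hu⟩ := hn.symm
  exact ⟨n, u, hu.symm⟩

instance : FaithfulSMul gapSeriesRing (FractionRing (ZMod 2)⟦X⟧) := by
  rw [faithfulSMul_iff_algebraMap_injective]
  exact (IsFractionRing.injective (ZMod 2)⟦X⟧ (FractionRing (ZMod 2)⟦X⟧)).comp
    Subtype.val_injective

instance : IsFractionRing gapSeriesRing (FractionRing (ZMod 2)⟦X⟧) := by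
  refine IsFractionRing.of_field _ _ fun z => ?_
  obtain ⟨a, b, hb, rfl⟩ := IsFractionRing.div_surjective (A := (ZMod 2)⟦X⟧) z
  refine ⟨⟨X ^ 7 * a, X_pow_mul_mem_gapSeriesRing le_rfl a⟩,
    ⟨X ^ 7 * b, X_pow_mul_mem_gapSeriesRing le_rfl b⟩, ?_⟩
  have hX : algebraMap (ZMod 2)⟦X⟧ (FractionRing (ZMod 2)⟦X⟧) (X ^ 7) ≠ 0 := by
    rw [Ne, FaithfulSMul.algebraMap_eq_zero_iff]
    exact pow_ne_zero _ X_ne_zero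
  rw [IsScalarTower.algebraMap_apply gapSeriesRing (ZMod 2)⟦X⟧,
    IsScalarTower.algebraMap_apply gapSeriesRing (ZMod 2)⟦X⟧]
  change _ = algebraMap _ _ (X ^ 7 * a) / algebraMap _ _ (X ^ 7 * b)
  rw [map_mul, map_mul, mul_div_mul_left _ _ hX]

instance isLocalHom_gapSeriesRing : IsLocalHom (algebraMap gapSeriesRing (ZMod 2)⟦X⟧) := by
  refine ⟨fun a ha => ?_⟩
  obtain ⟨u, hu⟩ := ha
  have hu' : (a : (ZMod 2)⟦X⟧) = u := hu.symm
  -- the inverse is `a ^ 7 * (u⁻¹) ^ 8`, where the eighth power lies in the subring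
  refine IsUnit.of_mul_eq_one (a ^ 7 * ⟨((u⁻¹ : (ZMod 2)⟦X⟧ˣ) : (ZMod 2)⟦X⟧) ^ 8,
    pow_eight_mem_gapSeriesRing _⟩) ?_
  apply Subtype.ext
  change (a : (ZMod 2)⟦X⟧) * (a ^ 7 * (u⁻¹ : (ZMod 2)⟦X⟧ˣ) ^ 8) = 1
  rw [hu', ← mul_assoc, ← pow_succ', ← mul_pow, Units.mul_inv, one_pow]

instance : IsLocalRing gapSeriesRing :=
  RingHom.domain_isLocalRing (algebraMap gapSeriesRing (ZMod 2)⟦X⟧)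

instance : Ring.HasFiniteQuotients gapSeriesRing where
  finiteQuotient := by
    intro I hI
    obtain ⟨f, hfI, hf0⟩ := Submodule.exists_mem_ne_zero_of_ne_bot hI
    obtain ⟨n, u, hu⟩ := exists_unit_mul_of_ne_zero (f := f.1) (by simpa using hf0)
    -- a series divisible by `X ^ (n + 7)` is a multiple of `f` within the ring
    have hmem : ∀ a : gapSeriesRing, (∀ m < n + 7, coeff m a.1 = 0) → a ∈ I := by
      intro a ha
      obtain ⟨h, hh⟩ := X_pow_dvd_iff.2 ha
      have : a = ⟨X ^ 7 * (((u⁻¹ : (ZMod 2)⟦X⟧ˣ) : (ZMod 2)⟦X⟧) * h),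
          X_pow_mul_mem_gapSeriesRing le_rfl _⟩ * f := by
        apply Subtype.ext
        rw [Subring.coe_mul, hh, hu]
        linear_combination (-X ^ (n + 7) * h) * u.inv_mul
      rw [this]
      exact I.mul_mem_left _ hfI
    refine Finite.of_injective
      (fun (q : gapSeriesRing ⧸ I) (m : Fin (n + 7)) => coeff m q.out.1) fun q r hqr => ?_
    rw [← Quotient.out_eq q, ← Quotient.out_eq r]
    refine Ideal.Quotient.eq.2 (hmem _ fun m hm => ?_)
    have := congrFun hqr ⟨m, hm⟩
    simp only at this
    rw [AddSubgroupClass.coe_sub, map_sub, this, sub_self]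

theorem X_pow_sub_notMem_gapSeriesRing {a b : ℕ} (ha : a = 1 ∨ a = 2 ∨ a = 3 ∨ a = 6) (hab : a < b)
    (h : (ZMod 2)⟦X⟧) : X ^ a - X ^ b * h ∉ gapSeriesRing := by
  have : coeff a (X ^ a - X ^ b * h) = (1 : ZMod 2) := by
    rw [map_sub, coeff_X_pow_self, coeff_X_pow_mul', if_neg (by omega), sub_zero]
  rintro ⟨h1, h2, h3, h6⟩
  rcases ha with rfl | rfl | rfl | rfl
  all_goals simp_all

theorem ringKrullDim_eq_one_of_hasFiniteQuotients {A : Type*} [CommRing A] [IsDomain A]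
    [Ring.HasFiniteQuotients A] (hA : ¬ IsField A) : ringKrullDim A = 1 := by
  have h1 : Ring.KrullDimLE 1 A := Ring.krullDimLE_one_iff_of_noZeroDivisors.2
    fun I hI _ => Ring.HasFiniteQuotients.maximalOfPrime hI
  have h0 : ¬ ringKrullDim A ≤ 0 := fun h => by
    have : Ring.KrullDimLE 0 A := Ring.krullDimLE_iff.2 h
    exact hA Ring.KrullDimLE.isField_of_isDomain
  exact le_antisymm (Ring.krullDimLE_iff.1 h1) (Order.succ_le_of_lt (lt_of_not_ge h0))

theorem not_isField_gapSeriesRing : ¬ IsField gapSeriesRing := by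
  intro h
  obtain ⟨b, hb⟩ := h.mul_inv_cancel
    (a := ⟨X ^ 7 * 1, X_pow_mul_mem_gapSeriesRing le_rfl 1⟩) (by
      rw [Ne, Subtype.ext_iff]
      simp)
  have := congrArg (fun f : gapSeriesRing => coeff 0 f.1) hb
  simp at this

theorem mem_valueSemigroup_gapSeriesRing {n : ℕ} :
    n ∈ valueSemigroup gapSeriesRing (ZMod 2)⟦X⟧ ↔ n ≠ 1 ∧ n ≠ 2 ∧ n ≠ 3 ∧ n ≠ 6 := by
  constructor
  · rintro ⟨r, hr⟩
    change addVal (ZMod 2)⟦X⟧ r.1 = n at hr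
    have hr0 : r.1 ≠ 0 := by
      intro h0
      rw [h0, addVal_zero] at hr
      exact ENat.top_ne_natCast n hr
    obtain ⟨m, u, hu⟩ := exists_unit_mul_of_ne_zero hr0
    rw [hu, addVal_mul, addVal_eq_zero_of_unit, add_zero, addVal_X_pow] at hr
    obtain rfl : m = n := by exact_mod_cast hr
    have hc : coeff m r.1 ≠ 0 := by
      have := coeff_X_pow_mul (u : (ZMod 2)⟦X⟧) m 0
      rw [zero_add] at this
      rw [hu, this, coeff_zero_eq_constantCoeff_apply]
      exact (isUnit_iff_constantCoeff.1 u.isUnit).ne_zero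
    obtain ⟨h1, h2, h3, h6⟩ := r.2
    refine ⟨?_, ?_, ?_, ?_⟩ <;> rintro rfl <;> exact hc (by assumption)
  · rintro ⟨h1, h2, h3, h6⟩
    have : (X ^ n : (ZMod 2)⟦X⟧) ∈ gapSeriesRing := by
      simp [mem_gapSeriesRing, coeff_X_pow, h1.symm, h2.symm, h3.symm, h6.symm]
    exact ⟨⟨X ^ n, this⟩, addVal_X_pow n⟩

theorem isPseudoSymmetric_gapSeriesRing :
    IsPseudoSymmetric (valueSemigroup gapSeriesRing (ZMod 2)⟦X⟧) := by
  refine ⟨(Set.finite_Iio 7).subset fun n hn => ?_, 6, ⟨?_, ?_⟩, by decide, fun a ha => ?_⟩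
  · rw [Set.mem_compl_iff, SetLike.mem_coe, mem_valueSemigroup_gapSeriesRing] at hn
    rw [Set.mem_Iio]
    omega
  · rintro ⟨s, hs, h⟩
    rw [mem_valueSemigroup_gapSeriesRing] at hs
    omega
  · intro n hn
    by_contra h
    exact hn ⟨n.toNat, mem_valueSemigroup_gapSeriesRing.2 (by omega), by omega⟩
  · by_cases h : a = 1 ∨ a = 2 ∨ a = 6
    · exact .inr ⟨6 - a, mem_valueSemigroup_gapSeriesRing.2 (by omega), by omega⟩
    · exact .inl (mem_valueSemigroup_gapSeriesRing.2 (by omega))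

theorem isIntegralClosure_gapSeriesRing :
    IsIntegralClosure (ZMod 2)⟦X⟧ gapSeriesRing (FractionRing (ZMod 2)⟦X⟧) where
  algebraMap_injective := IsFractionRing.injective _ _
  isIntegral_iff := by
    intro x
    constructor
    · exact fun hx => IsIntegrallyClosed.isIntegral_iff.1 (hx.tower_top (A := (ZMod 2)⟦X⟧))
    · rintro ⟨f, rfl⟩
      refine IsIntegral.of_pow (n := 8) (by norm_num) ?_
      rw [← map_pow]
      exact isIntegral_algebraMap (R := gapSeriesRing) (x := ⟨f ^ 8, pow_eight_mem_gapSeriesRing f⟩)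

theorem isKunzDomain_gapSeriesRing :
    IsKunzDomain gapSeriesRing (ZMod 2)⟦X⟧ (FractionRing (ZMod 2)⟦X⟧) where
  integralClosure := isIntegralClosure_gapSeriesRing
  conductor_ne_zero := by
    refine ⟨algebraMap (ZMod 2)⟦X⟧ _ (X ^ 7), ?_, fun x =>
      ⟨⟨X ^ 7 * x, X_pow_mul_mem_gapSeriesRing le_rfl x⟩, ?_⟩⟩
    · rw [Ne, FaithfulSMul.algebraMap_eq_zero_iff]
      exact pow_ne_zero _ X_ne_zero
    · rw [← map_mul]
      rfl
  isLocalHom := isLocalHom_gapSeriesRing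
  residue_bijective := by
    refine ⟨RingHom.injective _, fun z => ?_⟩
    obtain ⟨f, rfl⟩ := IsLocalRing.residue_surjective z
    refine ⟨IsLocalRing.residue _ ⟨C (constantCoeff f), C_mem_gapSeriesRing _⟩, ?_⟩
    rw [IsLocalRing.ResidueField.map_residue]
    refine Ideal.Quotient.eq.2 ((IsLocalRing.mem_maximalIdeal _).2 ?_)
    change ¬ IsUnit (C (constantCoeff f) - f)
    rw [isUnit_iff_constantCoeff]
    simp
  pseudoSymmetric := isPseudoSymmetric_gapSeriesRing

theorem finite_residueField_gapSeriesRing : Finite (IsLocalRing.ResidueField gapSeriesRing) :=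
  Ring.HasFiniteQuotients.finiteQuotient
    fun h => not_isField_gapSeriesRing (IsLocalRing.isField_iff_maximalIdeal_eq.2 h)

/-- If `V` is the ring of power series and `R` is the subring `gapSeriesRing`, then the images of
`X ^ b V` for `b = 7, 6, 3, 2, 1` form a strictly increasing chain of submodules of `V / R`. -/
theorem four_le_length_gapSeriesRing : 4 ≤ Module.length gapSeriesRing
    ((ZMod 2)⟦X⟧ ⧸ LinearMap.range (Algebra.linearMap gapSeriesRing (ZMod 2)⟦X⟧)) := by
  let N := LinearMap.range (Algebra.linearMap gapSeriesRing (ZMod 2)⟦X⟧)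
  let F : ℕ → Submodule gapSeriesRing ((ZMod 2)⟦X⟧ ⧸ N) := fun b =>
    ((Ideal.span {(X ^ b : (ZMod 2)⟦X⟧)}).restrictScalars gapSeriesRing).map N.mkQ
  have hF : ∀ a b : ℕ, (a = 1 ∨ a = 2 ∨ a = 3 ∨ a = 6) → a < b → F b < F a := by
    intro a b ha hab
    refine lt_of_le_of_ne (Submodule.map_mono ?_) fun hh => ?_
    · exact Ideal.span_singleton_le_span_singleton.2 (pow_dvd_pow X hab.le)
    · have h1 : N.mkQ (X ^ a) ∈ F b := by
        rw [hh]
        exact Submodule.mem_map_of_mem (Ideal.mem_span_singleton_self _)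
      obtain ⟨f, hf, hfa⟩ := h1
      obtain ⟨h, rfl⟩ := Ideal.mem_span_singleton.1 hf
      obtain ⟨r, hr⟩ := (Submodule.Quotient.eq N).1 hfa.symm
      refine X_pow_sub_notMem_gapSeriesRing ha hab h ?_
      rw [← hr]
      exact r.2
  let b : Fin 5 → ℕ := ![7, 6, 3, 2, 1]
  have hb : StrictMono fun i => F (b i) := by
    rw [Fin.strictMono_iff_lt_succ]
    intro i
    fin_cases i <;> exact hF _ _ (by simp [b]) (by simp [b])
  have h4 := Order.LTSeries.length_le_krullDim (LTSeries.mk 4 (fun i => F (b i)) hb)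
  rw [← Module.coe_length] at h4
  exact_mod_cast h4

theorem not_houstonMimouniParkConjecture : ¬ HoustonMimouniParkConjecture := by
  intro h
  obtain ⟨⟨h1, h2⟩, -, h3⟩ := isKunzDomain_gapSeriesRing.starOperation_card
    finite_residueField_gapSeriesRing four_le_length_gapSeriesRing
  exact h3 (h _ _
    (ringKrullDim_eq_one_of_hasFiniteQuotients not_isField_gapSeriesRing) h1 h2)

end Counterexample

theorem mainTheorem1 :
    (∀ (R : Type*) (V : Type*) (K : Type*) [CommRing R] [CommRing V] [IsDomain V]
        [IsDiscreteValuationRing V] [Field K] [Algebra R V] [Algebra R K] [Algebra V K]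
        [IsScalarTower R V K] [IsFractionRing R K] [IsFractionRing V K]
        [IsLocalRing R] [IsNoetherianRing R],
        IsKunzDomain R V K →
        Finite (IsLocalRing.ResidueField R) →
        4 ≤ Module.length R (V ⧸ LinearMap.range (Algebra.linearMap R V)) →
        (1 < #(StarOperation R K) ∧ #(StarOperation R K) < ℵ₀) ∧
        (∀ (g : ℕ) (y : V), IsFrobeniusNumberOf (valueSemigroup R V) g →
          IsDiscreteValuationRing.addVal V y = g →
          #(StarOperation R K) <
            #(StarOperation (Algebra.adjoin R {algebraMap V K y}) K)) ∧
        ¬ IsStarRegular R K) ∧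
    ¬ HoustonMimouniParkConjecture :=
  ⟨fun _ _ _ => fun hK hfin hlen => hK.starOperation_card hfin hlen,
    not_houstonMimouniParkConjecture⟩
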